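/- **Setting.** Let $E\subseteq\mathbb R$ be a nonempty open interval (bounded or not) and $\rho=e^{-V}$ a weight on $E$ (zero outside $E$) with $V'=g/f$, where $f,g$ are real polynomials, $f>0$ on $E$, and $f\rho$ vanishes at the endpoints of $E$. For complex times $t=(t_1,t_2,\dots)$, only finitely many nonzero, put $$\rho_t(z)=e^{-V(z)+\sum_k t_kz^k},\qquad \tilde V=\tfrac12(V+\log f),\qquad \tilde\rho_t(z)=\Big(\frac{\rho_{2t}(z)}{f(z)}\Big)^{1/2}=e^{-\tilde V(z)+\sum_k t_kz^k}.$$ Let $\langle\varphi,\psi\rangle^{sy}_t=\int\varphi\psi\rho_t\,dz$, $\mu_{ij}(t)=\langle z^i,z^j\rangle_t^{sy}$, $m_n=(\mu_{ij})_{0\le i,j<n}$, and let $$\mathbf n_t=\sqrt{f/\rho_t}\,\tfrac{d}{dz}\sqrt{f\rho_t}.$$ Its inverse $\mathbf n_t^{-1}$ on polynomials is a two-sided inverse that is skew-symmetric for $\langle\,,\rangle^{sy}_t$. Let $\varepsilon(x)=1$ for $x\ge0$, $\varepsilon(x)=-1$ for $x<0$, and $$\langle\varphi,\psi\rangle_t^{sk}=\tfrac12\iint\varphi(x)\psi(y)\,\varepsilon(x-y)\,\tilde\rho_t(x)\tilde\rho_t(y)\,dx\,dy,\qquad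 \tilde\mu_{ij}(t)=\langle x^i,y^j\rangle^{sk}_t,\quad \tilde m_n=(\tilde\mu_{ij})_{0\le i,j<n}.$$ $\Lambda$ is the shift matrix ($\Lambda\chi(z)=z\chi(z)$ for $\chi(z)=(1,z,z^2,\dots)^{\top}$), $\partial$ is the matrix with $\partial\chi=\frac{d}{dz}\chi$, and $J$ is block-diagonal with blocks $\begin{pmatrix}0&1\\-1&0\end{pmatrix}$. $\mathcal G_{\mathbf k}$ is the group of invertible lower-triangular matrices whose diagonal $2\times2$ blocks are nonzero multiples of the identity, $\mathbf k$ is its Lie algebra (lower-triangular, diagonal $2\times 2$ blocks multiples of the identity), and $\pi_{\mathbf k}$ is the projection onto $\mathbf k$ along $\{a: Ja^{\top}J=a\}$. $(A)_{sk}$ is the projection onto skew-symmetric matrices along lower-triangular ones. The Haar (Lebesgue) measures $dX$ on the Hermitean matrices $\mathcal H_n$ and on the real symmetric matrices $\mathcal S_n$ are normalized so that $dX=\Delta(z)^2dz\,dU$, resp. $dX=|\Delta(z)|\,dz\,dU$, with $\int dU=1$. Matrix integrals run over matrices with spectrum in $E$. Time derivatives are taken within the set of times for which the weights concerned have finite moments.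 **(1) Toda lattice.** Let $t$ be such that all moments of $\rho_t$ converge absolutely. Then, the integral converging absolutely, $$\tau_n(t):=\det m_n(t)=\frac1{n!}\int_{\mathcal H_n}e^{\mathrm{Tr}(-V(X)+\sum_k t_kX^k)}dX,$$ $\tau_n(t)\ne0$ for real $t$, and $\partial m_\infty/\partial t_k=\Lambda^km_\infty=m_\infty\Lambda^{\top k}$. If all $\tau_n(t)\neq0$, there is a lower-triangular $S$ with $m_\infty=S^{-1}S^{\top-1}$; for each such $S$ the $p_n=(S\chi)_n$ are orthonormal polynomials of degree $n$ for $\langle\,,\rangle_t^{sy}$, $S_{nn}^2=\tau_n/\tau_{n+1}$, and, with a suitable choice of signs (branches) of $S$ near $t$, $L=S\Lambda S^{-1}$ satisfies $\partial L/\partial t_k=[\tfrac12(L^k)_{sk},L]$. **(2) Symmetric matrix integrals.** Let $t$ be such that all moments of $\tilde\rho_t$ converge absolutely. Then the integrals defining $\langle\,,\rangle^{sk}_t$ converge absolutely, $\tilde m_\infty$ is skew-symmetric, $\partial\tilde m_\infty/\partial t_k=\Lambda^k\tilde m_\infty+\tilde m_\infty\Lambda^{\top k}$, $$\tilde\tau_{2n}(t):=\mathrm{pf}(\tilde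 m_{2n}(t))=\frac1{(-2)^n(2n)!}\int_{\mathcal S_{2n}}e^{\mathrm{Tr}(-\tilde V(X)+\sum_k t_kX^k)}dX$$ with an absolutely convergent integral, and $\tilde\tau_{2n}(t)\ne0$ for real $t$. **(3) The map.** Let $t$ be such that all moments of $\rho_{2t}$ and of $\tilde\rho_t$ converge absolutely. Then $\mathbf n_{2t}^{-1}$ exists, and $\langle\varphi,\mathbf n_{2t}^{-1}\psi\rangle_{2t}^{sy}=\langle\varphi,\psi\rangle_t^{sk}$ for all polynomials $\varphi,\psi$. Suppose all $\tau_n(2t)\ne0$, let $S=S(2t)$, $p=S\chi$, $L=S\Lambda S^{-1}$ and $M=S(\partial+\tfrac12\sum_k k\,(2t_k)\Lambda^{k-1})S^{-1}$ be as in (1) at time $2t$. Then $\mathcal N(2t)=f(L)M-\frac{f'+g}2(L)$ satisfies $\mathbf n_{2t}\,p=\mathcal N p$, and the matrix $\mathcal U=(\langle \mathbf n_{2t}^{-1}p_i,p_j\rangle_{2t}^{sy})_{ij}$ of $\mathbf n_{2t}^{-1}$ is skew-symmetric with $\mathcal N\,\mathcal U=\mathcal U\,\mathcal N=I$; write $\mathcal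 N^{-1}(2t)=\mathcal U$. If moreover all $\tilde\tau_{2n}(t)\neq0$, there is $O=O(2t)$ such that $$-\mathcal N^{-1}(2t)=O^{-1}JO^{\top-1},\qquad O\text{ is lower-triangular},\qquad OS\in\mathcal G_{\mathbf k}.$$ For each such $O$, the $q_n=(O\,p(2t,z))_n$ are polynomials of degree $n$, skew-orthonormal for the skew inner product: $\langle q_i,q_j\rangle^{sk}_t=J_{ij}$; the functions $\tilde\tau_{2n}$ are the Pfaff-lattice $\tau$-functions, i.e. $(OS)_{2n,2n}^2=\tilde\tau_{2n}(t)/\tilde\tau_{2n+2}(t)$; and, with a suitable choice of signs (branches) of $S,O$ near $t$, $\tilde L(t)=O(2t)L(2t)O(2t)^{-1}$ satisfies the Pfaff lattice $\partial\tilde L/\partial t_k=[-\pi_{\mathbf k}\tilde L^k,\tilde L]$. (In the time derivatives of $L$ and $\tilde L$, which are taken entry by entry, each of the relations $\langle p_i,p_j\rangle^{sy}=\delta_{ij}$ and $\langle q_i,q_j\rangle^{sk}=J_{ij}$ is required to hold on some neighbourhood of the time considered, which may depend on $i,j$.) -/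

import Mathlib

open Polynomial Filter Topology MeasureTheory

noncomputable section

namespace TodaPfaff

/-! Semi-infinite matrices. Every product formed below has only finitely many nonzero terms in each
entry (one factor has finite rows, or the other one has finite columns). -/

/-- Semi-infinite complex matrices, indexed by `0, 1, 2, …`. -/
abbrev IMat := Matrix ℕ ℕ ℂ

/-- The product of semi-infinite matrices. -/
def imul (A B : IMat) : IMat := fun i j => ∑ᶠ k, A i k * B k j

infixl:70 " ⬝∞ " => imul

/-- Powers of a semi-infinite matrix. -/
def ipow (A : IMat) : ℕ → IMat
  | 0 => 1
  | k + 1 => ipow A k ⬝∞ A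

/-- The polynomial `f` evaluated at a semi-infinite matrix. -/
def ieval (f : ℂ[X]) (A : IMat) : IMat := fun i j => f.sum fun k a => a * ipow A k i j

/-- The commutator. -/
def icomm (A B : IMat) : IMat := A ⬝∞ B - B ⬝∞ A

/-- Invertible lower-triangular matrices. -/
def IsLower (A : IMat) : Prop := (∀ i j, i < j → A i j = 0) ∧ ∀ i, A i i ≠ 0

/-- The inverse of an invertible lower-triangular matrix: its `(i, j)` entry is the `(i, j)` entry of
the inverse of any sufficiently large finite upper left corner. -/
def linv (A : IMat) : IMat := fun i j =>
  (Matrix.of fun a b : Fin (i + j + 1) => A a b)⁻¹ ⟨i, by omega⟩ ⟨j, by omega⟩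

/-- The shift matrix `Λ`, so that `Λ χ(z) = z χ(z)` for `χ(z) = (1, z, z², …)`. -/
def shift : IMat := fun i j => if j = i + 1 then 1 else 0

/-- The matrix `∂` with `∂ χ(z) = (d/dz) χ(z)`. -/
def partialMat : IMat := fun i j => if i = j + 1 then (i : ℂ) else 0

/-- The block-diagonal matrix `J` with blocks `(0, 1; -1, 0)`. -/
def Jmat : IMat := fun i j =>
  if i % 2 = 0 ∧ j = i + 1 then 1 else if j % 2 = 0 ∧ i = j + 1 then -1 else 0

/-- The involution `a ↦ J aᵀ J`. -/
def Jinv (A : IMat) : IMat := Jmat ⬝∞ A.transpose ⬝∞ Jmat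

/-- The strictly upper part with respect to `2 × 2` blocks. -/
def blockUp (A : IMat) : IMat := fun i j => if i / 2 < j / 2 then A i j else 0

/-- The strictly lower part with respect to `2 × 2` blocks. -/
def blockLow (A : IMat) : IMat := fun i j => if j / 2 < i / 2 then A i j else 0

/-- The block-diagonal part with respect to `2 × 2` blocks. -/
def blockDiag (A : IMat) : IMat := fun i j => if i / 2 = j / 2 then A i j else 0

/-- The projection onto the algebra of lower-triangular matrices whose diagonal `2 × 2` blocks are
multiples of the identity, along `{a | J aᵀ J = a}`. -/
def piK (A : IMat) : IMat :=
  (blockLow A - Jinv (blockUp A)) + (1 / 2 : ℂ) • (blockDiag A - Jinv (blockDiag A))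

/-- The group of invertible lower-triangular matrices whose diagonal `2 × 2` blocks are
nonzero multiples of the identity. -/
def InGk (Q : IMat) : Prop :=
  IsLower Q ∧ ∀ n, Q (2 * n + 1) (2 * n) = 0 ∧ Q (2 * n + 1) (2 * n + 1) = Q (2 * n) (2 * n)

/-- The projection onto skew-symmetric matrices along lower-triangular matrices. -/
def skewPart (A : IMat) : IMat := fun i j =>
  if i < j then A i j else if j < i then -A j i else 0

/-- The Pfaffian of the upper left `2n × 2n` corner of a skew-symmetric matrix. -/
def pf (A : IMat) (n : ℕ) : ℂ :=
  (1 / (2 ^ n * n.factorial : ℂ)) * ∑ σ : Equiv.Perm (Fin (2 * n)),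
    ((Equiv.Perm.sign σ : ℤ) : ℂ) *
      ∏ k : Fin n, A (σ ⟨2 * k, by omega⟩) (σ ⟨2 * k + 1, by omega⟩)

/-- The polynomial of degree at most `n` whose coefficients form row `n` of a lower-triangular
matrix, i.e. the `n`-th entry of `S χ(z)`. -/
def rowPoly (S : IMat) (n : ℕ) : ℂ[X] := ∑ j ∈ Finset.range (n + 1), monomial j (S n j)

/-- The `n`-th entry of `O p(z)`, where `p(z) = S χ(z)` and `O` is lower-triangular. -/
def mapPoly (O S : IMat) (n : ℕ) : ℂ[X] := ∑ j ∈ Finset.range (n + 1), C (O n j) * rowPoly S j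

/-! Times, weights, moments. -/

/-- Complex times `t = (t₁, t₂, …)`, only finitely many of them nonzero. -/
abbrev Times := ℕ+ →₀ ℂ

/-- The polynomial `∑ tₖ zᵏ`. -/
def xi (t : Times) : ℂ[X] := t.sum fun k a => monomial (k : ℕ) a

/-- The function on the real line given by a complex polynomial. -/
def fn (φ : ℂ[X]) : ℝ → ℂ := fun z => φ.eval (z : ℂ)

/-- `ε(x) = 1` for `x ≥ 0` and `-1` for `x < 0`. -/
def eps (x : ℝ) : ℂ := if 0 ≤ x then 1 else -1

/-- A weight `ρ = e^{-V}` on an open interval `E` (bounded or not) with `-ρ'/ρ = V' = g/f`, `f, g`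
polynomials, `f > 0` on `E`, such that `f ρ` vanishes at the finite endpoints of `E`. (That it vanishes
at the infinite ones follows from the finiteness of the moments.) -/
structure Weight where
  E : Set ℝ
  V : ℝ → ℝ
  f : ℝ[X]
  g : ℝ[X]
  isOpen_E : IsOpen E
  ordConnected_E : E.OrdConnected
  nonempty_E : E.Nonempty
  f_pos : ∀ z ∈ E, 0 < f.eval z
  hasDerivAt_V : ∀ z ∈ E, HasDerivAt V (g.eval z / f.eval z) z
  boundary : ∀ a ∈ frontier E, Tendsto (fun z => f.eval z * Real.exp (-V z)) (𝓝[E] a) (𝓝 0)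

variable (W : Weight)

namespace Weight

/-- `ρ_t = e^{-V + ∑ tₖ zᵏ}` on `E`, and `0` elsewhere. -/
def rho (t : Times) : ℝ → ℂ :=
  W.E.indicator fun z => Complex.exp (-(W.V z : ℂ) + (xi t).eval (z : ℂ))

/-- `Ṽ = (V + log f) / 2`. -/
def tV (z : ℝ) : ℝ := (W.V z + Real.log (W.f.eval z)) / 2

/-- `ρ̃_t = e^{-Ṽ + ∑ tₖ zᵏ}` on `E`, and `0` elsewhere. -/
def trho (t : Times) : ℝ → ℂ :=
  W.E.indicator fun z => Complex.exp (-(W.tV z : ℂ) + (xi t).eval (z : ℂ))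

/-- All moments of `ρ_t` converge absolutely. -/
def MomFinite (t : Times) : Prop := ∀ j : ℕ, Integrable fun z : ℝ => (z : ℂ) ^ j * W.rho t z

/-- All moments of `ρ̃_t` converge absolutely. -/
def TMomFinite (t : Times) : Prop := ∀ j : ℕ, Integrable fun z : ℝ => (z : ℂ) ^ j * W.trho t z

/-- The symmetric inner product `⟨φ, ψ⟩_t = ∫ φ ψ ρ_t dz`. -/
def innerSy (t : Times) (φ ψ : ℝ → ℂ) : ℂ := ∫ z : ℝ, φ z * ψ z * W.rho t z

/-- The moment matrix `m_∞(t)`. -/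
def mom (t : Times) : IMat := fun i j => W.innerSy t (fn (X ^ i)) (fn (X ^ j))

/-- `τ_n(t) = det m_n(t)`. -/
def tau (n : ℕ) (t : Times) : ℂ := (Matrix.of fun i j : Fin n => W.mom t i j).det

/-- The integrand `φ(x) ψ(y) ε(x - y) ρ̃_t(x) ρ̃_t(y)`. -/
def skIntegrand (t : Times) (φ ψ : ℝ → ℂ) (w : ℝ × ℝ) : ℂ :=
  φ w.1 * ψ w.2 * eps (w.1 - w.2) * W.trho t w.1 * W.trho t w.2

/-- The skew inner product `½ ∬ φ(x) ψ(y) ε(x - y) ρ̃_t(x) ρ̃_t(y) dx dy`. -/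
def innerSk (t : Times) (φ ψ : ℝ → ℂ) : ℂ := (1 / 2 : ℂ) * ∫ w : ℝ × ℝ, W.skIntegrand t φ ψ w

/-- The skew moment matrix `m̃_∞(t)`. -/
def tmom (t : Times) : IMat := fun i j => W.innerSk t (fn (X ^ i)) (fn (X ^ j))

/-- `τ̃_{2n}(t) = pf m̃_{2n}(t)`. -/
def ttau (n : ℕ) (t : Times) : ℂ := pf (W.tmom t) n

/-! The operator `n_t`, its inverse, and their matrices. -/

/-- `n_t φ = √(f/ρ_t) (d/dz) (√(f ρ_t) φ)`, a function on `E`. -/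
def nOp (t : Times) (φ : ℝ → ℂ) (z : ℝ) : ℂ :=
  Complex.exp (((Real.log (W.f.eval z) + W.V z : ℝ) - (xi t).eval (z : ℂ)) / 2) *
    deriv (fun y : ℝ =>
      Complex.exp (((Real.log (W.f.eval y) - W.V y : ℝ) + (xi t).eval (y : ℂ)) / 2) * φ y) z

/-- `n_t` on polynomials: `(d/dz) f - (f' + g_t)/2` with `g_t = g - f ∑ k tₖ z^{k-1}`. -/
def nPoly (t : Times) (φ : ℂ[X]) : ℂ[X] :=
  derivative (W.f.map Complex.ofRealHom * φ) -
    C (1 / 2) * (derivative (W.f.map Complex.ofRealHom) +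
      (W.g.map Complex.ofRealHom - W.f.map Complex.ofRealHom * derivative (xi t))) * φ

/-- `u` is the operator `n_t⁻¹` on polynomials: a two-sided inverse of `n_t` which is
skew-symmetric for `⟨ , ⟩_t`. Its values are functions on `E`, in general not polynomials. -/
def IsSkewInverse (t : Times) (u : ℂ[X] →ₗ[ℂ] (ℝ → ℂ)) : Prop :=
  (∀ φ, DifferentiableOn ℝ (u φ) W.E) ∧
  (∀ φ, ∀ z ∈ W.E, W.nOp t (u φ) z = fn φ z) ∧
  (∀ φ, ∀ z ∈ W.E, u (W.nPoly t φ) z = fn φ z) ∧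
  (∀ φ ψ, Integrable fun z : ℝ => fn φ z * u ψ z * W.rho t z) ∧
  ∀ φ ψ, W.innerSy t (u φ) (fn ψ) = -W.innerSy t (fn φ) (u ψ)

end Weight

/-- `m = S⁻¹ (Sᵀ)⁻¹` with `S` lower-triangular. -/
def IsBorel (S m : IMat) : Prop := IsLower S ∧ m = linv S ⬝∞ (linv S).transpose

/-- `L = S Λ S⁻¹`. -/
def Lmat (S : IMat) : IMat := S ⬝∞ shift ⬝∞ linv S

/-- `M = S (∂ + ½ ∑ k tₖ Λ^{k-1}) S⁻¹`. -/
def Mmat (t : Times) (S : IMat) : IMat :=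
  S ⬝∞ (partialMat + (1 / 2 : ℂ) • ieval (derivative (xi t)) shift) ⬝∞ linv S

/-- `𝒩(t) = f(L) M - ((f' + g)/2)(L)`. -/
def Weight.Nmat (t : Times) (S : IMat) : IMat :=
  ieval (W.f.map Complex.ofRealHom) (Lmat S) ⬝∞ Mmat t S -
    ieval (C (1 / 2) * (derivative W.f + W.g).map Complex.ofRealHom) (Lmat S)

/-- The matrix `𝒰` of the operator `u` in the basis `p = S χ`, i.e. `u p = 𝒰 p` after taking the
inner product with each `p_j`: `𝒰_{ij} = ⟨u p_i, p_j⟩_t`. -/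
def Weight.Umat (t : Times) (S : IMat) (u : ℂ[X] →ₗ[ℂ] (ℝ → ℂ)) : IMat := fun i j =>
  W.innerSy t (u (rowPoly S i)) (fn (rowPoly S j))

/-- The three conditions on the map `O`, for a given matrix `𝒰`: `-𝒰 = O⁻¹ J (Oᵀ)⁻¹`, `O` is
lower-triangular, and `O S` has nonzero scalar diagonal `2 × 2` blocks. -/
def IsMapO (U S O : IMat) : Prop :=
  IsLower O ∧ -U = linv O ⬝∞ Jmat ⬝∞ (linv O).transpose ∧ InGk (O ⬝∞ S)

/-! Matrix integrals. -/

/-- `e^{Tr(-V(X) + ∑ tₖ Xᵏ)}`. -/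
def expTr {n : ℕ} (V : ℝ → ℝ) (t : Times) (X : Matrix (Fin n) (Fin n) ℂ) : ℂ :=
  Complex.exp (Matrix.trace (-(cfc V X) + t.sum fun k a => a • X ^ (k : ℕ)))

/-- The Vandermonde determinant `∏_{i<j} (z_i - z_j)`. -/
def vand {n : ℕ} (z : Fin n → ℝ) : ℝ := ∏ i, ∏ j ∈ Finset.Ioi i, (z i - z j)

/-- The coordinates `X_{ii}`, `(Re X_{ij}, Im X_{ij})` with `i < j`, of a Hermitean matrix. -/
abbrev HermCoord (n : ℕ) := (Fin n → ℝ) × ({p : Fin n × Fin n // p.1 < p.2} → ℝ × ℝ)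

/-- The Hermitean matrix with given coordinates. -/
def hermMat {n : ℕ} (c : HermCoord n) : Matrix (Fin n) (Fin n) ℂ := fun i j =>
  if h : i < j then ⟨(c.2 ⟨(i, j), h⟩).1, (c.2 ⟨(i, j), h⟩).2⟩
  else if h : j < i then ⟨(c.2 ⟨(j, i), h⟩).1, -(c.2 ⟨(j, i), h⟩).2⟩
  else (c.1 i : ℂ)

/-- The coordinates `X_{ij}`, `i ≤ j`, of a real symmetric matrix. -/
abbrev SymCoord (n : ℕ) := {p : Fin n × Fin n // p.1 ≤ p.2} → ℝ

/-- The symmetric matrix with given coordinates. -/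
def symMat {n : ℕ} (c : SymCoord n) : Matrix (Fin n) (Fin n) ℂ := fun i j =>
  if h : i ≤ j then (c ⟨(i, j), h⟩ : ℂ) else (c ⟨(j, i), le_of_not_ge h⟩ : ℂ)

/-- The mass that `|Δ(z)|^β dz₁ ⋯ dz_n` gives to the ball `∑ z_i² ≤ 1`. -/
def radialMass (β n : ℕ) : ℝ := ∫ z in {z : Fin n → ℝ | ∑ i, z i ^ 2 ≤ 1}, |vand z| ^ β

/-- The Haar measure `∏ dX_{ii} ∏_{i<j} dRe X_{ij} dIm X_{ij}` on Hermitean matrices, normalized so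
that in its polar decomposition `dX = Δ(z)² dz₁ ⋯ dz_n dU` the angular part `dU` has total mass `1`:
the ball `Tr X² ≤ 1` gets the mass of the corresponding ball of eigenvalues. -/
def hermHaar (n : ℕ) : Measure (HermCoord n) :=
  ENNReal.ofReal (radialMass 2 n /
    (volume : Measure (HermCoord n)).real
      {c | (Matrix.trace (hermMat c * hermMat c)).re ≤ 1}) • volume

/-- The Haar measure `∏_{i≤j} dX_{ij}` on real symmetric matrices, normalized so that in its polar
decomposition `dX = |Δ(z)| dz₁ ⋯ dz_n dU` the angular part `dU` has total mass `1`. -/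
def symHaar (n : ℕ) : Measure (SymCoord n) :=
  ENNReal.ofReal (radialMass 1 n /
    (volume : Measure (SymCoord n)).real
      {c | (Matrix.trace (symMat c * symMat c)).re ≤ 1}) • volume

/-- Hermitean matrices with all eigenvalues in `E`. -/
def hermSet (E : Set ℝ) (n : ℕ) : Set (HermCoord n) := {c | spectrum ℝ (hermMat c) ⊆ E}

/-- Symmetric matrices with all eigenvalues in `E`. -/
def symSet (E : Set ℝ) (n : ℕ) : Set (SymCoord n) := {c | spectrum ℝ (symMat c) ⊆ E}

/-! Time evolution. -/

/-- `t + s eₖ`. -/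
def move (t : Times) (k : ℕ+) (s : ℂ) : Times := t + Finsupp.single k s

/-- `F` (a function of `s`) has derivative `D` at `s = 0`, entry by entry, within the set `A`. -/
def HasEntryDeriv (F : ℂ → IMat) (D : IMat) (A : Set ℂ) : Prop :=
  ∀ i j, HasDerivWithinAt (fun s => F s i j) (D i j) A 0

/-- Locally in `s`, a choice `S(s)` of the dressing matrix at time `t + s eₖ` extending `S = S(0)`:
each of the relations `⟨p_i, p_j⟩ = δ_{ij}` holds for `s` near `0`. -/
def IsTodaCurve (t : Times) (k : ℕ+) (A : Set ℂ) (S : IMat) (Sc : ℂ → IMat) : Prop :=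
  Sc 0 = S ∧ (∀ s, IsLower (Sc s)) ∧
  ∀ i j, ∀ᶠ s in 𝓝[A] 0,
    W.innerSy (move t k s) (fn (rowPoly (Sc s) i)) (fn (rowPoly (Sc s) j)) = (1 : IMat) i j

/-- Locally in `s`, a choice of `S` at time `2(t + s eₖ)` and of `O` at time `2(t + s eₖ)`,
extending given ones at `s = 0`: each of the relations `⟨p_i, p_j⟩^{sy} = δ_{ij}` and
`⟨q_i, q_j⟩^{sk} = J_{ij}` holds for `s` near `0`. -/
def IsPfaffCurve (t : Times) (k : ℕ+) (A : Set ℂ) (S O : IMat) (Sc Oc : ℂ → IMat) : Prop :=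
  Sc 0 = S ∧ Oc 0 = O ∧ (∀ s, IsLower (Sc s) ∧ IsLower (Oc s) ∧ InGk (Oc s ⬝∞ Sc s)) ∧
  ∀ i j, ∀ᶠ s in 𝓝[A] 0,
    W.innerSy ((2 : ℂ) • move t k s) (fn (rowPoly (Sc s) i)) (fn (rowPoly (Sc s) j))
      = (1 : IMat) i j ∧
    W.innerSk (move t k s) (fn (mapPoly (Oc s) (Sc s) i)) (fn (mapPoly (Oc s) (Sc s) j))
      = Jmat i j

/-- `L̃ = O L O⁻¹`. -/
def tLmat (O S : IMat) : IMat := O ⬝∞ Lmat S ⬝∞ linv O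

end TodaPfaff

end

open TodaPfaff

/-!
**Factorization and time evolution.** Both factorizations of moment matrices are one Gram–Schmidt
process (`BlockForm.gs`) for a bilinear form with a prescribed block-diagonal normal form `η`: the
identity in the symmetric case, `J` in the skew case. It succeeds because a vanishing pivot would
make a leading minor, resp. a leading Pfaffian, vanish (`exists_isBorel`, `exists_inGk_congr`). For
a curve of moment matrices with `m(0) = Q⁻¹ η Qᵀ⁻¹`, the process is applied to `Q m(s) Qᵀ`, which
equals `η` at `s = 0`. It gives a curve `D(s)` with `D(0) = 1`, and hence `Q(s) = D(s) Q` dresses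
`m(s)`. Each entry of `D` only involves finitely many moments, so that it is differentiable, and
differentiating `D (Q m Qᵀ) Dᵀ = η` determines `D'(0)`: it is minus the projection of `L̃ᵏ` to the
triangular subalgebra `𝐤` in the skew case, and minus half the projection of `Lᵏ` to all
lower-triangular matrices in the symmetric case. This is the Lax equation (`exists_toda_curve`,
`exists_pfaff_curve`). The time derivative of an integral within the set of times with finite
moments is taken by dominated convergence; the set contains all imaginary shifts of a time, so that
derivatives within it are unique.

**Matrix integrals.** The formulas of Andréief and de Bruijn express `τ_n` and `τ̃_{2n}` as
integrals over `ℝⁿ` against `Δ²` and `|Δ|` (`det_moments`, `pf_moments`); at real times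
they are evidently nonzero. The passage to matrices is the Weyl integration formula
`MatrixModel.integral_eig`. It is proved without the geometry of the polar decomposition. For the
Gaussian density on matrices, and for `|Δ|^β e^{-∑ zᵢ²/2}` on `ℝⁿ`, integration by parts gives the
same loop equations for the expectations of products of power sums `Tr Xᵏ`, and these equations
determine all the expectations up to the total mass (`LoopEq.unique`). As both measures have
exponential moments, their symmetrizations agree up to a constant (`sum_map_perm_eq`), and the mass
of the ball `Tr X² ≤ 1` identifies the constant.

**The map.** The operator `n_{2t}` is `φ ↦ ρ̃_t⁻¹ (√(f ρ_{2t}) φ)'`, so an inverse is obtained by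
dividing the primitive `½ ∫ ε(z - y) ψ(y) ρ̃_t(y) dy` by `√(f ρ_{2t})`. Since
`ρ_{2t} = ρ̃_t √(f ρ_{2t})`, its symmetric inner product with `φ` is `⟨φ, ψ⟩^{sk}_t` (`innerSy_skInv`).
It is also a left inverse because `√(f ρ_{2t}) φ` vanishes at both ends of `E`, at an infinite one because it is
integrable and has a limit there (`TMomFinite.skPrim_nPoly`). Any other skew inverse has the same
inner products with polynomials (`IsSkewInverse.innerSy_eq`). Therefore the matrix of the inverse
is `𝒰 = -S m̃ Sᵀ`, and the condition on `O` says that `O S` dresses `m̃` to `J`, which reduces the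
statements on `q_n`, `τ̃_{2n}` and `L̃ = (O S) Λ (O S)⁻¹` to those on the skew factorization.
-/

/-! ### Semi-infinite matrices -/

noncomputable section

namespace TodaPfaff

/-- Matrices all of whose rows are finitely supported. They form an algebra, and they act from the
left on arbitrary semi-infinite matrices. -/
def RowFin (A : IMat) : Prop := ∀ i, (Function.support (A i)).Finite

/-- Lower-triangular matrices, not necessarily invertible. -/
def IsLT (A : IMat) : Prop := ∀ i j, i < j → A i j = 0

lemma IsLower.isLT {A : IMat} (h : IsLower A) : IsLT A := h.1

lemma IsLT.rowFin {A : IMat} (h : IsLT A) : RowFin A := fun i =>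
  (Finset.range (i + 1)).finite_toSet.subset fun j hj => by
    by_contra hc
    simp only [Finset.coe_range, Set.mem_Iio, not_lt] at hc
    exact hj (h i j (by omega))

lemma IsLower.rowFin {A : IMat} (h : IsLower A) : RowFin A := h.isLT.rowFin

lemma RowFin.exists_finset {A : IMat} (h : RowFin A) (i : ℕ) :
    ∃ s : Finset ℕ, ∀ k, k ∉ s → A i k = 0 :=
  ⟨(h i).toFinset, fun k hk => by simpa using hk⟩

lemma rowFin_of_finset {A : IMat} (h : ∀ i, ∃ s : Finset ℕ, ∀ k, k ∉ s → A i k = 0) : RowFin A :=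
  fun i => by
    obtain ⟨s, hs⟩ := h i
    exact s.finite_toSet.subset fun k hk => by
      by_contra hc
      exact hk (hs k (by simpa using hc))

lemma imul_eq_sum {A B : IMat} {i j : ℕ} (s : Finset ℕ) (h : ∀ k, k ∉ s → A i k * B k j = 0) :
    (A ⬝∞ B) i j = ∑ k ∈ s, A i k * B k j :=
  finsum_eq_finsetSum_of_support_subset _ fun k hk => by
    by_contra hc
    exact hk (h k (by simpa using hc))

lemma IsLT.imul_apply {A : IMat} (hA : IsLT A) (B : IMat) (i j : ℕ) :
    (A ⬝∞ B) i j = ∑ k ∈ Finset.range (i + 1), A i k * B k j :=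
  imul_eq_sum _ fun k hk => by rw [hA i k (by simpa using hk), zero_mul]

lemma imul_transpose (A B : IMat) : (A ⬝∞ B).transpose = B.transpose ⬝∞ A.transpose := by
  ext i j
  simp only [Matrix.transpose_apply, imul, mul_comm]

lemma imul_assoc_of_finset {A B C : IMat}
    (h : ∀ i l, ∃ s t : Finset ℕ, (∀ j, j ∉ s → A i j = 0) ∧
      ∀ j ∈ s, ∀ k, k ∉ t → B j k * C k l = 0) :
    A ⬝∞ B ⬝∞ C = A ⬝∞ (B ⬝∞ C) := by
  ext i l
  obtain ⟨s, t, hs, ht⟩ := h i l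
  have h1 : ∀ k, (A ⬝∞ B) i k = ∑ j ∈ s, A i j * B j k := fun k =>
    imul_eq_sum s fun j hj => by rw [hs j hj, zero_mul]
  rw [imul_eq_sum (A := A ⬝∞ B) t, imul_eq_sum (A := A) s fun j hj => by rw [hs j hj, zero_mul]]
  · simp_rw [h1, Finset.sum_mul]
    rw [Finset.sum_comm]
    refine Finset.sum_congr rfl fun j hj => ?_
    rw [imul_eq_sum t (ht j hj), Finset.mul_sum]
    exact Finset.sum_congr rfl fun k _ => mul_assoc _ _ _
  · intro k hk
    rw [h1, Finset.sum_mul]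
    exact Finset.sum_eq_zero fun j hj => by rw [mul_assoc, ht j hj k hk, mul_zero]

/-- Associativity when the two left factors have finite rows. -/
lemma imul_assoc {A B : IMat} (hA : RowFin A) (hB : RowFin B) (C : IMat) :
    A ⬝∞ B ⬝∞ C = A ⬝∞ (B ⬝∞ C) :=
  imul_assoc_of_finset fun i _ => by
    obtain ⟨s, hs⟩ := hA.exists_finset i
    choose t ht using fun j => hB.exists_finset j
    refine ⟨s, s.biUnion t, hs, fun j hj k hk => ?_⟩
    rw [ht j k fun hc => hk (Finset.mem_biUnion.2 ⟨j, hj, hc⟩), zero_mul]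

/-- Associativity when the outer factors have finite rows, resp. columns. -/
lemma imul_assoc' {A C : IMat} (hA : RowFin A) (B : IMat) (hC : RowFin C.transpose) :
    A ⬝∞ B ⬝∞ C = A ⬝∞ (B ⬝∞ C) :=
  imul_assoc_of_finset fun i l => by
    obtain ⟨s, hs⟩ := hA.exists_finset i
    obtain ⟨t, ht⟩ := hC.exists_finset l
    exact ⟨s, t, hs, fun j _ k hk => by rw [show C k l = 0 from ht k hk, mul_zero]⟩

/-- Associativity when the two right factors have finite columns. -/
lemma imul_assoc'' (A : IMat) {B C : IMat} (hB : RowFin B.transpose) (hC : RowFin C.transpose) :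
    A ⬝∞ B ⬝∞ C = A ⬝∞ (B ⬝∞ C) := by
  have := imul_assoc hC hB A.transpose
  apply_fun Matrix.transpose at this
  simpa only [imul_transpose, Matrix.transpose_transpose] using this.symm

lemma RowFin.imul {A B : IMat} (hA : RowFin A) (hB : RowFin B) : RowFin (A ⬝∞ B) :=
  rowFin_of_finset fun i => by
    obtain ⟨s, hs⟩ := hA.exists_finset i
    choose t ht using fun j => hB.exists_finset j
    refine ⟨s.biUnion t, fun k hk => ?_⟩
    rw [imul_eq_sum s fun j hj => by rw [hs j hj, zero_mul]]
    refine Finset.sum_eq_zero fun j hj => ?_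
    rw [ht j k fun hc => hk (Finset.mem_biUnion.2 ⟨j, hj, hc⟩), mul_zero]

lemma RowFin.add {A B : IMat} (hA : RowFin A) (hB : RowFin B) : RowFin (A + B) :=
  fun i => ((hA i).union (hB i)).subset (Function.support_add (A i) (B i))

lemma RowFin.smul {A : IMat} (c : ℂ) (hA : RowFin A) : RowFin (c • A) :=
  fun i => (hA i).subset (Function.support_const_smul_subset c (A i))

lemma RowFin.neg {A : IMat} (hA : RowFin A) : RowFin (-A) :=
  fun i => (hA i).subset (by intro k hk; simpa using hk)

lemma RowFin.sub {A B : IMat} (hA : RowFin A) (hB : RowFin B) : RowFin (A - B) := by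
  rw [sub_eq_add_neg]; exact hA.add hB.neg

lemma isLT_one : IsLT (1 : IMat) := fun _ _ h => Matrix.one_apply_ne h.ne

lemma rowFin_one : RowFin (1 : IMat) := isLT_one.rowFin

lemma one_imul (A : IMat) : (1 : IMat) ⬝∞ A = A := by
  ext i j
  rw [imul_eq_sum {i} fun k hk => by
    rw [Matrix.one_apply_ne (by simpa [eq_comm] using hk), zero_mul]]
  simp

lemma imul_one (A : IMat) : A ⬝∞ (1 : IMat) = A := by
  have := congrArg Matrix.transpose (one_imul A.transpose)
  simpa [imul_transpose] using this

lemma add_imul {A B : IMat} (hA : RowFin A) (hB : RowFin B) (C : IMat) :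
    (A + B) ⬝∞ C = A ⬝∞ C + B ⬝∞ C := by
  ext i j
  obtain ⟨s, hs⟩ := hA.exists_finset i
  obtain ⟨t, ht⟩ := hB.exists_finset i
  have hs' : ∀ k, k ∉ s ∪ t → A i k = 0 := fun k hk => hs k fun h => hk (by simp [h])
  have ht' : ∀ k, k ∉ s ∪ t → B i k = 0 := fun k hk => ht k fun h => hk (by simp [h])
  rw [Matrix.add_apply, imul_eq_sum (s ∪ t) fun k hk => by simp [hs' k hk, ht' k hk],
    imul_eq_sum (s ∪ t) fun k hk => by simp [hs' k hk],
    imul_eq_sum (s ∪ t) fun k hk => by simp [ht' k hk], ← Finset.sum_add_distrib]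
  exact Finset.sum_congr rfl fun k _ => by rw [Matrix.add_apply]; ring

lemma imul_add {A : IMat} (hA : RowFin A) (B C : IMat) :
    A ⬝∞ (B + C) = A ⬝∞ B + A ⬝∞ C := by
  ext i j
  obtain ⟨s, hs⟩ := hA.exists_finset i
  have h : ∀ B : IMat, (A ⬝∞ B) i j = ∑ k ∈ s, A i k * B k j := fun B =>
    imul_eq_sum s fun k hk => by rw [hs k hk, zero_mul]
  rw [Matrix.add_apply, h, h, h, ← Finset.sum_add_distrib]
  exact Finset.sum_congr rfl fun k _ => by rw [Matrix.add_apply]; ring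

lemma smul_imul (c : ℂ) (A B : IMat) : (c • A) ⬝∞ B = c • (A ⬝∞ B) := by
  ext i j
  simp only [imul, Matrix.smul_apply, smul_eq_mul, mul_assoc]
  exact (smul_finsum c fun k => A i k * B k j).symm

lemma imul_smul (c : ℂ) (A B : IMat) : A ⬝∞ (c • B) = c • (A ⬝∞ B) := by
  have := congrArg Matrix.transpose (smul_imul c B.transpose A.transpose)
  simpa [imul_transpose] using this

lemma neg_imul (A B : IMat) : (-A) ⬝∞ B = -(A ⬝∞ B) := by
  simpa using smul_imul (-1) A B

lemma imul_neg (A B : IMat) : A ⬝∞ (-B) = -(A ⬝∞ B) := by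
  simpa using imul_smul (-1) A B

lemma sub_imul {A B : IMat} (hA : RowFin A) (hB : RowFin B) (C : IMat) :
    (A - B) ⬝∞ C = A ⬝∞ C - B ⬝∞ C := by
  rw [sub_eq_add_neg, add_imul hA hB.neg, neg_imul, sub_eq_add_neg]

lemma imul_sub {A : IMat} (hA : RowFin A) (B C : IMat) :
    A ⬝∞ (B - C) = A ⬝∞ B - A ⬝∞ C := by
  rw [sub_eq_add_neg, imul_add hA, imul_neg, sub_eq_add_neg]

lemma add_imul' (A B : IMat) {C : IMat} (hC : RowFin C.transpose) :
    (A + B) ⬝∞ C = A ⬝∞ C + B ⬝∞ C := by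
  have := congrArg Matrix.transpose (imul_add hC A.transpose B.transpose)
  simpa [imul_transpose] using this

/-! Inverses of lower-triangular matrices. -/

lemma IsLT.imul {A B : IMat} (hA : IsLT A) (hB : IsLT B) : IsLT (A ⬝∞ B) := fun i j hij => by
  rw [hA.imul_apply]
  refine Finset.sum_eq_zero fun k hk => ?_
  rw [hB k j (by simp at hk; omega), mul_zero]

lemma IsLT.imul_diag {A B : IMat} (hA : IsLT A) (hB : IsLT B) (i : ℕ) :
    (A ⬝∞ B) i i = A i i * B i i := by
  rw [hA.imul_apply, Finset.sum_eq_single_of_mem i (by simp)]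
  intro k hk hki
  rw [hB k i (by simp at hk; omega), mul_zero]

lemma IsLower.imul {A B : IMat} (hA : IsLower A) (hB : IsLower B) : IsLower (A ⬝∞ B) :=
  ⟨hA.isLT.imul hB.isLT, fun i => by
    rw [hA.isLT.imul_diag hB.isLT]; exact mul_ne_zero (hA.2 i) (hB.2 i)⟩

lemma isLower_one : IsLower (1 : IMat) := ⟨isLT_one, fun i => by simp⟩

/-- The upper left `N × N` corner. -/
def corner (A : IMat) (N : ℕ) : Matrix (Fin N) (Fin N) ℂ := Matrix.of fun a b => A a b

lemma IsLT.det_corner {A : IMat} (hA : IsLT A) (N : ℕ) :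
    (corner A N).det = ∏ i : Fin N, A i i :=
  Matrix.det_of_isLowerTriangular _ fun i j hij => hA i j (by simpa using hij)

lemma IsLower.isUnit_det_corner {A : IMat} (hA : IsLower A) (N : ℕ) :
    IsUnit (corner A N).det := by
  rw [hA.isLT.det_corner]
  exact IsUnit.mk0 _ (Finset.prod_ne_zero_iff.2 fun i _ => hA.2 i)

lemma IsLower.corner_inv_lower {A : IMat} (hA : IsLower A) {N : ℕ} {i j : Fin N} (h : i < j) :
    (corner A N)⁻¹ i j = 0 := by
  have := (corner A N).invertibleOfIsUnitDet (hA.isUnit_det_corner N)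
  have hb : (corner A N).BlockTriangular OrderDual.toDual := fun a b hab =>
    hA.1 a b (by simpa using hab)
  exact Matrix.blockTriangular_inv_of_blockTriangular hb (by simpa using h)

lemma IsLower.corner_inv_stable {A : IMat} (hA : IsLower A) {M N : ℕ} (hMN : M ≤ N)
    (i j : Fin M) :
    (corner A N)⁻¹ (Fin.castLE hMN i) (Fin.castLE hMN j) = (corner A M)⁻¹ i j := by
  have key : (Matrix.of fun a b : Fin M =>
      (corner A N)⁻¹ (Fin.castLE hMN a) (Fin.castLE hMN b)) * corner A M = 1 := by
    ext a b
    have h1 := congrFun (congrFun (Matrix.nonsing_inv_mul _ (hA.isUnit_det_corner N))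
      (Fin.castLE hMN a)) (Fin.castLE hMN b)
    rw [Matrix.mul_apply] at h1
    have h2 : (1 : Matrix (Fin N) (Fin N) ℂ) (Fin.castLE hMN a) (Fin.castLE hMN b) =
        (1 : Matrix (Fin M) (Fin M) ℂ) a b := by
      simp [Matrix.one_apply]
    rw [← h2, ← h1, Matrix.mul_apply]
    refine Finset.sum_of_injOn (Fin.castLE hMN) (Fin.castLE_injective hMN).injOn
      (by simp) (fun k _ hk => ?_) (fun k _ => by simp [corner])
    rw [hA.corner_inv_lower, zero_mul]
    by_contra hc
    exact hk ⟨⟨k, lt_of_le_of_lt (not_lt.1 hc) a.2⟩, by simp, by ext; simp⟩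
  rw [Matrix.inv_eq_left_inv key]; rfl

lemma IsLower.linv_apply {A : IMat} (hA : IsLower A) {N : ℕ} (i j : Fin N) :
    linv A i j = (corner A N)⁻¹ i j := by
  have h1 : (i : ℕ) + j + 1 ≤ (i : ℕ) + j + 1 + N := by omega
  have h2 : N ≤ (i : ℕ) + j + 1 + N := by omega
  exact (hA.corner_inv_stable h1 ⟨i, by omega⟩ ⟨j, by omega⟩).symm.trans
    (hA.corner_inv_stable h2 i j)

lemma IsLower.isLT_linv {A : IMat} (hA : IsLower A) : IsLT (linv A) := fun i j h => by
  have := hA.linv_apply (N := j + 1) ⟨i, by omega⟩ ⟨j, by omega⟩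
  rw [show linv A i j = _ from this]
  exact hA.corner_inv_lower (by simpa using h)

lemma IsLower.linv_imul {A : IMat} (hA : IsLower A) : linv A ⬝∞ A = 1 := by
  ext i j
  have h := congrFun (congrFun (Matrix.nonsing_inv_mul _ (hA.isUnit_det_corner (i + j + 1)))
    ⟨i, by omega⟩) ⟨j, by omega⟩
  rw [imul_eq_sum (Finset.range (i + j + 1)) fun k hk => by
    rw [hA.isLT_linv i k (by simp at hk; omega), zero_mul], Finset.sum_range]
  rw [Matrix.mul_apply] at h
  convert! h using 1
  · exact Finset.sum_congr rfl fun k _ => by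
      rw [← hA.linv_apply (N := i + j + 1) ⟨i, by omega⟩ k]; rfl
  · simp [Matrix.one_apply]

lemma IsLower.imul_linv {A : IMat} (hA : IsLower A) : A ⬝∞ linv A = 1 := by
  ext i j
  have h := congrFun (congrFun (Matrix.mul_nonsing_inv _ (hA.isUnit_det_corner (i + j + 1)))
    ⟨i, by omega⟩) ⟨j, by omega⟩
  rw [imul_eq_sum (Finset.range (i + j + 1)) fun k hk => by
    rw [hA.isLT i k (by simp at hk; omega), zero_mul], Finset.sum_range]
  rw [Matrix.mul_apply] at h
  convert! h using 1
  · exact Finset.sum_congr rfl fun k _ => by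
      rw [← hA.linv_apply (N := i + j + 1) k ⟨j, by omega⟩]; rfl
  · simp [Matrix.one_apply]

lemma IsLower.linv {A : IMat} (hA : IsLower A) : IsLower (linv A) :=
  ⟨hA.isLT_linv, fun i h => by
    have := hA.isLT.imul_diag hA.isLT_linv i
    rw [hA.imul_linv, h] at this
    simp at this⟩

lemma IsLower.eq_linv {A B : IMat} (hA : IsLower A) (hB : RowFin B) (h : B ⬝∞ A = 1) :
    B = TodaPfaff.linv A := by
  have := imul_assoc hB hA.rowFin (TodaPfaff.linv A)
  rwa [h, hA.imul_linv, one_imul, imul_one, eq_comm] at this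

lemma IsLower.linv_mul {A B : IMat} (hA : IsLower A) (hB : IsLower B) :
    TodaPfaff.linv (A ⬝∞ B) = TodaPfaff.linv B ⬝∞ TodaPfaff.linv A := by
  refine ((hA.imul hB).eq_linv (hB.linv.imul hA.linv).rowFin ?_).symm
  rw [imul_assoc hB.linv.rowFin hA.linv.rowFin, ← imul_assoc hA.linv.rowFin hA.rowFin,
    hA.linv_imul, one_imul, hB.linv_imul]

/-- A congruence `m ↦ A m Aᵀ` by an invertible lower-triangular matrix can be inverted. -/
lemma IsLower.congr_eq_iff {A : IMat} (hA : IsLower A) (m N : IMat) :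
    m = TodaPfaff.linv A ⬝∞ N ⬝∞ (TodaPfaff.linv A).transpose ↔ A ⬝∞ m ⬝∞ A.transpose = N := by
  have hr : ∀ B : IMat, IsLower B → RowFin B.transpose.transpose := fun B hB => by
    rw [Matrix.transpose_transpose]; exact hB.rowFin
  have key : ∀ {B C : IMat} (_ : IsLower B) (_ : IsLower C) (_ : B ⬝∞ C = 1) (N : IMat),
      B ⬝∞ (C ⬝∞ N ⬝∞ C.transpose) ⬝∞ B.transpose = N := fun {B C} hB hC h N => by
    rw [imul_assoc' hC.rowFin N (hr C hC), ← imul_assoc hB.rowFin hC.rowFin, h, one_imul,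
      imul_assoc'' N (hr C hC) (hr B hB), ← imul_transpose, h, Matrix.transpose_one, imul_one]
  constructor
  · rintro rfl
    exact key hA hA.linv hA.imul_linv N
  · rintro rfl
    exact (key hA.linv hA hA.linv_imul m).symm

lemma RowFin.ipow {A : IMat} (hA : RowFin A) (k : ℕ) : RowFin (ipow A k) := by
  induction k with
  | zero => exact rowFin_one
  | succ k ih => exact ih.imul hA

lemma ipow_conj {S A : IMat} (hS : IsLower S) (hA : RowFin A) (k : ℕ) :
    ipow (S ⬝∞ A ⬝∞ linv S) k = S ⬝∞ ipow A k ⬝∞ linv S := by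
  induction k with
  | zero => simp only [ipow]; rw [imul_one, hS.imul_linv]
  | succ k ih =>
    simp only [ipow]
    have h1 := hS.rowFin.imul (hA.ipow k)
    rw [ih, imul_assoc h1 hS.linv.rowFin, ← imul_assoc hS.linv.rowFin (hS.rowFin.imul hA),
      ← imul_assoc hS.linv.rowFin hS.rowFin, hS.linv_imul, one_imul, ← imul_assoc h1 hA,
      imul_assoc hS.rowFin (hA.ipow k)]

lemma ieval_eq_sum (f : ℂ[X]) (A : IMat) :
    ieval f A = ∑ k ∈ f.support, f.coeff k • ipow A k := by
  ext i j
  rw [Matrix.sum_apply]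
  rfl

lemma rowFin_sum {ι : Type*} (s : Finset ι) {F : ι → IMat} (h : ∀ k ∈ s, RowFin (F k)) :
    RowFin (∑ k ∈ s, F k) := by
  classical
  induction s using Finset.induction_on with
  | empty => intro i; simp [Function.support_eq_empty_iff.2 (rfl : (0 : IMat) i = 0)]
  | insert a s ha ih =>
    rw [Finset.sum_insert ha]
    exact (h a (by simp)).add (ih fun k hk => h k (by simp [hk]))

lemma sum_imul {ι : Type*} (s : Finset ι) {F : ι → IMat} (h : ∀ k ∈ s, RowFin (F k)) (C : IMat) :
    (∑ k ∈ s, F k) ⬝∞ C = ∑ k ∈ s, F k ⬝∞ C := by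
  classical
  induction s using Finset.induction_on with
  | empty => ext i j; simp [imul]
  | insert a s ha ih =>
    rw [Finset.sum_insert ha, Finset.sum_insert ha, add_imul (h a (by simp))
      (rowFin_sum s fun k hk => h k (by simp [hk])), ih fun k hk => h k (by simp [hk])]

lemma imul_sum {ι : Type*} (s : Finset ι) {A : IMat} (hA : RowFin A) (F : ι → IMat) :
    A ⬝∞ (∑ k ∈ s, F k) = ∑ k ∈ s, A ⬝∞ F k := by
  classical
  induction s using Finset.induction_on with
  | empty => ext i j; simp [imul]
  | insert a s ha ih =>
    rw [Finset.sum_insert ha, Finset.sum_insert ha, imul_add hA, ih]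

lemma RowFin.ieval {A : IMat} (hA : RowFin A) (f : ℂ[X]) : RowFin (ieval f A) := by
  rw [ieval_eq_sum]
  exact rowFin_sum _ fun k _ => (hA.ipow k).smul _

lemma ieval_conj {S A : IMat} (hS : IsLower S) (hA : RowFin A) (f : ℂ[X]) :
    ieval f (S ⬝∞ A ⬝∞ linv S) = S ⬝∞ ieval f A ⬝∞ linv S := by
  simp_rw [ieval_eq_sum]
  rw [imul_sum _ hS.rowFin, sum_imul _ fun k _ => hS.rowFin.imul ((hA.ipow k).smul _)]
  refine Finset.sum_congr rfl fun k _ => ?_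
  rw [ipow_conj hS hA, imul_smul, smul_imul]

/-! Rows as polynomials. Multiplying a matrix with finite rows from the right by `Λ` or `∂` means
multiplying the polynomials of its rows by `z`, resp. differentiating them. -/

/-- The polynomial whose coefficients form row `i` of a matrix with finite rows. -/
def rowp (A : IMat) (i : ℕ) : ℂ[X] := ∑ᶠ j, monomial j (A i j)

lemma rowp_eq_sum {A : IMat} {i : ℕ} (s : Finset ℕ) (h : ∀ k, k ∉ s → A i k = 0) :
    rowp A i = ∑ k ∈ s, monomial k (A i k) :=
  finsum_eq_finsetSum_of_support_subset _ fun k hk => by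
    by_contra hc
    exact hk (by simp [h k (by simpa using hc)])

lemma RowFin.coeff_rowp {A : IMat} (hA : RowFin A) (i j : ℕ) : (rowp A i).coeff j = A i j := by
  obtain ⟨s, hs⟩ := hA.exists_finset i
  rw [rowp_eq_sum s hs, finsetSum_coeff]
  simp only [coeff_monomial]
  rw [Finset.sum_ite_eq' s j]
  split_ifs with h
  · rfl
  · exact (hs j h).symm

lemma rowPoly_eq_rowp {S : IMat} (hS : IsLT S) (i : ℕ) : rowPoly S i = rowp S i :=
  (rowp_eq_sum _ fun k hk => hS i k (by simp at hk; omega)).symm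

lemma rowp_imul {A B : IMat} (hA : RowFin A) (hB : RowFin B) {i : ℕ} (s : Finset ℕ)
    (h : ∀ k, k ∉ s → A i k = 0) : rowp (A ⬝∞ B) i = ∑ k ∈ s, C (A i k) * rowp B k := by
  ext j
  rw [(hA.imul hB).coeff_rowp, imul_eq_sum s fun k hk => by rw [h k hk, zero_mul],
    finsetSum_coeff]
  exact Finset.sum_congr rfl fun k _ => by rw [coeff_C_mul, hB.coeff_rowp]

lemma mapPoly_eq_rowp {O S : IMat} (hO : IsLT O) (hS : IsLT S) (i : ℕ) :
    mapPoly O S i = rowp (O ⬝∞ S) i := by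
  rw [rowp_imul hO.rowFin hS.rowFin (Finset.range (i + 1)) fun k hk =>
    hO i k (by simp at hk; omega)]
  exact Finset.sum_congr rfl fun j _ => by rw [rowPoly_eq_rowp hS]

lemma rowFin_shift : RowFin shift :=
  rowFin_of_finset fun i => ⟨{i + 1}, fun k hk => if_neg (by simpa using hk)⟩

lemma rowFin_partialMat : RowFin partialMat :=
  rowFin_of_finset fun i => ⟨{i - 1}, fun k hk => if_neg (by
    rintro rfl; simp at hk)⟩

lemma ipow_shift_apply (k i j : ℕ) : ipow shift k i j = if j = i + k then 1 else 0 := by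
  induction k generalizing j with
  | zero => simp [ipow, Matrix.one_apply, eq_comm]
  | succ k ih =>
    rw [ipow, imul_eq_sum {i + k} fun l hl => by rw [ih, if_neg (by simpa using hl), zero_mul]]
    rw [Finset.sum_singleton, ih, if_pos rfl, one_mul]
    simp only [shift, add_assoc]

lemma ipow_shift_imul (k : ℕ) (A : IMat) (i j : ℕ) : (ipow shift k ⬝∞ A) i j = A (i + k) j := by
  rw [imul_eq_sum {i + k} fun l hl => by
    rw [ipow_shift_apply, if_neg (by simpa using hl), zero_mul], Finset.sum_singleton,
    ipow_shift_apply, if_pos rfl, one_mul]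

lemma imul_ipow_shift_transpose (k : ℕ) (A : IMat) (i j : ℕ) :
    (A ⬝∞ (ipow shift k).transpose) i j = A i (j + k) := by
  have h := imul_transpose (ipow shift k) A.transpose
  rw [Matrix.transpose_transpose] at h
  rw [← h, Matrix.transpose_apply, ipow_shift_imul, Matrix.transpose_apply]

lemma rowp_imul_shift {A : IMat} (hA : RowFin A) (i : ℕ) :
    rowp (A ⬝∞ shift) i = X * rowp A i := by
  ext j
  rw [(hA.imul rowFin_shift).coeff_rowp]
  cases j with
  | zero =>
    rw [coeff_X_mul_zero]
    exact (imul_eq_sum ∅ fun k _ => by simp [shift])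
  | succ j =>
    rw [coeff_X_mul, hA.coeff_rowp, imul_eq_sum {j} fun k hk => by
      rw [shift, if_neg (by simp at hk; omega), mul_zero]]
    simp [shift]

lemma rowp_imul_partialMat {A : IMat} (hA : RowFin A) (i : ℕ) :
    rowp (A ⬝∞ partialMat) i = derivative (rowp A i) := by
  ext j
  rw [(hA.imul rowFin_partialMat).coeff_rowp, coeff_derivative, hA.coeff_rowp,
    imul_eq_sum {j + 1} fun k hk => by
      rw [partialMat, if_neg (by simpa using hk), mul_zero]]
  simp [partialMat]

lemma rowp_imul_ipow_shift {A : IMat} (hA : RowFin A) (k i : ℕ) :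
    rowp (A ⬝∞ ipow shift k) i = X ^ k * rowp A i := by
  induction k with
  | zero => simp [ipow, imul_one]
  | succ k ih =>
    rw [ipow, ← imul_assoc hA (rowFin_shift.ipow k),
      rowp_imul_shift (hA.imul (rowFin_shift.ipow k)),
      ih]
    ring

lemma rowp_add {A B : IMat} (hA : RowFin A) (hB : RowFin B) (i : ℕ) :
    rowp (A + B) i = rowp A i + rowp B i := by
  ext j
  rw [coeff_add, (hA.add hB).coeff_rowp, hA.coeff_rowp, hB.coeff_rowp, Matrix.add_apply]

lemma rowp_smul {A : IMat} (hA : RowFin A) (c : ℂ) (i : ℕ) : rowp (c • A) i = C c * rowp A i := by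
  ext j
  rw [coeff_C_mul, (hA.smul c).coeff_rowp, hA.coeff_rowp, Matrix.smul_apply, smul_eq_mul]

lemma rowp_sub {A B : IMat} (hA : RowFin A) (hB : RowFin B) (i : ℕ) :
    rowp (A - B) i = rowp A i - rowp B i := by
  ext j
  rw [coeff_sub, (hA.sub hB).coeff_rowp, hA.coeff_rowp, hB.coeff_rowp, Matrix.sub_apply]

lemma rowp_sum {ι : Type*} (s : Finset ι) {F : ι → IMat} (h : ∀ k ∈ s, RowFin (F k)) (i : ℕ) :
    rowp (∑ k ∈ s, F k) i = ∑ k ∈ s, rowp (F k) i := by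
  ext j
  rw [finsetSum_coeff, (rowFin_sum s h).coeff_rowp, Matrix.sum_apply]
  exact Finset.sum_congr rfl fun k hk => ((h k hk).coeff_rowp i j).symm

lemma rowp_imul_ieval_shift {A : IMat} (hA : RowFin A) (f : ℂ[X]) (i : ℕ) :
    rowp (A ⬝∞ ieval f shift) i = f * rowp A i := by
  rw [ieval_eq_sum, imul_sum _ hA,
    rowp_sum _ fun k _ => hA.imul ((rowFin_shift.ipow k).smul _)]
  conv_rhs => rw [f.as_sum_support_C_mul_X_pow, Finset.sum_mul]
  refine Finset.sum_congr rfl fun k _ => ?_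
  rw [imul_smul, rowp_smul (hA.imul (rowFin_shift.ipow k)), rowp_imul_ipow_shift hA, mul_assoc]

end TodaPfaff
end

/-! ### The bilinear form of a semi-infinite matrix, and block Gram–Schmidt -/

noncomputable section

namespace TodaPfaff

/-- The bilinear form on polynomials with matrix `N` in the basis of monomials. -/
def form (N : IMat) : ℂ[X] →ₗ[ℂ] ℂ[X] →ₗ[ℂ] ℂ :=
  (basisMonomials ℂ).constr ℂ fun a => (basisMonomials ℂ).constr ℂ (N a)

lemma form_monomial (N : IMat) (a b : ℕ) (x y : ℂ) :
    form N (monomial a x) (monomial b y) = x * N a b * y := by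
  have h : ∀ (a : ℕ) (x : ℂ), (monomial a x : ℂ[X]) = x • basisMonomials ℂ a := fun a x => by
    rw [coe_basisMonomials, smul_monomial, smul_eq_mul, mul_one]
  rw [h a, h b, map_smul, map_smul, LinearMap.smul_apply, form, Module.Basis.constr_basis,
    Module.Basis.constr_basis]
  simp only [smul_eq_mul]
  ring

lemma form_X_pow (N : IMat) (a b : ℕ) : form N (X ^ a) (X ^ b) = N a b := by
  simpa [← monomial_one_right_eq_X_pow] using form_monomial N a b 1 1

lemma form_sum_monomial (N : IMat) (s t : Finset ℕ) (x y : ℕ → ℂ) :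
    form N (∑ a ∈ s, monomial a (x a)) (∑ b ∈ t, monomial b (y b)) =
      ∑ a ∈ s, ∑ b ∈ t, x a * N a b * y b := by
  simp only [map_sum, LinearMap.sum_apply, form_monomial]
  exact Finset.sum_comm

lemma form_eq_sum (N : IMat) {M : ℕ} {φ ψ : ℂ[X]} (hφ : φ.natDegree < M) (hψ : ψ.natDegree < M) :
    form N φ ψ = ∑ a ∈ Finset.range M, ∑ b ∈ Finset.range M, φ.coeff a * N a b * ψ.coeff b := by
  conv_lhs => rw [φ.as_sum_range' M hφ, ψ.as_sum_range' M hψ]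
  exact form_sum_monomial N _ _ _ _

lemma form_transpose (N : IMat) (φ ψ : ℂ[X]) : form N.transpose φ ψ = form N ψ φ := by
  have h1 : φ.natDegree < φ.natDegree + ψ.natDegree + 1 := by omega
  have h2 : ψ.natDegree < φ.natDegree + ψ.natDegree + 1 := by omega
  rw [form_eq_sum _ h1 h2, form_eq_sum _ h2 h1, Finset.sum_comm]
  refine Finset.sum_congr rfl fun a _ => Finset.sum_congr rfl fun b _ => ?_
  rw [Matrix.transpose_apply]; ring

lemma form_smul_mat (c : ℂ) (N : IMat) (φ ψ : ℂ[X]) : form (c • N) φ ψ = c * form N φ ψ := by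
  have h1 : φ.natDegree < φ.natDegree + ψ.natDegree + 1 := by omega
  have h2 : ψ.natDegree < φ.natDegree + ψ.natDegree + 1 := by omega
  simp only [form_eq_sum _ h1 h2, Finset.mul_sum, Matrix.smul_apply, smul_eq_mul]
  refine Finset.sum_congr rfl fun a _ => Finset.sum_congr rfl fun b _ => ?_
  ring

/-- A congruence evaluated through the form: `(A m Bᵀ)_{ij}` pairs row `i` of `A` with row `j` of
`B`. -/
lemma congr_apply {A B : IMat} (hA : RowFin A) (hB : RowFin B) (m : IMat) (i j : ℕ) :
    (A ⬝∞ m ⬝∞ B.transpose) i j = form m (rowp A i) (rowp B j) := by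
  obtain ⟨s, hs⟩ := hA.exists_finset i
  obtain ⟨t, ht⟩ := hB.exists_finset j
  rw [rowp_eq_sum s hs, rowp_eq_sum t ht, form_sum_monomial,
    imul_eq_sum t fun k hk => by rw [Matrix.transpose_apply, ht k hk, mul_zero], Finset.sum_comm]
  refine Finset.sum_congr rfl fun b _ => ?_
  rw [imul_eq_sum s fun k hk => by rw [hs k hk, zero_mul], Finset.sum_mul]
  rfl

/-- A nondegenerate form on `ℂ^∞`, either symmetric with blocks of size `1` (the identity) or
skew-symmetric with blocks of size `2` (the matrix `J`), described by the first index `base n` of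
the block of `n`, the only index `par n` that is paired with `n`, the value `sg n` of the pairing,
and the sign `sym` of the symmetry. The identity and `J` are treated together in this way. -/
structure BlockForm where
  par : ℕ → ℕ
  base : ℕ → ℕ
  sg : ℕ → ℂ
  sym : ℂ
  par_par : ∀ n, par (par n) = n
  base_le : ∀ n, base n ≤ n
  base_base : ∀ n, base (base n) = base n
  base_par : ∀ n, base (par n) = base n
  lt_base : ∀ i n, base i < base n → i < base n
  mem_block : ∀ n, n = base n ∨ n = par (base n)
  sg_mul : ∀ n, sg n * sg n = 1
  sg_base : ∀ n, sg (base n) = 1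
  sg_par : ∀ n, sg (par n) = sym * sg n
  par_base : ∀ n, par (base n) = base n ∨ sym = -1

namespace BlockForm

variable (B : BlockForm)

/-- The matrix of the form. -/
def eta : IMat := fun i j => if j = B.par i then B.sg i else 0

lemma base_lt {i n : ℕ} (h : i < B.base n) : B.base i < B.base n := (B.base_le i).trans_lt h

lemma par_lt {i n : ℕ} (h : i < B.base n) : B.par i < B.base n :=
  B.lt_base _ _ (by rw [B.base_par]; exact B.base_lt h)

lemma sym_mul : B.sym * B.sym = 1 := by
  have h := B.sg_par (B.par 0)
  rw [B.par_par, B.sg_par, ← mul_assoc] at h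
  have h0 : B.sg 0 ≠ 0 := fun h => by simpa [h] using B.sg_mul 0
  exact mul_right_cancel₀ h0 (by rw [one_mul]; exact h.symm)

lemma eta_comm (i j : ℕ) : B.eta j i = B.sym * B.eta i j := by
  unfold eta
  by_cases h : j = B.par i
  · rw [if_pos h, if_pos (by rw [h, B.par_par]), h, B.sg_par]
  · rw [if_neg h, if_neg fun hc => h (by rw [hc, B.par_par]), mul_zero]

lemma eta_of_base_ne {i j : ℕ} (h : B.base j ≠ B.base i) : B.eta i j = 0 :=
  if_neg fun hc => h (by rw [hc, B.base_par])

/-- The factor `h^{-1/2}`, chosen nonzero also for `h = 0`. -/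
def rsqrt (h : ℂ) : ℂ := Complex.exp (-Complex.log h / 2)

lemma rsqrt_ne_zero (h : ℂ) : rsqrt h ≠ 0 := Complex.exp_ne_zero _

lemma rsqrt_one : rsqrt 1 = 1 := by simp [rsqrt]

lemma rsqrt_mul_self {h : ℂ} (hh : h ≠ 0) : rsqrt h * rsqrt h * h = 1 := by
  nth_rw 3 [← Complex.exp_log hh]
  rw [rsqrt, ← Complex.exp_add, ← Complex.exp_add]
  simp

/-- The unnormalized Gram–Schmidt polynomials: `z^n` minus its projection to the span of the
previous blocks. -/
def gsV (N : IMat) (n : ℕ) : ℂ[X] :=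
  X ^ n - ∑ i : Fin (B.base n),
    (B.sg (B.par i) * form N (X ^ n)
      (rsqrt (form N (gsV N (B.base i)) (gsV N (B.par (B.base i)))) • gsV N i)) •
      (rsqrt (form N (gsV N (B.base i)) (gsV N (B.par (B.base i)))) • gsV N (B.par i))
termination_by n
decreasing_by
  · exact ((B.base_lt i.2).trans_le (B.base_le n))
  · exact ((B.par_lt (B.base_lt i.2)).trans_le (B.base_le n))
  · exact (i.2.trans_le (B.base_le n))
  · exact ((B.par_lt i.2).trans_le (B.base_le n))

/-- The pivot of the block of `n`. -/
def pivot (N : IMat) (n : ℕ) : ℂ :=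
  form N (B.gsV N (B.base n)) (B.gsV N (B.par (B.base n)))

/-- The normalized Gram–Schmidt polynomials. -/
def gsD (N : IMat) (n : ℕ) : ℂ[X] := rsqrt (B.pivot N n) • B.gsV N n

/-- The matrix of coefficients of the Gram–Schmidt polynomials. -/
def gs (N : IMat) : IMat := fun i j => (B.gsD N i).coeff j

lemma pivot_base (N : IMat) (n : ℕ) : B.pivot N (B.base n) = B.pivot N n := by
  rw [pivot, pivot, B.base_base]

lemma gsV_eq (N : IMat) (n : ℕ) : B.gsV N n = X ^ n - ∑ i ∈ Finset.range (B.base n),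
    (B.sg (B.par i) * form N (X ^ n) (B.gsD N i)) • B.gsD N (B.par i) := by
  conv_lhs => rw [gsV]
  simp only [gsD, pivot, B.base_par, Finset.sum_range]

lemma natDegree_gsD_le (N : IMat) (n : ℕ) : (B.gsD N n).natDegree ≤ n := by
  induction n using Nat.strong_induction_on with
  | _ n ih =>
    rw [gsD]
    refine (natDegree_smul_le _ _).trans ?_
    rw [gsV_eq]
    refine (natDegree_sub_le _ _).trans (max_le (natDegree_X_pow_le n)
      (natDegree_sum_le_of_forall_le _ _ fun i hi => ?_))
    rw [Finset.mem_range] at hi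
    have h := (B.par_lt hi).trans_le (B.base_le n)
    exact (natDegree_smul_le _ _).trans ((ih _ h).trans h.le)

lemma coeff_gsV (N : IMat) {n j : ℕ} (h : B.base n ≤ j) :
    (B.gsV N n).coeff j = if j = n then 1 else 0 := by
  rw [gsV_eq, coeff_sub, finsetSum_coeff, Finset.sum_eq_zero, sub_zero, coeff_X_pow]
  intro i hi
  rw [coeff_smul, coeff_eq_zero_of_natDegree_lt, smul_zero]
  exact (B.natDegree_gsD_le N _).trans_lt ((B.par_lt (Finset.mem_range.1 hi)).trans_le h)

lemma gs_of_base_le (N : IMat) {i j : ℕ} (h : B.base i ≤ j) (hj : j ≠ i) : B.gs N i j = 0 := by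
  rw [gs, gsD, coeff_smul, B.coeff_gsV N h, if_neg hj, smul_zero]

lemma gs_diag (N : IMat) (i : ℕ) : B.gs N i i = rsqrt (B.pivot N i) := by
  rw [gs, gsD, coeff_smul, B.coeff_gsV N (B.base_le i), if_pos rfl, smul_eq_mul, mul_one]

lemma isLower_gs (N : IMat) : IsLower (B.gs N) :=
  ⟨fun i _ h => B.gs_of_base_le N ((B.base_le i).trans h.le) h.ne', fun i => by
    rw [gs_diag]; exact rsqrt_ne_zero _⟩

lemma rowp_gs (N : IMat) (i : ℕ) : rowp (B.gs N) i = B.gsD N i := by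
  ext j
  rw [(B.isLower_gs N).rowFin.coeff_rowp]
  rfl

section Relations

variable {B} {N : IMat} (hN : ∀ i j, N j i = B.sym * N i j)

include hN

lemma form_comm (φ ψ : ℂ[X]) : form N ψ φ = B.sym * form N φ ψ := by
  have h : N.transpose = B.sym • N := by ext i j; exact hN i j
  rw [← form_transpose, ← form_smul_mat, h]

/-- Within a block the unnormalized polynomials pair as prescribed, up to the pivot. -/
lemma form_gsV_block {i j : ℕ} (h : B.base i = B.base j) :
    form N (B.gsV N i) (B.gsV N j) = B.pivot N i * B.eta i j := by
  have hi := B.mem_block i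
  have hj := B.mem_block j
  have hb := B.par_base i
  have e1 : B.eta (B.base i) (B.par (B.base i)) = 1 := by rw [eta, if_pos rfl, B.sg_base]
  rw [← h] at hj
  rw [pivot]
  generalize B.base i = b at *
  -- In a block of size two the form is alternating, as `sym = -1`.
  have self : ∀ k, k = b ∨ k = B.par b →
      form N (B.gsV N k) (B.gsV N k) =
        form N (B.gsV N b) (B.gsV N (B.par b)) * B.eta k k := fun k hk => by
    by_cases hbb : B.par b = b
    · rw [hbb, or_self] at hk
      rw [hbb] at e1
      rw [hk, hbb, e1, mul_one]
    · have hs := hb.resolve_left hbb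
      have hkk : k ≠ B.par k := by
        rcases hk with rfl | rfl
        · exact Ne.symm hbb
        · rwa [B.par_par]
      have := form_comm hN (B.gsV N k) (B.gsV N k)
      rw [hs] at this
      rw [eta, if_neg hkk, mul_zero]
      linear_combination this / 2
  by_cases hij : i = j
  · rw [← hij]
    exact self i hi
  rcases hi with hi | hi <;> rcases hj with hj | hj
  · exact absurd (hi.trans hj.symm) hij
  · rw [hi, hj, e1, mul_one]
  · rw [hi, hj, form_comm hN (B.gsV N b), B.eta_comm b, e1]
    ring
  · exact absurd (hi.trans hj.symm) hij

/-- The Gram–Schmidt relations hold as long as the pivots do not vanish. -/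
lemma form_gsD_of_lt {n : ℕ} (hp : ∀ i, B.base i < B.base n → B.pivot N i ≠ 0) :
    (∀ i j, B.base i < B.base n → B.base j < B.base n →
      form N (B.gsD N i) (B.gsD N j) = B.eta i j) ∧
    ∀ j, B.base j < B.base n → form N (B.gsV N n) (B.gsD N j) = 0 := by
  induction n using Nat.strong_induction_on with
  | _ n ih =>
    have h1 : ∀ i j, B.base i < B.base n → B.base j ≤ B.base i →
        form N (B.gsD N i) (B.gsD N j) = B.eta i j := fun i j hi hj => by
      have hin := (B.lt_base i n hi).trans_le (B.base_le n)
      rcases hj.lt_or_eq with hj | hj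
      · rw [B.eta_of_base_ne hj.ne]
        nth_rw 1 [gsD]
        rw [map_smul, LinearMap.smul_apply,
          (ih i hin fun k hk => hp k (hk.trans hi)).2 j hj, smul_zero]
      · have hpj : B.pivot N j = B.pivot N i := by rw [pivot, hj]; rfl
        rw [gsD, gsD, map_smul, map_smul, LinearMap.smul_apply, form_gsV_block hN hj.symm, hpj,
          smul_eq_mul, smul_eq_mul]
        linear_combination B.eta i j * rsqrt_mul_self (hp i hi)
    have h2 : ∀ i j, B.base i < B.base n → B.base j < B.base n →
        form N (B.gsD N i) (B.gsD N j) = B.eta i j := fun i j hi hj => by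
      rcases le_total (B.base j) (B.base i) with h | h
      · exact h1 i j hi h
      · rw [form_comm hN (B.gsD N j), h1 j i hj h, B.eta_comm, ← mul_assoc, B.sym_mul, one_mul]
    refine ⟨h2, fun j hj => ?_⟩
    rw [gsV_eq, map_sub, LinearMap.sub_apply, map_sum, LinearMap.sum_apply,
      Finset.sum_eq_single_of_mem j (Finset.mem_range.2 (B.lt_base j n hj))]
    · rw [map_smul, LinearMap.smul_apply, h2 _ _ (by rwa [B.base_par]) hj, eta,
        if_pos (B.par_par j).symm, smul_eq_mul]
      linear_combination (-form N (X ^ n) (B.gsD N j)) * B.sg_mul (B.par j)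
    · intro k hk hkj
      rw [Finset.mem_range] at hk
      rw [map_smul, LinearMap.smul_apply, h2 _ _ (by rw [B.base_par]; exact B.base_lt hk) hj, eta,
        if_neg (by rw [B.par_par]; exact hkj.symm), smul_zero]

lemma form_gsD {n : ℕ} (hp : ∀ i, B.base i ≤ B.base n → B.pivot N i ≠ 0) {i j : ℕ}
    (hi : B.base i ≤ B.base n) (hj : B.base j ≤ B.base n) :
    form N (B.gsD N i) (B.gsD N j) = B.eta i j := by
  have h1 : ∀ i j, B.base i ≤ B.base n → B.base j ≤ B.base i →
      form N (B.gsD N i) (B.gsD N j) = B.eta i j := fun i j hi hj => by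
    rcases hj.lt_or_eq with hj | hj
    · rw [B.eta_of_base_ne hj.ne]
      nth_rw 1 [gsD]
      rw [map_smul, LinearMap.smul_apply,
        (form_gsD_of_lt hN fun k hk => hp k (hk.le.trans hi)).2 j hj, smul_zero]
    · have hpj : B.pivot N j = B.pivot N i := by rw [pivot, hj]; rfl
      rw [gsD, gsD, map_smul, map_smul, LinearMap.smul_apply, form_gsV_block hN hj.symm, hpj,
        smul_eq_mul, smul_eq_mul]
      linear_combination B.eta i j * rsqrt_mul_self (hp i hi)
  rcases le_total (B.base j) (B.base i) with h | h
  · exact h1 i j hi h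
  · rw [form_comm hN (B.gsD N j), h1 j i hj h, B.eta_comm, ← mul_assoc, B.sym_mul, one_mul]

/-- A vanishing pivot makes the form degenerate on the polynomials up to the block concerned. -/
lemma form_gsD_of_pivot_eq_zero {n : ℕ} (hp : ∀ i, B.base i < B.base n → B.pivot N i ≠ 0)
    (h0 : B.pivot N n = 0) {j : ℕ} (hj : B.base j ≤ B.base n) :
    form N (B.gsD N n) (B.gsD N j) = 0 := by
  nth_rw 1 [gsD]
  rw [map_smul, LinearMap.smul_apply]
  rcases hj.lt_or_eq with hj | hj
  · rw [(form_gsD_of_lt hN hp).2 j hj, smul_zero]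
  · rw [gsD, map_smul, form_gsV_block hN hj.symm, h0, zero_mul, smul_zero, smul_zero]

/-- If the form is not degenerate on the polynomials up to any block, it is brought to normal form
by a lower-triangular congruence. -/
lemma gs_congr (hdeg : ∀ n, (∀ j, B.base j ≤ B.base n → form N (B.gsD N n) (B.gsD N j) = 0) →
      False) : B.gs N ⬝∞ N ⬝∞ (B.gs N).transpose = B.eta := by
  have hp : ∀ n, B.pivot N n ≠ 0 := by
    by_contra hc
    push Not at hc
    obtain ⟨n, hn, hmin⟩ : ∃ n, B.pivot N n = 0 ∧ ∀ i, B.base i < B.base n → B.pivot N i ≠ 0 := by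
      classical
      have hex : ∃ b, ∃ n, B.base n = b ∧ B.pivot N n = 0 := let ⟨n, hn⟩ := hc; ⟨_, n, rfl, hn⟩
      obtain ⟨n, hb, hn⟩ := Nat.find_spec hex
      refine ⟨n, hn, fun i hi hi0 => Nat.find_min hex (hb ▸ hi) ⟨i, rfl, hi0⟩⟩
    exact hdeg n fun j hj => form_gsD_of_pivot_eq_zero hN hmin hn hj
  ext i j
  rw [congr_apply (B.isLower_gs N).rowFin (B.isLower_gs N).rowFin, rowp_gs, rowp_gs]
  rcases le_total (B.base i) (B.base j) with h | h
  · exact form_gsD hN (n := j) (fun k _ => hp k) h le_rfl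
  · exact form_gsD hN (n := i) (fun k _ => hp k) le_rfl h

end Relations

/-- The identity: symmetric, blocks of size `1`. -/
def one : BlockForm where
  par n := n
  base n := n
  sg _ := 1
  sym := 1
  par_par _ := rfl
  base_le _ := le_rfl
  base_base _ := rfl
  base_par _ := rfl
  lt_base _ _ h := h
  mem_block _ := Or.inl rfl
  sg_mul _ := by simp
  sg_base _ := rfl
  sg_par _ := by simp
  par_base _ := Or.inl rfl

/-- The matrix `J`: skew-symmetric, blocks of size `2`. -/
def skew : BlockForm where
  par n := if n % 2 = 0 then n + 1 else n - 1
  base n := 2 * (n / 2)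
  sg n := if n % 2 = 0 then 1 else -1
  sym := -1
  par_par n := by split_ifs <;> omega
  base_le n := by omega
  base_base n := by omega
  base_par n := by split_ifs <;> omega
  lt_base i n h := by omega
  mem_block n := by split_ifs <;> omega
  sg_mul n := by split_ifs <;> simp
  sg_base n := by simp
  sg_par n := by split_ifs <;> first | omega | simp
  par_base _ := Or.inr rfl

lemma eta_one : one.eta = 1 := by
  ext i j
  simp [eta, one, Matrix.one_apply, eq_comm]

lemma eta_skew : skew.eta = Jmat := by
  ext i j
  simp only [eta, skew, Jmat]
  split_ifs <;> first | rfl | omega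

end BlockForm

end TodaPfaff
end

/-! ### Differentiating block Gram–Schmidt -/

noncomputable section

namespace TodaPfaff

lemma form_hasDerivWithinAt {N : ℂ → IMat} {N' : IMat} {A : Set ℂ} (h : HasEntryDeriv N N' A)
    (φ ψ : ℂ[X]) : HasDerivWithinAt (fun s => form (N s) φ ψ) (form N' φ ψ) A 0 := by
  have h1 : φ.natDegree < φ.natDegree + ψ.natDegree + 1 := by omega
  have h2 : ψ.natDegree < φ.natDegree + ψ.natDegree + 1 := by omega
  simp only [form_eq_sum _ h1 h2]
  exact HasDerivWithinAt.fun_sum fun a _ => HasDerivWithinAt.fun_sum fun b _ =>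
    ((h a b).const_mul _).mul_const _

/-- The product rule, when the rows of the left factor are supported in a fixed finite set. -/
lemma HasEntryDeriv.imul {F G : ℂ → IMat} {F' G' : IMat} {A : Set ℂ} (hF : HasEntryDeriv F F' A)
    (hG : HasEntryDeriv G G' A)
    (hs : ∀ i, ∃ s : Finset ℕ, ∀ k, k ∉ s → (∀ z, F z i k = 0) ∧ F' i k = 0) :
    HasEntryDeriv (fun z => F z ⬝∞ G z) (F' ⬝∞ G 0 + F 0 ⬝∞ G') A := fun i j => by
  obtain ⟨s, hs⟩ := hs i
  have h1 : ∀ z, (F z ⬝∞ G z) i j = ∑ k ∈ s, F z i k * G z k j := fun z =>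
    imul_eq_sum s fun k hk => by rw [(hs k hk).1, zero_mul]
  simp only [h1, Matrix.add_apply]
  rw [imul_eq_sum (A := F') s fun k hk => by rw [(hs k hk).2, zero_mul],
    imul_eq_sum (A := F 0) s fun k hk => by rw [(hs k hk).1, zero_mul], ← Finset.sum_add_distrib]
  exact HasDerivWithinAt.fun_sum fun k _ => (hF i k).mul (hG k j)

/-- The inverse of a lower-triangular curve through the identity. -/
lemma HasEntryDeriv.linv {F : ℂ → IMat} {F' : IMat} {A : Set ℂ} (hF : HasEntryDeriv F F' A)
    (hl : ∀ z, IsLower (F z)) (hl' : IsLT F') (h0 : F 0 = 1) :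
    HasEntryDeriv (fun z => linv (F z)) (-F') A := by
  intro i
  induction i using Nat.strong_induction_on with
  | _ i ih =>
    intro j
    have h1 : ∀ z, TodaPfaff.linv (F z) i j = (F z i i)⁻¹ *
        ((1 : IMat) i j - ∑ k ∈ Finset.range i, F z i k * TodaPfaff.linv (F z) k j) := fun z => by
      have h := congrFun (congrFun (hl z).imul_linv i) j
      rw [(hl z).isLT.imul_apply, Finset.sum_range_succ] at h
      rw [← h]
      field_simp [(hl z).2 i]
      ring
    have hL0 : TodaPfaff.linv (F 0) = 1 := by
      rw [h0]
      exact (isLower_one.eq_linv rowFin_one (one_imul 1)).symm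
    simp only [h1]
    have hd : F 0 i i ≠ 0 := (hl 0).2 i
    have h2 : HasDerivWithinAt
        (fun z => ∑ k ∈ Finset.range i, F z i k * TodaPfaff.linv (F z) k j)
        (∑ k ∈ Finset.range i, (F' i k * (1 : IMat) k j + (1 : IMat) i k * (-F') k j)) A 0 := by
      refine HasDerivWithinAt.fun_sum fun k hk => ?_
      have := (hF i k).mul (ih k (Finset.mem_range.1 hk) j)
      exact this.congr_deriv (by beta_reduce; rw [hL0, h0])
    refine (((hF i i).fun_inv hd).mul (h2.const_sub _)).congr_deriv ?_
    have e0 : ∑ k ∈ Finset.range i, F 0 i k * TodaPfaff.linv (F 0) k j = 0 := by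
      refine Finset.sum_eq_zero fun k hk => ?_
      rw [h0, Matrix.one_apply_ne (by simp at hk; omega), zero_mul]
    have e1 : ∑ k ∈ Finset.range i, (F' i k * (1 : IMat) k j + (1 : IMat) i k * (-F') k j) =
        ∑ k ∈ Finset.range i, F' i k * (1 : IMat) k j := by
      refine Finset.sum_congr rfl fun k hk => ?_
      rw [Matrix.one_apply_ne (show i ≠ k by simp at hk; omega), zero_mul, add_zero]
    rw [e0, e1, h0]
    rcases lt_trichotomy j i with h | h | h
    · rw [Finset.sum_eq_single_of_mem j (by simpa using h) fun k _ hk => by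
        rw [Matrix.one_apply_ne hk, mul_zero]]
      simp [h.ne']
    · subst h
      rw [Finset.sum_eq_zero fun k hk => by
        rw [Matrix.one_apply_ne (by simp at hk; omega), mul_zero]]
      simp
    · rw [Finset.sum_eq_zero fun k hk => by
        rw [Matrix.one_apply_ne (by simp at hk; omega), mul_zero]]
      simp [h.ne, hl' i j h]

/-- Conjugating a fixed matrix by a lower-triangular curve through the identity. -/
lemma HasEntryDeriv.conj {F : ℂ → IMat} {F' : IMat} {A : Set ℂ} (hF : HasEntryDeriv F F' A)
    (hl : ∀ z, IsLower (F z)) (hl' : IsLT F') (h0 : F 0 = 1) {L : IMat} (hL : RowFin L) :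
    HasEntryDeriv (fun z => F z ⬝∞ L ⬝∞ TodaPfaff.linv (F z)) (icomm F' L) A := by
  have hc : HasEntryDeriv (fun _ => L) 0 A := fun i j => hasDerivWithinAt_const _ _ _
  have h1 := hF.imul hc fun i => ⟨Finset.range (i + 1), fun k hk =>
    ⟨fun z => (hl z).1 i k (by simpa using hk), hl' i k (by simpa using hk)⟩⟩
  have e1 : F' ⬝∞ L + F 0 ⬝∞ 0 = F' ⬝∞ L := by
    rw [h0, one_imul, add_zero]
  rw [e1] at h1
  have h2 := h1.imul (hF.linv hl hl' h0) fun i => by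
    choose t ht using fun j => hL.exists_finset j
    refine ⟨(Finset.range (i + 1)).biUnion t, fun k hk => ?_⟩
    have hk' : ∀ j ∈ Finset.range (i + 1), L j k = 0 := fun j hj =>
      ht j k fun hc => hk (Finset.mem_biUnion.2 ⟨j, hj, hc⟩)
    refine ⟨fun z => ?_, ?_⟩
    · rw [(hl z).isLT.imul_apply]
      exact Finset.sum_eq_zero fun j hj => by rw [hk' j hj, mul_zero]
    · rw [hl'.imul_apply]
      exact Finset.sum_eq_zero fun j hj => by rw [hk' j hj, mul_zero]
  have hL0 : TodaPfaff.linv (F 0) = 1 := by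
    rw [h0]
    exact (isLower_one.eq_linv rowFin_one (one_imul 1)).symm
  rw [hL0, h0, one_imul, imul_one, imul_neg, ← sub_eq_add_neg] at h2
  exact h2

namespace BlockForm

variable (B : BlockForm)

lemma gsV_eta_of_gsD (n : ℕ) (ih : ∀ i < B.base n, B.gsD B.eta i = X ^ i) :
    B.gsV B.eta n = X ^ n := by
  rw [gsV_eq, Finset.sum_eq_zero, sub_zero]
  intro i hi
  rw [Finset.mem_range] at hi
  rw [ih i hi, form_X_pow, B.eta_of_base_ne (B.base_lt hi).ne, mul_zero, zero_smul]

lemma pivot_eta_of_gsV (n : ℕ) (h1 : B.gsV B.eta (B.base n) = X ^ B.base n)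
    (h2 : B.gsV B.eta (B.par (B.base n)) = X ^ B.par (B.base n)) : B.pivot B.eta n = 1 := by
  rw [pivot, h1, h2, form_X_pow, eta, if_pos rfl, B.sg_base]

lemma gsV_eta (n : ℕ) : B.gsV B.eta n = X ^ n := by
  induction n using Nat.strong_induction_on with
  | _ n ih =>
    refine B.gsV_eta_of_gsD n fun i hi => ?_
    have hn := B.base_le n
    rw [gsD, ih i (hi.trans_le hn), B.pivot_eta_of_gsV i
      (ih _ ((B.base_lt hi).trans_le hn)) (ih _ ((B.par_lt (B.base_lt hi)).trans_le hn)),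
      rsqrt_one, one_smul]

lemma pivot_eta (n : ℕ) : B.pivot B.eta n = 1 :=
  B.pivot_eta_of_gsV n (B.gsV_eta _) (B.gsV_eta _)

lemma gsD_eta (n : ℕ) : B.gsD B.eta n = X ^ n := by
  rw [gsD, B.gsV_eta, B.pivot_eta, rsqrt_one, one_smul]

lemma gs_eta : B.gs B.eta = 1 := by
  ext i j
  rw [gs, gsD_eta, coeff_X_pow, Matrix.one_apply]
  simp [eq_comm]

section Curve

variable {B} {N : ℂ → IMat} {A : Set ℂ}

lemma differentiableWithinAt_form (hN : ∀ i j, DifferentiableWithinAt ℂ (fun s => N s i j) A 0)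
    {φ ψ : ℂ → ℂ[X]} {M : ℕ} (hφM : ∀ s, (φ s).natDegree < M) (hψM : ∀ s, (ψ s).natDegree < M)
    (hφ : ∀ a, DifferentiableWithinAt ℂ (fun s => (φ s).coeff a) A 0)
    (hψ : ∀ a, DifferentiableWithinAt ℂ (fun s => (ψ s).coeff a) A 0) :
    DifferentiableWithinAt ℂ (fun s => form (N s) (φ s) (ψ s)) A 0 := by
  simp only [form_eq_sum _ (hφM _) (hψM _)]
  exact DifferentiableWithinAt.fun_sum fun a _ => DifferentiableWithinAt.fun_sum fun b _ =>
    ((hφ a).mul (hN a b)).mul (hψ b)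

lemma natDegree_gsV_lt (N : IMat) (n : ℕ) : (B.gsV N n).natDegree < n + 1 := by
  have h : B.gsV N n = (rsqrt (B.pivot N n))⁻¹ • B.gsD N n := by
    rw [gsD, smul_smul, inv_mul_cancel₀ (rsqrt_ne_zero _), one_smul]
  rw [h]
  exact Nat.lt_succ_of_le ((natDegree_smul_le _ _).trans (B.natDegree_gsD_le N n))

variable (hN : ∀ i j, DifferentiableWithinAt ℂ (fun s => N s i j) A 0) (h0 : N 0 = B.eta)

include hN

lemma differentiableWithinAt_pivot {n : ℕ}
    (h1 : ∀ a, DifferentiableWithinAt ℂ (fun s => (B.gsV (N s) (B.base n)).coeff a) A 0)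
    (h2 : ∀ a, DifferentiableWithinAt ℂ (fun s => (B.gsV (N s) (B.par (B.base n))).coeff a) A 0) :
    DifferentiableWithinAt ℂ (fun s => B.pivot (N s) n) A 0 :=
  differentiableWithinAt_form hN (M := B.base n + B.par (B.base n) + 1)
    (fun s => (natDegree_gsV_lt (N s) _).trans_le (by omega))
    (fun s => (natDegree_gsV_lt (N s) _).trans_le (by omega)) h1 h2

include h0

lemma differentiableWithinAt_gsD_of_gsV {n : ℕ}
    (h : ∀ a, DifferentiableWithinAt ℂ (fun s => (B.gsV (N s) n).coeff a) A 0)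
    (h1 : ∀ a, DifferentiableWithinAt ℂ (fun s => (B.gsV (N s) (B.base n)).coeff a) A 0)
    (h2 : ∀ a, DifferentiableWithinAt ℂ (fun s => (B.gsV (N s) (B.par (B.base n))).coeff a) A 0)
    (a : ℕ) : DifferentiableWithinAt ℂ (fun s => (B.gsD (N s) n).coeff a) A 0 := by
  simp only [gsD, coeff_smul, smul_eq_mul]
  refine DifferentiableWithinAt.mul ?_ (h a)
  have hp := differentiableWithinAt_pivot hN h1 h2
  have hp0 : B.pivot (N 0) n = 1 := by rw [h0, pivot_eta]
  simp only [rsqrt]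
  exact ((hp.clog (by rw [hp0]; exact Complex.one_mem_slitPlane)).neg.div_const 2).cexp

lemma differentiableWithinAt_gsV (n a : ℕ) :
    DifferentiableWithinAt ℂ (fun s => (B.gsV (N s) n).coeff a) A 0 := by
  induction n using Nat.strong_induction_on generalizing a with
  | _ n ih =>
    have hn := B.base_le n
    have hD : ∀ i < B.base n, ∀ a, DifferentiableWithinAt ℂ
        (fun s => (B.gsD (N s) i).coeff a) A 0 := fun i hi =>
      differentiableWithinAt_gsD_of_gsV hN h0 (ih i (hi.trans_le hn))
        (ih _ ((B.base_lt hi).trans_le hn)) (ih _ ((B.par_lt (B.base_lt hi)).trans_le hn))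
    simp only [gsV_eq, coeff_sub, finsetSum_coeff, coeff_smul, smul_eq_mul]
    refine (differentiableWithinAt_const _).sub (DifferentiableWithinAt.fun_sum fun i hi => ?_)
    rw [Finset.mem_range] at hi
    refine DifferentiableWithinAt.mul
      (DifferentiableWithinAt.mul (differentiableWithinAt_const _) ?_)
      (hD _ (B.par_lt hi) a)
    refine differentiableWithinAt_form hN (M := n + 1) (fun s => by simp)
      (fun s => Nat.lt_succ_of_le ((B.natDegree_gsD_le _ _).trans (hi.le.trans hn)))
      (fun a => differentiableWithinAt_const _) (hD i hi)

lemma differentiableWithinAt_gs (i j : ℕ) :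
    DifferentiableWithinAt ℂ (fun s => B.gs (N s) i j) A 0 :=
  differentiableWithinAt_gsD_of_gsV hN h0 (differentiableWithinAt_gsV hN h0 _)
    (differentiableWithinAt_gsV hN h0 _) (differentiableWithinAt_gsV hN h0 _) j

lemma eventually_form_gsD (hsym : ∀ s i j, N s j i = B.sym * N s i j) (i j : ℕ) :
    ∀ᶠ s in 𝓝[A] 0, form (N s) (B.gsD (N s) i) (B.gsD (N s) j) = B.eta i j := by
  have hp : ∀ n, ∀ᶠ s in 𝓝[A] 0, B.pivot (N s) n ≠ 0 := fun n => by
    have hd := differentiableWithinAt_pivot hN (n := n)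
      (differentiableWithinAt_gsV hN h0 _) (differentiableWithinAt_gsV hN h0 _)
    refine hd.continuousWithinAt.eventually_ne ?_
    change B.pivot (N 0) n ≠ 0
    rw [h0, pivot_eta]
    exact one_ne_zero
  have hall : ∀ᶠ s in 𝓝[A] 0, ∀ n ∈ Finset.range (i + j + 1), B.pivot (N s) n ≠ 0 :=
    (Finset.range (i + j + 1)).eventually_all.2 fun n _ => hp n
  filter_upwards [hall] with s hs
  have hb : ∀ n ≤ i + j, ∀ k, B.base k ≤ B.base n → B.pivot (N s) k ≠ 0 := fun n hn k hk => by
    rw [← B.pivot_base]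
    exact hs _ (Finset.mem_range.2 (by have := B.base_le n; omega))
  rcases le_total (B.base i) (B.base j) with h | h
  · exact form_gsD (hsym s) (hb j (by omega)) h le_rfl
  · exact form_gsD (hsym s) (hb i (by omega)) le_rfl h

/-- Along a curve of forms through the normal form, Gram–Schmidt gives a curve of lower-triangular
matrices through the identity that brings the forms to normal form, entry by entry near `0`. Its
velocity `D'` satisfies `D' η + N' + η D'ᵀ = 0`. -/
theorem exists_hasEntryDeriv_gs {N' : IMat} (hN' : HasEntryDeriv N N' A)
    (hsym : ∀ s i j, N s j i = B.sym * N s i j) (hA : UniqueDiffWithinAt ℂ A 0) :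
    ∃ D' : IMat, HasEntryDeriv (fun s => B.gs (N s)) D' A ∧
      (∀ i j, B.base i ≤ j → j ≠ i → D' i j = 0) ∧ (∀ i, D' i i = D' (B.base i) (B.base i)) ∧
      ∀ i j, D' i (B.par j) * B.sg (B.par j) + N' i j + B.sg i * D' j (B.par i) = 0 := by
  have hD : HasEntryDeriv (fun s => B.gs (N s))
      (fun i j => derivWithin (fun s => B.gs (N s) i j) A 0) A := fun i j =>
    (differentiableWithinAt_gs hN h0 i j).hasDerivWithinAt
  set D' : IMat := fun i j => derivWithin (fun s => B.gs (N s) i j) A 0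
  refine ⟨D', hD, fun i j hij hne => ?_, fun i => ?_, fun i j => ?_⟩
  · refine hA.eq_deriv _ (hD i j) ?_
    simp only [B.gs_of_base_le _ hij hne]
    exact hasDerivWithinAt_const _ _ _
  · refine hA.eq_deriv _ (hD i i) ?_
    have := hD (B.base i) (B.base i)
    simp only [gs_diag, pivot_base] at this ⊢
    exact this
  · set M := i + j + B.par i + B.par j + 1 with hM
    have hf : ∀ s, form (N s) (B.gsD (N s) i) (B.gsD (N s) j) =
        ∑ a ∈ Finset.range M, ∑ b ∈ Finset.range M, B.gs (N s) i a * N s a b * B.gs (N s) j b :=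
      fun s => form_eq_sum _ ((B.natDegree_gsD_le _ _).trans_lt (by omega))
        ((B.natDegree_gsD_le _ _).trans_lt (by omega))
    have h1 : HasDerivWithinAt (fun s => form (N s) (B.gsD (N s) i) (B.gsD (N s) j)) 0 A 0 := by
      refine (hasDerivWithinAt_const (0 : ℂ) A (B.eta i j)).congr_of_eventuallyEq
        (eventually_form_gsD hN h0 hsym i j) ?_
      rw [h0, gsD_eta, gsD_eta, form_X_pow]
    simp only [hf] at h1
    have h2 := HasDerivWithinAt.fun_sum (u := Finset.range M) fun a _ =>
      HasDerivWithinAt.fun_sum (u := Finset.range M) fun b _ =>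
        ((hD i a).fun_mul (hN' a b)).fun_mul (hD j b)
    have h3 := hA.eq_deriv _ h2 h1
    rw [← h3]
    simp only [h0, gs_eta, Matrix.one_apply, Finset.sum_add_distrib, mul_ite, mul_one,
      mul_zero, ite_mul, one_mul, zero_mul, Finset.sum_ite_eq, Finset.mem_range]
    have e1 : ∑ a ∈ Finset.range M, D' i a * B.eta a j = D' i (B.par j) * B.sg (B.par j) := by
      rw [Finset.sum_eq_single_of_mem (B.par j) (by simp; omega)]
      · rw [eta, if_pos (B.par_par j).symm]
      · intro a _ ha
        rw [eta, if_neg fun hc => ha (by rw [hc, B.par_par]), mul_zero]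
    have e2 : ∑ b ∈ Finset.range M, B.eta i b * D' j b = B.sg i * D' j (B.par i) := by
      rw [Finset.sum_eq_single_of_mem (B.par i) (by simp; omega)]
      · rw [eta, if_pos rfl]
      · intro b _ hb
        rw [eta, if_neg hb, zero_mul]
    rw [Finset.sum_comm (f := fun a b => if i = a then _ else _)]
    simp only [Finset.sum_ite_eq, Finset.mem_range, show i < M by omega, show j < M by omega,
      if_true, e1, e2, Finset.sum_add_distrib]

end Curve

end BlockForm

end TodaPfaff
end

/-! ### Pfaffians -/

noncomputable section

namespace TodaPfaff

/-- The first element `2k` of the `k`-th pair of indices. -/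
abbrev fstIdx {n : ℕ} (k : Fin n) : Fin (2 * n) := ⟨2 * k, by omega⟩

/-- The second element `2k + 1` of the `k`-th pair of indices. -/
abbrev sndIdx {n : ℕ} (k : Fin n) : Fin (2 * n) := ⟨2 * k + 1, by omega⟩

/-- The pairs `(2k, 2k+1)` exhaust the indices. -/
def pairEquiv (n : ℕ) : Fin n × Fin 2 ≃ Fin (2 * n) where
  toFun p := ⟨2 * p.1 + p.2, by omega⟩
  invFun i := (⟨i / 2, by omega⟩, ⟨i % 2, by omega⟩)
  left_inv p := by ext <;> simp <;> omega
  right_inv i := by ext; simp; omega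

lemma pairEquiv_zero {n : ℕ} (k : Fin n) : pairEquiv n (k, 0) = fstIdx k := rfl

lemma pairEquiv_one {n : ℕ} (k : Fin n) : pairEquiv n (k, 1) = sndIdx k := rfl

lemma prod_pairs {M : Type*} [CommMonoid M] {n : ℕ} (g : Fin (2 * n) → M) :
    ∏ i, g i = ∏ k, g (fstIdx k) * g (sndIdx k) := by
  rw [← (pairEquiv n).prod_comp, Fintype.prod_prod_type]
  exact Finset.prod_congr rfl fun k _ => by
    rw [Fin.prod_univ_two, pairEquiv_zero, pairEquiv_one]

/-- `2ⁿ n!` times the Pfaffian, for finite matrices. -/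
def pfSum {n : ℕ} (A : Matrix (Fin (2 * n)) (Fin (2 * n)) ℂ) : ℂ :=
  ∑ σ : Equiv.Perm (Fin (2 * n)), ((Equiv.Perm.sign σ : ℤ) : ℂ) *
    ∏ k : Fin n, A (σ (fstIdx k)) (σ (sndIdx k))

lemma pf_eq (A : IMat) (n : ℕ) :
    pf A n = (1 / (2 ^ n * n.factorial : ℂ)) * pfSum (corner A (2 * n)) := rfl

lemma prod_sum_pairs {n : ℕ} (T : Fin n → Fin (2 * n) → Fin (2 * n) → ℂ) :
    ∏ k, ∑ a, ∑ b, T k a b =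
      ∑ g : Fin (2 * n) → Fin (2 * n), ∏ k, T k (g (fstIdx k)) (g (sndIdx k)) := by
  let e : (Fin (2 * n) → Fin (2 * n)) ≃ (Fin n → Fin (2 * n) × Fin (2 * n)) :=
    { toFun := fun g k => (g (fstIdx k), g (sndIdx k))
      invFun := fun f i => if ((pairEquiv n).symm i).2 = 0 then (f ((pairEquiv n).symm i).1).1
        else (f ((pairEquiv n).symm i).1).2
      left_inv := fun g => by
        funext i
        obtain ⟨⟨k, b⟩, rfl⟩ := (pairEquiv n).surjective i
        fin_cases b <;> simp [← pairEquiv_zero, ← pairEquiv_one]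
      right_inv := fun f => by
        funext k
        simp [← pairEquiv_zero, ← pairEquiv_one] }
  simp_rw [← Fintype.sum_prod_type' (f := T _)]
  rw [Finset.prod_univ_sum, Fintype.piFinset_univ, ← e.sum_comp]
  rfl

lemma pfSum_congr {n : ℕ} (B A : Matrix (Fin (2 * n)) (Fin (2 * n)) ℂ) :
    pfSum (B * A * B.transpose) = B.det * pfSum A := by
  classical
  have h1 : ∀ i j, (B * A * B.transpose) i j = ∑ a, ∑ b, B i a * A a b * B j b := fun i j => by
    rw [Matrix.mul_apply, Finset.sum_comm]
    refine Finset.sum_congr rfl fun b _ => ?_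
    rw [Matrix.mul_apply, Finset.sum_mul]
    rfl
  have h2 : pfSum (B * A * B.transpose) = ∑ g : Fin (2 * n) → Fin (2 * n),
      (B.submatrix id g).det * ∏ k, A (g (fstIdx k)) (g (sndIdx k)) := by
    unfold pfSum
    simp_rw [h1, prod_sum_pairs, Finset.mul_sum]
    rw [Finset.sum_comm]
    refine Finset.sum_congr rfl fun g _ => ?_
    rw [Matrix.det_apply', Finset.sum_mul]
    refine Finset.sum_congr rfl fun σ _ => ?_
    rw [mul_assoc]
    congr 1
    simp only [Matrix.submatrix_apply, id]
    rw [prod_pairs, ← Finset.prod_mul_distrib]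
    exact Finset.prod_congr rfl fun k _ => by ring
  rw [h2, pfSum, Finset.mul_sum]
  symm
  refine Finset.sum_of_injOn (fun σ => ⇑σ) (fun _ _ _ _ h => Equiv.coe_fn_injective h) (by simp)
    (fun g _ hg => ?_) fun σ _ => ?_
  · have hni : ¬ Function.Injective g := fun hi => hg
      ⟨Equiv.ofBijective g (Finite.injective_iff_bijective.1 hi), by simp, rfl⟩
    simp only [Function.Injective, not_forall] at hni
    obtain ⟨a, b, hab, hne⟩ := hni
    rw [Matrix.det_zero_of_column_eq hne fun k => by simp [hab], zero_mul]
  · rw [Matrix.det_permute']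
    ring

/-- The block-diagonal matrix `J` on pairs. -/
lemma Jmat_pairEquiv {n : ℕ} (p q : Fin n × Fin 2) :
    Jmat (pairEquiv n p) (pairEquiv n q) =
      if p.1 = q.1 then (if p.2 = 0 ∧ q.2 = 1 then 1 else if p.2 = 1 ∧ q.2 = 0 then -1 else 0)
        else 0 := by
  obtain ⟨a, b⟩ := p
  obtain ⟨c, d⟩ := q
  fin_cases b <;> fin_cases d <;> simp [Jmat, pairEquiv, Fin.ext_iff] <;> grind

/-- Only the permutations that permute the pairs contribute to the Pfaffian of `J`, and each of
them contributes `1`. -/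
lemma pfSum_Jmat (n : ℕ) : pfSum (corner Jmat (2 * n)) = 2 ^ n * n.factorial := by
  classical
  let T : Equiv.Perm (Fin n × Fin 2) → ℂ := fun σ => ((Equiv.Perm.sign σ : ℤ) : ℂ) *
    ∏ k : Fin n, Jmat (pairEquiv n (σ (k, 0))) (pairEquiv n (σ (k, 1)))
  have h1 : pfSum (corner Jmat (2 * n)) = ∑ σ, T σ := by
    rw [pfSum, ← (pairEquiv n).permCongr.sum_comp]
    refine Finset.sum_congr rfl fun σ _ => ?_
    rw [Equiv.Perm.sign_permCongr]
    simp only [← pairEquiv_zero, ← pairEquiv_one, Equiv.permCongr_apply, Equiv.symm_apply_apply]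
    rfl
  let Φ : Equiv.Perm (Fin n) × (Fin n → Equiv.Perm (Fin 2)) → Equiv.Perm (Fin n × Fin 2) :=
    fun x => (Equiv.prodCongrLeft fun _ => x.1) * Equiv.prodCongrRight x.2
  have hΦ : ∀ x k b, Φ x (k, b) = (x.1 k, x.2 k b) := fun x k b => rfl
  have hsgn2 : ∀ τ : Equiv.Perm (Fin 2), (if τ 0 = 0 ∧ τ 1 = 1 then (1 : ℂ) else
      if τ 0 = 1 ∧ τ 1 = 0 then -1 else 0) = ((Equiv.Perm.sign τ : ℤ) : ℂ) := fun τ => by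
    have : ∀ τ : Equiv.Perm (Fin 2), (if τ 0 = 0 ∧ τ 1 = 1 then (1 : ℤ) else
      if τ 0 = 1 ∧ τ 1 = 0 then -1 else 0) = (Equiv.Perm.sign τ : ℤ) := by decide
    rw [← this τ]
    split_ifs <;> simp
  have hT : ∀ x, T (Φ x) = 1 := fun x => by
    simp only [T, hΦ, Jmat_pairEquiv, if_true, hsgn2]
    rw [Equiv.Perm.sign_mul, Equiv.Perm.sign_prodCongrLeft, Equiv.Perm.sign_prodCongrRight,
      Fin.prod_univ_two]
    rw [← Int.cast_prod, ← Int.cast_mul, ← Units.coe_prod, ← Units.val_mul]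
    simp
  have hinj : Function.Injective Φ := fun x y h => by
    have h' : ∀ k b, x.1 k = y.1 k ∧ x.2 k b = y.2 k b := fun k b => by
      have := congrArg (fun σ : Equiv.Perm (Fin n × Fin 2) => σ (k, b)) h
      simpa [hΦ] using this
    exact Prod.ext (Equiv.ext fun k => (h' k 0).1)
      (funext fun k => Equiv.ext fun b => (h' k b).2)
  have hsum : ∑ σ, T σ = ∑ x, T (Φ x) := by
    symm
    refine Finset.sum_of_injOn Φ hinj.injOn (by simp) (fun σ _ hσ => ?_) fun _ _ => rfl
    by_contra hne
    have hk : ∀ k, (σ (k, 0)).1 = (σ (k, 1)).1 := fun k => by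
      by_contra hk
      refine hne (mul_eq_zero_of_right _ (Finset.prod_eq_zero (Finset.mem_univ k) ?_))
      rw [Jmat_pairEquiv, if_neg hk]
    have hk' : ∀ k b, (σ (k, b)).1 = (σ (k, 0)).1 := fun k b => by
      fin_cases b
      · rfl
      · exact (hk k).symm
    have hτ : ∀ k, Function.Injective fun b => (σ (k, b)).2 := fun k b c hbc => by
      have : σ (k, b) = σ (k, c) := Prod.ext ((hk' k b).trans (hk' k c).symm) hbc
      simpa using this
    have hsurj : Function.Surjective fun k => (σ (k, 0)).1 := fun a => by
      obtain ⟨⟨k, b⟩, hkb⟩ := σ.surjective (a, 0)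
      exact ⟨k, by change (σ (k, 0)).1 = a; rw [← hk' k b, hkb]⟩
    refine hσ ⟨(Equiv.ofBijective _ (Finite.surjective_iff_bijective.1 hsurj),
      fun k => Equiv.ofBijective _ (Finite.injective_iff_bijective.1 (hτ k))), by simp, ?_⟩
    refine Equiv.ext fun ⟨k, b⟩ => ?_
    rw [hΦ]
    exact Prod.ext (hk' k b).symm rfl
  rw [h1, hsum, Finset.sum_congr rfl fun x _ => hT x]
  simp [Finset.card_univ, Fintype.card_perm, mul_comm]

lemma corner_congr {D : IMat} (hD : IsLT D) (m : IMat) (N : ℕ) :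
    corner (D ⬝∞ m ⬝∞ D.transpose) N = corner D N * corner m N * (corner D N).transpose := by
  ext i j
  have h1 : ∀ i : Fin N, ∀ k, k ∉ Finset.range N → D i k = 0 := fun i k hk =>
    hD i k (by simp at hk; omega)
  have h2 : ∀ k, (D ⬝∞ m) i k = ∑ a : Fin N, D i a * m a k := fun k => by
    rw [imul_eq_sum (Finset.range N) fun a ha => by rw [h1 i a ha, zero_mul], Finset.sum_range]
  change (D ⬝∞ m ⬝∞ D.transpose) i j = _
  rw [imul_eq_sum (Finset.range N) fun k hk => by
    rw [Matrix.transpose_apply, h1 j k hk, mul_zero], Finset.sum_range, Matrix.mul_apply]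
  refine Finset.sum_congr rfl fun b _ => ?_
  rw [h2, Matrix.mul_apply]
  rfl

lemma pf_Jmat (n : ℕ) : pf Jmat n = 1 := by
  rw [pf_eq, pfSum_Jmat]
  have := Nat.factorial_ne_zero n
  field_simp

lemma pf_congr {D : IMat} (hD : IsLT D) (m : IMat) (n : ℕ) :
    pf (D ⬝∞ m ⬝∞ D.transpose) n = (∏ i ∈ Finset.range (2 * n), D i i) * pf m n := by
  rw [pf_eq, pf_eq, corner_congr hD, pfSum_congr, hD.det_corner, Finset.prod_range]
  ring

lemma Jmat_imul (A : IMat) (i j : ℕ) :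
    (Jmat ⬝∞ A) i j = BlockForm.skew.sg i * A (BlockForm.skew.par i) j := by
  rw [← BlockForm.eta_skew, imul_eq_sum {BlockForm.skew.par i} fun k hk => by
    rw [BlockForm.eta, if_neg (by simpa using hk), zero_mul]]
  simp [BlockForm.eta]

lemma imul_Jmat (A : IMat) (i j : ℕ) :
    (A ⬝∞ Jmat) i j = A i (BlockForm.skew.par j) * BlockForm.skew.sg (BlockForm.skew.par j) := by
  rw [← BlockForm.eta_skew, imul_eq_sum {BlockForm.skew.par j} fun k hk => by
    rw [BlockForm.eta, if_neg fun hc => hk (by simp [hc, BlockForm.skew.par_par]), mul_zero]]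
  simp [BlockForm.eta, BlockForm.skew.par_par]

lemma Jmat_transpose : Jmat.transpose = -Jmat := by
  ext i j
  rw [Matrix.transpose_apply, Matrix.neg_apply, ← BlockForm.eta_skew, BlockForm.eta_comm]
  simp [BlockForm.skew]

/-- The lower-triangular matrix that takes `J` to the matrix of the order relation. -/
def orderMat : IMat := fun i j => if j ≤ i ∧ (j % 2 = 1 ∨ j / 2 = i / 2) then 1 else 0

lemma orderMat_congr {i j : ℕ} (h : i < j) :
    (orderMat ⬝∞ Jmat ⬝∞ orderMat.transpose) i j = 1 := by
  have hl : IsLT orderMat := fun i j hij => if_neg (by omega)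
  rw [imul_assoc' hl.rowFin _ (by rw [Matrix.transpose_transpose]; exact hl.rowFin),
    hl.imul_apply, Finset.sum_eq_single_of_mem (2 * (i / 2)) (by simp; omega)]
  · rw [Jmat_imul]
    simp only [Matrix.transpose_apply, orderMat, BlockForm.skew]
    split_ifs <;> first | omega | norm_num
  · intro k hk hne
    rw [Finset.mem_range] at hk
    rw [Jmat_imul]
    simp only [Matrix.transpose_apply, orderMat, BlockForm.skew]
    split_ifs <;> first | omega | simp

/-- The Pfaffian of the matrix of the order relation is `1`. -/
lemma pfSum_order {n : ℕ} {A : Matrix (Fin (2 * n)) (Fin (2 * n)) ℂ}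
    (hlt : ∀ i j, i < j → A i j = 1) (hgt : ∀ i j, j < i → A i j = -1) :
    pfSum A = 2 ^ n * n.factorial := by
  have hl : IsLT orderMat := fun i j hij => if_neg (by omega)
  have hsk : (orderMat ⬝∞ Jmat ⬝∞ orderMat.transpose).transpose =
      -(orderMat ⬝∞ Jmat ⬝∞ orderMat.transpose) := by
    rw [imul_transpose, imul_transpose, Matrix.transpose_transpose, Jmat_transpose, neg_imul,
      imul_neg, imul_assoc' hl.rowFin _ (by rw [Matrix.transpose_transpose]; exact hl.rowFin)]
  have h1 : pfSum A = pfSum (corner (orderMat ⬝∞ Jmat ⬝∞ orderMat.transpose) (2 * n)) := by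
    refine Finset.sum_congr rfl fun σ _ => ?_
    congr 1
    refine Finset.prod_congr rfl fun k _ => ?_
    change _ = (orderMat ⬝∞ Jmat ⬝∞ orderMat.transpose) _ _
    have hne : σ (fstIdx k) ≠ σ (sndIdx k) := fun h => by
      simpa using σ.injective h
    rcases lt_or_gt_of_ne hne with h | h
    · rw [hlt _ _ h, orderMat_congr h]
    · have := congrFun (congrFun hsk (σ (sndIdx k))) (σ (fstIdx k))
      rw [Matrix.transpose_apply, Matrix.neg_apply, orderMat_congr h] at this
      rw [hgt _ _ h, this]
  rw [h1, corner_congr hl, pfSum_congr, hl.det_corner, pfSum_Jmat, Finset.prod_eq_one, one_mul]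
  intro i _
  exact if_pos (by omega)

/-- A skew-symmetric matrix with a vanishing row has vanishing Pfaffian. -/
lemma pf_eq_zero_of_row {A : IMat} {n r : ℕ} (hr : r < 2 * n) (h : ∀ j < 2 * n, A r j = 0)
    (hs : ∀ i j, A j i = -A i j) : pf A n = 0 := by
  rw [pf_eq, pfSum, Finset.sum_eq_zero, mul_zero]
  intro σ _
  obtain ⟨⟨k, b⟩, hkb⟩ := ((pairEquiv n).trans σ).surjective ⟨r, hr⟩
  refine mul_eq_zero_of_right _ (Finset.prod_eq_zero (Finset.mem_univ k) ?_)
  change A _ _ = 0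
  fin_cases b
  · have : σ (fstIdx k) = ⟨r, hr⟩ := hkb
    rw [this]
    exact h _ (Fin.is_lt _)
  · have : σ (sndIdx k) = ⟨r, hr⟩ := hkb
    rw [this, hs, h _ (Fin.is_lt _), neg_zero]

end TodaPfaff
end

/-! ### Borel and skew-Borel factorizations, and their time evolution -/

noncomputable section

namespace TodaPfaff

lemma RowFin.transpose_transpose {A : IMat} (h : RowFin A) : RowFin A.transpose.transpose := h

lemma isBorel_iff {S m : IMat} : IsBorel S m ↔ IsLower S ∧ S ⬝∞ m ⬝∞ S.transpose = 1 := by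
  refine and_congr_right fun hS => ?_
  rw [← hS.congr_eq_iff m 1, imul_one]

lemma IsLower.rowFin_Lmat {S : IMat} (hS : IsLower S) : RowFin (Lmat S) :=
  (hS.rowFin.imul rowFin_shift).imul hS.linv.rowFin

lemma IsLower.ipow_Lmat {S : IMat} (hS : IsLower S) (k : ℕ) :
    ipow (Lmat S) k = S ⬝∞ ipow shift k ⬝∞ TodaPfaff.linv S := ipow_conj hS rowFin_shift k

lemma Lmat_imul {D S : IMat} (hD : IsLower D) (hS : IsLower S) :
    Lmat (D ⬝∞ S) = D ⬝∞ Lmat S ⬝∞ linv D := by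
  simp only [Lmat]
  have h1 := hS.rowFin.imul rowFin_shift
  rw [hD.linv_mul hS, imul_assoc hD.rowFin hS.rowFin,
    ← imul_assoc (hD.rowFin.imul h1) hS.linv.rowFin, imul_assoc hD.rowFin h1]

lemma tLmat_eq {O S : IMat} (hO : IsLower O) (hS : IsLower S) : tLmat O S = Lmat (O ⬝∞ S) :=
  (Lmat_imul hO hS).symm

lemma ipow_comm {A : IMat} (hA : RowFin A) (k : ℕ) : ipow A k ⬝∞ A = A ⬝∞ ipow A k := by
  induction k with
  | zero => simp only [ipow, one_imul, imul_one]
  | succ k ih =>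
    simp only [ipow]
    rw [ih, imul_assoc hA (hA.ipow k), ih]

/-- Nested congruences. -/
lemma congr_imul {D Q : IMat} (hD : RowFin D) (hQ : RowFin Q) (m : IMat) :
    (D ⬝∞ Q) ⬝∞ m ⬝∞ (D ⬝∞ Q).transpose = D ⬝∞ (Q ⬝∞ m ⬝∞ Q.transpose) ⬝∞ D.transpose := by
  ext i j
  rw [imul_transpose, ← imul_assoc'' _ hQ.transpose_transpose hD.transpose_transpose,
    imul_assoc hD hQ, imul_assoc' hD _ hQ.transpose_transpose]

/-- If `Q m Qᵀ = η`, then `Q Λᵏ m Qᵀ = (Q Λ Q⁻¹)ᵏ η`. -/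
lemma congr_shift {Q m N : IMat} (hQ : IsLower Q) (h : Q ⬝∞ m ⬝∞ Q.transpose = N)
    (k : ℕ) :
    Q ⬝∞ (ipow shift k ⬝∞ m) ⬝∞ Q.transpose = ipow (Lmat Q) k ⬝∞ N := by
  have hk := rowFin_shift.ipow k
  rw [hQ.ipow_Lmat, ← h, imul_assoc' hQ.rowFin m hQ.rowFin.transpose_transpose,
    imul_assoc (hQ.rowFin.imul hk) hQ.linv.rowFin, ← imul_assoc hQ.linv.rowFin hQ.rowFin,
    hQ.linv_imul, one_imul, imul_assoc hQ.rowFin hk,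
    imul_assoc' hQ.rowFin _ hQ.rowFin.transpose_transpose,
    imul_assoc' hk _ hQ.rowFin.transpose_transpose]

lemma HasEntryDeriv.congr_const {F : ℂ → IMat} {F' : IMat} {A : Set ℂ} (hF : HasEntryDeriv F F' A)
    {Q : IMat} (hQ : RowFin Q) :
    HasEntryDeriv (fun s => Q ⬝∞ F s ⬝∞ Q.transpose) (Q ⬝∞ F' ⬝∞ Q.transpose) A := fun i j => by
  simp only [congr_apply hQ hQ]
  exact form_hasDerivWithinAt hF _ _

lemma transpose_congr (Q : IMat) {m : IMat} (hQ : RowFin Q) :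
    (Q ⬝∞ m ⬝∞ Q.transpose).transpose = Q ⬝∞ m.transpose ⬝∞ Q.transpose := by
  rw [imul_transpose, imul_transpose, Matrix.transpose_transpose,
    imul_assoc' hQ _ hQ.transpose_transpose]

/-! The symmetric case. -/

/-- A symmetric matrix with nonvanishing principal minors has a Borel factorization. -/
theorem exists_isBorel {m : IMat} (hm : m.transpose = m)
    (hdet : ∀ n, (corner m n).det ≠ 0) : ∃ S, IsBorel S m := by
  have hsym : ∀ i j, m j i = BlockForm.one.sym * m i j := fun i j => by
    change m.transpose i j = 1 * _
    rw [hm, one_mul]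
  have hl := BlockForm.one.isLower_gs m
  refine ⟨BlockForm.one.gs m, isBorel_iff.2 ⟨hl, ?_⟩⟩
  rw [BlockForm.gs_congr hsym, BlockForm.eta_one]
  intro n h
  have hz : (corner (BlockForm.one.gs m ⬝∞ m ⬝∞ (BlockForm.one.gs m).transpose) (n + 1)).det = 0 :=
    Matrix.det_eq_zero_of_row_eq_zero (Fin.last n) fun j => by
      change (BlockForm.one.gs m ⬝∞ m ⬝∞ (BlockForm.one.gs m).transpose) n j = 0
      rw [congr_apply hl.rowFin hl.rowFin, BlockForm.rowp_gs, BlockForm.rowp_gs]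
      exact h j (Nat.lt_succ_iff.1 j.2)
  rw [corner_congr hl.isLT, Matrix.det_mul, Matrix.det_mul, Matrix.det_transpose] at hz
  have hd := (hl.isUnit_det_corner (n + 1)).ne_zero
  simp only [mul_eq_zero, hd, hdet, or_false] at hz

lemma IsBorel.diag_sq {S m : IMat} (h : IsBorel S m) (n : ℕ) :
    S n n ^ 2 = (corner m n).det / (corner m (n + 1)).det := by
  obtain ⟨hl, h⟩ := isBorel_iff.1 h
  have key : ∀ N, (∏ i ∈ Finset.range N, S i i) ^ 2 * (corner m N).det = 1 := fun N => by
    have := corner_congr hl.isLT m N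
    rw [h] at this
    have h1 : corner (1 : IMat) N = 1 := by
      ext i j
      simp [corner, Matrix.one_apply, Fin.ext_iff]
    rw [h1] at this
    apply_fun Matrix.det at this
    rw [Matrix.det_mul, Matrix.det_mul, Matrix.det_transpose, Matrix.det_one, hl.isLT.det_corner]
      at this
    rw [Finset.prod_range, this]
    ring
  have h1 := key n
  have h2 := key (n + 1)
  rw [Finset.prod_range_succ] at h2
  have hn1 : (corner m (n + 1)).det ≠ 0 := fun h0 => by simp [h0] at h2
  have hp : (∏ i ∈ Finset.range n, S i i) ^ 2 ≠ 0 := fun h0 => by simp [h0] at h1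
  rw [eq_div_iff hn1]
  apply mul_left_cancel₀ hp
  linear_combination h2 - h1

/-- The Toda lattice: a curve of moment matrices that moves by `Λᵏ` has a dressing matrix moving by
`-(Lᵏ)₋ - ½ (Lᵏ)₀`, which differs from `½ (Lᵏ)_{sk}` by `-½ Lᵏ`, and this commutes with `L`. -/
theorem exists_toda_curve {m : ℂ → IMat} {A : Set ℂ} {S : IMat} (hS : IsBorel S (m 0))
    (hm : ∀ s, (m s).transpose = m s) (k : ℕ)
    (hd : HasEntryDeriv m (ipow shift k ⬝∞ m 0) A)
    (hcomm : (ipow shift k ⬝∞ m 0).transpose = ipow shift k ⬝∞ m 0)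
    (hA : UniqueDiffWithinAt ℂ A 0) :
    ∃ Sc : ℂ → IMat, Sc 0 = S ∧ (∀ s, IsLower (Sc s)) ∧
      (∀ i j, ∀ᶠ s in 𝓝[A] 0, form (m s) (rowPoly (Sc s) i) (rowPoly (Sc s) j) = (1 : IMat) i j) ∧
      HasEntryDeriv (fun s => Lmat (Sc s))
        ((1 / 2 : ℂ) • icomm (skewPart (ipow (Lmat S) k)) (Lmat S)) A := by
  obtain ⟨hl, h1⟩ := isBorel_iff.1 hS
  set N : ℂ → IMat := fun s => S ⬝∞ m s ⬝∞ S.transpose with hNdef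
  have hN0 : N 0 = BlockForm.one.eta := by rw [BlockForm.eta_one]; exact h1
  have hsym : ∀ s i j, N s j i = BlockForm.one.sym * N s i j := fun s i j => by
    change (N s).transpose i j = 1 * _
    rw [one_mul, transpose_congr S hl.rowFin, hm]
  have hN' := hd.congr_const hl.rowFin
  have hP : S ⬝∞ (ipow shift k ⬝∞ m 0) ⬝∞ S.transpose = ipow (Lmat S) k := by
    rw [congr_shift hl h1, imul_one]
  have hPs : (ipow (Lmat S) k).transpose = ipow (Lmat S) k := by
    rw [← hP, transpose_congr S hl.rowFin, hcomm]
  rw [hP] at hN'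
  have hNd : ∀ i j, DifferentiableWithinAt ℂ (fun s => N s i j) A 0 := fun i j =>
    (hN' i j).differentiableWithinAt
  obtain ⟨D', hD', hz, -, hrel⟩ :=
    BlockForm.exists_hasEntryDeriv_gs hNd hN0 hN' hsym hA
  have hDl : ∀ s, IsLower (BlockForm.one.gs (N s)) := fun s => BlockForm.one.isLower_gs _
  have hD0 : BlockForm.one.gs (N 0) = 1 := by rw [hN0, BlockForm.gs_eta]
  have hlt' : IsLT D' := fun i j hij => hz i j hij.le hij.ne'
  refine ⟨fun s => BlockForm.one.gs (N s) ⬝∞ S, by beta_reduce; rw [hD0, one_imul],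
    fun s => (hDl s).imul hl, fun i j => ?_, ?_⟩
  · filter_upwards [BlockForm.eventually_form_gsD hNd hN0 hsym i j] with s hs
    rw [rowPoly_eq_rowp ((hDl s).imul hl).isLT, rowPoly_eq_rowp ((hDl s).imul hl).isLT,
      ← congr_apply ((hDl s).imul hl).rowFin ((hDl s).imul hl).rowFin,
      congr_imul (hDl s).rowFin hl.rowFin, congr_apply (hDl s).rowFin (hDl s).rowFin,
      BlockForm.rowp_gs, BlockForm.rowp_gs, ← BlockForm.eta_one]
    exact hs
  · have hL := hl.rowFin_Lmat
    have hconj := hD'.conj hDl hlt' hD0 hL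
    have hskew : skewPart (ipow (Lmat S) k) = (2 : ℂ) • D' + ipow (Lmat S) k := by
      ext i j
      have hPij : ∀ i j, ipow (Lmat S) k j i = ipow (Lmat S) k i j := fun i j =>
        congrFun (congrFun hPs i) j
      have hr := hrel i j
      change D' i j * 1 + ipow (Lmat S) k i j + 1 * D' j i = 0 at hr
      simp only [skewPart, Matrix.add_apply, Matrix.smul_apply, smul_eq_mul]
      split_ifs with h h'
      · rw [hlt' i j h]; ring
      · rw [hlt' j i h'] at hr
        rw [hPij i j]
        linear_combination (-2) * hr
      · obtain rfl : i = j := by omega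
        linear_combination -hr
    have hD'r := hlt'.rowFin
    have e : (1 / 2 : ℂ) • icomm (skewPart (ipow (Lmat S) k)) (Lmat S) = icomm D' (Lmat S) := by
      rw [hskew, icomm, icomm, add_imul (hD'r.smul 2) (hL.ipow k), imul_add hL, smul_imul,
        imul_smul, ipow_comm hL]
      ext i j
      simp only [Matrix.smul_apply, Matrix.add_apply, Matrix.sub_apply, smul_eq_mul]
      ring
    rw [e]
    simp only [fun s => Lmat_imul (hDl s) hl]
    exact hconj

/-! The skew-symmetric case. -/

lemma isLT_skew_of {D : IMat} (hz : ∀ i j, BlockForm.skew.base i ≤ j → j ≠ i → D i j = 0) :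
    IsLT D := fun i j hij => hz i j ((BlockForm.skew.base_le i).trans hij.le) hij.ne'

lemma InGk.imul {P Q : IMat} (hP : InGk P) (hQ : InGk Q) : InGk (P ⬝∞ Q) := by
  refine ⟨hP.1.imul hQ.1, fun n => ⟨?_, ?_⟩⟩
  · rw [hP.1.isLT.imul_apply, Finset.sum_range_succ, Finset.sum_range_succ, (hP.2 n).1,
      (hQ.2 n).1, Finset.sum_eq_zero, mul_zero, zero_mul, add_zero, add_zero]
    intro k hk
    rw [hQ.1.1 k _ (by simpa using hk), mul_zero]
  · rw [hP.1.isLT.imul_diag hQ.1.isLT, hP.1.isLT.imul_diag hQ.1.isLT, (hP.2 n).2, (hQ.2 n).2]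

lemma inGk_gs (N : IMat) : InGk (BlockForm.skew.gs N) := by
  refine ⟨BlockForm.skew.isLower_gs N, fun n => ⟨BlockForm.skew.gs_of_base_le N ?_ (by omega), ?_⟩⟩
  · change 2 * ((2 * n + 1) / 2) ≤ 2 * n
    omega
  · rw [BlockForm.gs_diag, BlockForm.gs_diag, ← BlockForm.pivot_base,
      ← BlockForm.pivot_base _ _ (2 * n)]
    congr 2
    change 2 * ((2 * n + 1) / 2) = 2 * (2 * n / 2)
    omega

/-- A skew-symmetric matrix with nonvanishing Pfaffians has a skew-Borel factorization. -/
theorem exists_inGk_congr {m : IMat} (hm : m.transpose = -m) (hpf : ∀ n, pf m n ≠ 0) :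
    ∃ Q, InGk Q ∧ Q ⬝∞ m ⬝∞ Q.transpose = Jmat := by
  have hsym : ∀ i j, m j i = BlockForm.skew.sym * m i j := fun i j => by
    change m.transpose i j = -1 * _
    rw [hm, Matrix.neg_apply, neg_one_mul]
  have hl := BlockForm.skew.isLower_gs m
  refine ⟨BlockForm.skew.gs m, inGk_gs m, ?_⟩
  rw [BlockForm.gs_congr hsym, BlockForm.eta_skew]
  intro n h
  have hz : pf (BlockForm.skew.gs m ⬝∞ m ⬝∞ (BlockForm.skew.gs m).transpose) (n / 2 + 1) = 0 := by
    refine pf_eq_zero_of_row (r := n) (by omega) (fun j hj => ?_) fun i j => ?_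
    · rw [congr_apply hl.rowFin hl.rowFin, BlockForm.rowp_gs, BlockForm.rowp_gs]
      refine h j ?_
      change 2 * (j / 2) ≤ 2 * (n / 2)
      omega
    · change (BlockForm.skew.gs m ⬝∞ m ⬝∞ (BlockForm.skew.gs m).transpose).transpose i j = _
      rw [transpose_congr _ hl.rowFin, hm, imul_neg, neg_imul, Matrix.neg_apply]
  rw [pf_congr hl.isLT, mul_eq_zero] at hz
  rcases hz with hz | hz
  · exact Finset.prod_ne_zero_iff.2 (fun i _ => hl.2 i) hz
  · exact hpf _ hz

lemma InGk.diag_sq {Q m : IMat} (hQ : InGk Q) (h : Q ⬝∞ m ⬝∞ Q.transpose = Jmat) (n : ℕ) :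
    Q (2 * n) (2 * n) ^ 2 = pf m n / pf m (n + 1) := by
  have key : ∀ N, (∏ i ∈ Finset.range (2 * N), Q i i) * pf m N = 1 := fun N => by
    rw [← pf_congr hQ.1.isLT, h, pf_Jmat]
  have h1 := key n
  have h2 := key (n + 1)
  rw [show 2 * (n + 1) = 2 * n + 1 + 1 by ring, Finset.prod_range_succ, Finset.prod_range_succ,
    (hQ.2 n).2] at h2
  have hn1 : pf m (n + 1) ≠ 0 := fun h0 => by simp [h0] at h2
  have hp : (∏ i ∈ Finset.range (2 * n), Q i i) ≠ 0 := fun h0 => by simp [h0] at h1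
  rw [eq_div_iff hn1]
  apply mul_left_cancel₀ hp
  linear_combination h2 - h1

lemma Jinv_apply (A : IMat) (i j : ℕ) : Jinv A i j =
    -(BlockForm.skew.sg i * BlockForm.skew.sg j *
      A (BlockForm.skew.par j) (BlockForm.skew.par i)) := by
  rw [Jinv, imul_Jmat, Jmat_imul, Matrix.transpose_apply, BlockForm.skew.sg_par]
  change _ * (-1 * _) = _
  ring

lemma skew_par_div (i : ℕ) : BlockForm.skew.par i / 2 = i / 2 := by
  have : 2 * (BlockForm.skew.par i / 2) = 2 * (i / 2) := BlockForm.skew.base_par i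
  omega

/-- The velocity of a curve in the group `𝒢_k` through the identity is determined by the velocity
`P J + J Pᵀ` of the forms: it is `-π_k P`. -/
lemma eq_neg_piK {D' P : IMat} (hz : ∀ i j, BlockForm.skew.base i ≤ j → j ≠ i → D' i j = 0)
    (hb : ∀ i, D' i i = D' (BlockForm.skew.base i) (BlockForm.skew.base i))
    (hrel : ∀ i j, D' i (BlockForm.skew.par j) * BlockForm.skew.sg (BlockForm.skew.par j) +
      (P ⬝∞ Jmat + Jmat ⬝∞ P.transpose) i j +
        BlockForm.skew.sg i * D' j (BlockForm.skew.par i) = 0) :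
    D' = -piK P := by
  ext i j
  have hr := hrel i (BlockForm.skew.par j)
  rw [Matrix.add_apply, imul_Jmat, Jmat_imul, Matrix.transpose_apply, BlockForm.skew.par_par] at hr
  have hsi := BlockForm.skew.sg_mul i
  have hsj := BlockForm.skew.sg_mul j
  have hbase : ∀ a, BlockForm.skew.base a = 2 * (a / 2) := fun a => rfl
  simp only [piK, Matrix.neg_apply, Matrix.add_apply, Matrix.sub_apply, Matrix.smul_apply,
    smul_eq_mul, Jinv_apply, blockUp, blockLow, blockDiag, skew_par_div]
  rcases lt_trichotomy (i / 2) (j / 2) with h | h | h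
  · rw [if_neg (by omega), if_neg (by omega), if_neg (by omega), if_neg (by omega),
      hz i j (by rw [hbase]; omega) (by rintro rfl; omega)]
    ring
  · rw [if_neg (by omega), if_neg (by omega), if_pos h, if_pos h.symm]
    by_cases hij : i = j
    · subst hij
      have : D' (BlockForm.skew.par i) (BlockForm.skew.par i) = D' i i := by
        rw [hb, BlockForm.skew.base_par, ← hb]
      rw [this] at hr
      linear_combination (1 / 2 * BlockForm.skew.sg i) * hr -
        (D' i i + 1 / 2 * P i i) * hsi
    · have hp : j = BlockForm.skew.par i := by
        simp only [BlockForm.skew]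
        split_ifs <;> omega
      rw [hz i j (by rw [hbase]; omega) (Ne.symm hij)]
      have hs : BlockForm.skew.sg j = -1 * BlockForm.skew.sg i := by
        rw [hp]; exact BlockForm.skew.sg_par i
      have hp' : BlockForm.skew.par j = i := by rw [hp, BlockForm.skew.par_par]
      rw [hp', ← hp, hs]
      linear_combination (-(1 / 2) * P i j) * hsi
  · rw [if_pos (by omega), if_pos (by omega), if_neg (by omega), if_neg (by omega)]
    have : D' (BlockForm.skew.par j) (BlockForm.skew.par i) = 0 := by
      have h1 := skew_par_div i
      have h2 := skew_par_div j
      refine hz _ _ (by rw [hbase]; omega) fun he => ?_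
      rw [he] at h1
      omega
    rw [this] at hr
    linear_combination BlockForm.skew.sg j * hr - (D' i j + P i j) * hsj

/-- The Pfaff lattice: a curve of skew moment matrices that moves by `Λᵏ m + m Λᵏᵀ` is dressed by a
curve in `𝒢_k` with velocity `-π_k L̃ᵏ`. -/
theorem exists_pfaff_curve {m : ℂ → IMat} {A : Set ℂ} {Q : IMat} (hQ : InGk Q)
    (h1 : Q ⬝∞ m 0 ⬝∞ Q.transpose = Jmat)
    (hm : ∀ s, (m s).transpose = -m s) (k : ℕ)
    (hd : HasEntryDeriv m (ipow shift k ⬝∞ m 0 + m 0 ⬝∞ (ipow shift k).transpose) A)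
    (hA : UniqueDiffWithinAt ℂ A 0) :
    ∃ Qc : ℂ → IMat, Qc 0 = Q ∧ (∀ s, InGk (Qc s)) ∧
      (∀ i j, ∀ᶠ s in 𝓝[A] 0, form (m s) (rowp (Qc s) i) (rowp (Qc s) j) = Jmat i j) ∧
      HasEntryDeriv (fun s => Lmat (Qc s)) (icomm (-piK (ipow (Lmat Q) k)) (Lmat Q)) A := by
  have hl := hQ.1
  set N : ℂ → IMat := fun s => Q ⬝∞ m s ⬝∞ Q.transpose with hNdef
  have hN0 : N 0 = BlockForm.skew.eta := by rw [BlockForm.eta_skew]; exact h1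
  have hsym : ∀ s i j, N s j i = BlockForm.skew.sym * N s i j := fun s i j => by
    change (N s).transpose i j = -1 * _
    rw [transpose_congr Q hl.rowFin, hm, imul_neg, neg_imul, Matrix.neg_apply, neg_one_mul]
  have hN' := hd.congr_const hl.rowFin
  have hP : Q ⬝∞ (ipow shift k ⬝∞ m 0 + m 0 ⬝∞ (ipow shift k).transpose) ⬝∞ Q.transpose =
      ipow (Lmat Q) k ⬝∞ Jmat + Jmat ⬝∞ (ipow (Lmat Q) k).transpose := by
    have h2 : m 0 ⬝∞ (ipow shift k).transpose = -(ipow shift k ⬝∞ m 0).transpose := by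
      rw [imul_transpose, hm, neg_imul, neg_neg]
    rw [imul_add hl.rowFin, add_imul' _ _ hl.rowFin.transpose_transpose, congr_shift hl h1, h2,
      imul_neg, neg_imul, ← transpose_congr Q hl.rowFin, congr_shift hl h1, imul_transpose,
      Jmat_transpose, neg_imul, neg_neg]
  rw [hP] at hN'
  have hNd : ∀ i j, DifferentiableWithinAt ℂ (fun s => N s i j) A 0 := fun i j =>
    (hN' i j).differentiableWithinAt
  obtain ⟨D', hD', hz, hb, hrel⟩ :=
    BlockForm.exists_hasEntryDeriv_gs hNd hN0 hN' hsym hA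
  have hG : ∀ s, InGk (BlockForm.skew.gs (N s)) := fun s => inGk_gs _
  have hDl : ∀ s, IsLower (BlockForm.skew.gs (N s)) := fun s => (hG s).1
  have hD0 : BlockForm.skew.gs (N 0) = 1 := by rw [hN0, BlockForm.gs_eta]
  refine ⟨fun s => BlockForm.skew.gs (N s) ⬝∞ Q, by beta_reduce; rw [hD0, one_imul],
    fun s => (hG s).imul hQ, fun i j => ?_, ?_⟩
  · filter_upwards [BlockForm.eventually_form_gsD hNd hN0 hsym i j] with s hs
    rw [← congr_apply ((hDl s).imul hl).rowFin ((hDl s).imul hl).rowFin,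
      congr_imul (hDl s).rowFin hl.rowFin, congr_apply (hDl s).rowFin (hDl s).rowFin,
      BlockForm.rowp_gs, BlockForm.rowp_gs, ← BlockForm.eta_skew]
    exact hs
  · rw [← eq_neg_piK hz hb hrel]
    simp only [fun s => Lmat_imul (hDl s) hl]
    exact hD'.conj hDl (isLT_skew_of hz) hD0 hl.rowFin_Lmat

end TodaPfaff
end

/-! ### Moments and their time derivatives -/

noncomputable section

namespace TodaPfaff

lemma norm_exp_sub_one_le_max (z : ℂ) : ‖Complex.exp z - 1‖ ≤ ‖z‖ * max 1 (Real.exp z.re) := by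
  have hd : ∀ u ∈ Set.Icc (0 : ℝ) 1, HasDerivWithinAt (fun u : ℝ => Complex.exp (u * z))
      (Complex.exp (u * z) * z) (Set.Icc 0 1) u := fun u _ => by
    have h := (Complex.hasDerivAt_exp ((u : ℂ) * z)).scomp_of_eq u
      ((Complex.ofRealCLM.hasDerivAt (x := u)).mul_const z) rfl
    simpa [mul_comm, Function.comp_def] using h.hasDerivWithinAt
  have h := norm_image_sub_le_of_norm_deriv_le_segment_01' hd
    (C := ‖z‖ * max 1 (Real.exp z.re)) fun u hu => by
      rw [norm_mul, mul_comm, Complex.norm_exp]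
      refine mul_le_mul_of_nonneg_left ?_ (norm_nonneg _)
      have hre : ((u : ℂ) * z).re = u * z.re := by simp
      rw [hre]
      rcases le_total 0 z.re with h | h
      · exact le_max_of_le_right (Real.exp_le_exp.2 (by nlinarith [hu.1, hu.2.le]))
      · exact le_max_of_le_left (Real.exp_le_one_iff.2 (mul_nonpos_of_nonneg_of_nonpos hu.1 h))
  simpa using h

/-- Differentiation of `∫ G e^{s h}` at `s = 0` within any set of times for which the integrals
converge; this set need not be a neighbourhood of `0`. -/
lemma hasDerivWithinAt_integral_mul_exp {α : Type*} [MeasurableSpace α] {μ : Measure α}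
    {G : α → ℂ} {h : α → ℝ} {A : Set ℂ} (h0 : (0 : ℂ) ∈ A)
    (h1 : ∀ s ∈ A, Integrable (fun w => G w * Complex.exp (s * h w)) μ)
    (h2 : ∀ s ∈ A, Integrable (fun w => h w * (G w * Complex.exp (s * h w))) μ) :
    HasDerivWithinAt (fun s => ∫ w, G w * Complex.exp (s * h w) ∂μ) (∫ w, h w * G w ∂μ) A 0 := by
  rw [hasDerivWithinAt_iff_tendsto_slope]
  -- The exponentials at `s` are dominated by those at two points of `A` with `b.re ≤ s.re ≤ a.re`;
  -- on a side where `A` does not extend beyond `0`, the point `0` itself serves.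
  obtain ⟨a, ha, haA⟩ : ∃ a : ℂ, a ∈ A ∧ ∀ᶠ s in 𝓝[A] 0, s.re ≤ a.re := by
    by_cases hex : ∃ a ∈ A, 0 < a.re
    · obtain ⟨a, ha, hpos⟩ := hex
      refine ⟨a, ha, ?_⟩
      have : ∀ᶠ s : ℂ in 𝓝 0, s.re < a.re :=
        Complex.continuous_re.continuousAt.eventually_lt continuousAt_const (by simpa using hpos)
      exact (this.filter_mono nhdsWithin_le_nhds).mono fun s hs => hs.le
    · push Not at hex
      exact ⟨0, h0, eventually_mem_nhdsWithin.mono fun s hs => by simpa using hex s hs⟩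
  obtain ⟨b, hb, hbA⟩ : ∃ b : ℂ, b ∈ A ∧ ∀ᶠ s in 𝓝[A] 0, b.re ≤ s.re := by
    by_cases hex : ∃ b ∈ A, b.re < 0
    · obtain ⟨b, hb, hneg⟩ := hex
      refine ⟨b, hb, ?_⟩
      have : ∀ᶠ s : ℂ in 𝓝 0, b.re < s.re :=
        continuousAt_const.eventually_lt Complex.continuous_re.continuousAt (by simpa using hneg)
      exact (this.filter_mono nhdsWithin_le_nhds).mono fun s hs => hs.le
    · push Not at hex
      exact ⟨0, h0, eventually_mem_nhdsWithin.mono fun s hs => by simpa using hex s hs⟩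
  have hle : 𝓝[A \ {0}] (0 : ℂ) ≤ 𝓝[A] 0 := nhdsWithin_mono _ Set.sdiff_subset
  have hG : Integrable G μ := by simpa using h1 0 h0
  have hhG : Integrable (fun w => h w * G w) μ := by simpa using h2 0 h0
  have hslope : ∀ᶠ s in 𝓝[A \ {0}] (0 : ℂ),
      ∫ w, s⁻¹ * (G w * Complex.exp (s * h w) - G w) ∂μ =
        slope (fun s => ∫ w, G w * Complex.exp (s * h w) ∂μ) 0 s := by
    filter_upwards [eventually_mem_nhdsWithin] with s hs
    rw [integral_const_mul, integral_sub (h1 s hs.1) hG, slope]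
    simp
  refine Tendsto.congr' hslope ?_
  refine tendsto_integral_filter_of_dominated_convergence
    (fun w => ‖(h w : ℂ) * G w‖ + ‖h w * (G w * Complex.exp (a * h w))‖ +
      ‖h w * (G w * Complex.exp (b * h w))‖) ?_ ?_
    ((hhG.norm.add (h2 a ha).norm).add (h2 b hb).norm) ?_
  · filter_upwards [eventually_mem_nhdsWithin] with s hs
    exact (((h1 s hs.1).sub hG).const_mul _).aestronglyMeasurable
  · filter_upwards [eventually_mem_nhdsWithin, haA.filter_mono hle, hbA.filter_mono hle]
      with s hs hsa hsb
    refine Eventually.of_forall fun w => ?_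
    have hs0 : s ≠ 0 := fun h => hs.2 (by simp [h])
    have e1 : s⁻¹ * (G w * Complex.exp (s * h w) - G w) =
        G w * (s⁻¹ * (Complex.exp (s * h w) - 1)) := by ring
    have hn : ‖s⁻¹ * (Complex.exp (s * h w) - 1)‖ ≤ |h w| * max 1 (Real.exp (s.re * h w)) := by
      rw [norm_mul, norm_inv]
      have := norm_exp_sub_one_le_max (s * h w)
      rw [norm_mul, Complex.norm_real, Real.norm_eq_abs,
        show (s * (h w : ℂ)).re = s.re * h w by simp]
        at this
      rw [inv_mul_le_iff₀ (norm_pos_iff.2 hs0), ← mul_assoc]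
      exact this
    have hm : max 1 (Real.exp (s.re * h w)) ≤
        1 + Real.exp (a.re * h w) + Real.exp (b.re * h w) := by
      have p1 := Real.exp_pos (a.re * h w)
      have p2 := Real.exp_pos (b.re * h w)
      refine max_le (by linarith) ?_
      rcases le_total 0 (h w) with hw | hw
      · have := Real.exp_le_exp.2 (mul_le_mul_of_nonneg_right hsa hw)
        linarith
      · have := Real.exp_le_exp.2 (mul_le_mul_of_nonpos_right hsb hw)
        linarith
    have hre : ∀ c : ℂ, ‖Complex.exp (c * h w)‖ = Real.exp (c.re * h w) := fun c => by
      rw [Complex.norm_exp]; simp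
    rw [e1, norm_mul]
    simp only [norm_mul, hre, Complex.norm_real, Real.norm_eq_abs]
    calc ‖G w‖ * (‖s⁻¹‖ * ‖Complex.exp (s * h w) - 1‖)
        ≤ ‖G w‖ * (|h w| * (1 + Real.exp (a.re * h w) + Real.exp (b.re * h w))) := by
          rw [← norm_mul]
          exact mul_le_mul_of_nonneg_left
            (hn.trans (mul_le_mul_of_nonneg_left hm (abs_nonneg _))) (norm_nonneg _)
      _ = _ := by ring
  · refine Eventually.of_forall fun w => ?_
    have hd : HasDerivAt (fun s : ℂ => G w * Complex.exp (s * h w)) (h w * G w) 0 := by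
      have := (((hasDerivAt_id (0 : ℂ)).mul_const (h w : ℂ)).cexp).const_mul (G w)
      simpa [mul_comm] using this
    have := (hasDerivAt_iff_tendsto_slope.1 hd).mono_left
      (nhdsWithin_mono (0 : ℂ) (fun s (hs : s ∈ A \ {0}) => hs.2))
    refine this.congr fun s => ?_
    simp [slope]

lemma uniqueDiffWithinAt_of_imaginary {A : Set ℂ} (h : ∀ y : ℝ, (y : ℂ) * Complex.I ∈ A) :
    UniqueDiffWithinAt ℂ A 0 := by
  rw [uniqueDiffWithinAt_iff_accPt, accPt_iff_nhds]
  intro U hU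
  obtain ⟨ε, hε, hb⟩ := Metric.mem_nhds_iff.1 hU
  refine ⟨((ε / 2 : ℝ) : ℂ) * Complex.I, ⟨hb ?_, h _⟩, ?_⟩
  · rw [mem_ball_zero_iff, norm_mul, Complex.norm_I, mul_one, Complex.norm_real,
      Real.norm_of_nonneg (by positivity)]
    linarith
  · simp [hε.ne']

lemma xi_add (t u : Times) : xi (t + u) = xi t + xi u :=
  Finsupp.sum_add_index' (fun k => by simp) fun k a b => by simp

lemma xi_move (t : Times) (k : ℕ+) (s : ℂ) : xi (move t k s) = xi t + monomial (k : ℕ) s := by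
  rw [move, xi_add]
  congr 1
  exact Finsupp.sum_single_index (by simp)

lemma xi_smul (c : ℂ) (t : Times) : xi (c • t) = c • xi t := by
  rw [xi, Finsupp.sum_smul_index' (fun k => by simp), xi, Finsupp.smul_sum]
  simp only [smul_monomial]

lemma move_zero (t : Times) (k : ℕ+) : move t k 0 = t := by simp [move]

lemma two_smul_move (t : Times) (k : ℕ+) (s : ℂ) :
    (2 : ℂ) • move t k s = move ((2 : ℂ) • t) k (2 * s) := by
  simp [move, Finsupp.smul_single]

lemma fn_add (φ ψ : ℂ[X]) (z : ℝ) : fn (φ + ψ) z = fn φ z + fn ψ z := eval_add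

lemma fn_smul (c : ℂ) (φ : ℂ[X]) (z : ℝ) : fn (c • φ) z = c * fn φ z := by
  simp [fn]

lemma fn_mul (φ ψ : ℂ[X]) (z : ℝ) : fn (φ * ψ) z = fn φ z * fn ψ z := eval_mul

lemma fn_X_pow (n : ℕ) (z : ℝ) : fn (X ^ n) z = (z : ℂ) ^ n := by simp [fn]

lemma continuous_fn (φ : ℂ[X]) : Continuous (fn φ) := φ.continuous.comp Complex.continuous_ofReal

namespace Weight

variable (W : Weight)

lemma continuousOn_V : ContinuousOn W.V W.E := fun z hz =>
  (W.hasDerivAt_V z hz).continuousAt.continuousWithinAt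

lemma continuousOn_tV : ContinuousOn W.tV W.E := by
  refine ContinuousOn.div_const (W.continuousOn_V.add (ContinuousOn.log ?_ fun z hz =>
    (W.f_pos z hz).ne')) 2
  exact W.f.continuous.continuousOn

lemma rho_move (t : Times) (k : ℕ+) (s : ℂ) (z : ℝ) :
    W.rho (move t k s) z = W.rho t z * Complex.exp (s * ((z ^ (k : ℕ) : ℝ) : ℂ)) := by
  simp only [rho, Set.indicator]
  split_ifs
  · rw [← Complex.exp_add, xi_move, eval_add, eval_monomial, Complex.ofReal_pow, add_assoc]
  · rw [zero_mul]

lemma trho_move (t : Times) (k : ℕ+) (s : ℂ) (z : ℝ) :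
    W.trho (move t k s) z = W.trho t z * Complex.exp (s * ((z ^ (k : ℕ) : ℝ) : ℂ)) := by
  simp only [trho, Set.indicator]
  split_ifs
  · rw [← Complex.exp_add, xi_move, eval_add, eval_monomial, Complex.ofReal_pow, add_assoc]
  · rw [zero_mul]

lemma trho_sq (t : Times) {z : ℝ} (hz : z ∈ W.E) :
    W.trho t z ^ 2 = W.rho ((2 : ℂ) • t) z / ((W.f.eval z : ℝ) : ℂ) := by
  rw [trho, rho, Set.indicator_of_mem hz, Set.indicator_of_mem hz, ← Complex.exp_nat_mul, xi_smul]
  have hf : ((W.f.eval z : ℝ) : ℂ) = Complex.exp ((Real.log (W.f.eval z) : ℝ) : ℂ) := by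
    rw [← Complex.ofReal_exp, Real.exp_log (W.f_pos z hz)]
  rw [hf, ← Complex.exp_sub]
  congr 1
  simp only [tV, eval_smul, smul_eq_mul]
  push_cast
  ring

variable {W}

lemma MomFinite.integrable {t : Times} (h : W.MomFinite t) (φ : ℂ[X]) :
    Integrable fun z => fn φ z * W.rho t z := by
  have : (fun z => fn φ z * W.rho t z) =
      fun z : ℝ => ∑ i ∈ φ.support, φ.coeff i * ((z : ℂ) ^ i * W.rho t z) := by
    funext z
    simp only [fn, eval_eq_sum, Polynomial.sum, Finset.sum_mul, mul_assoc]
  rw [this]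
  exact integrable_finsetSum _ fun i _ => (h i).const_mul _

lemma TMomFinite.integrable {t : Times} (h : W.TMomFinite t) (φ : ℂ[X]) :
    Integrable fun z => fn φ z * W.trho t z := by
  have : (fun z => fn φ z * W.trho t z) =
      fun z : ℝ => ∑ i ∈ φ.support, φ.coeff i * ((z : ℂ) ^ i * W.trho t z) := by
    funext z
    simp only [fn, eval_eq_sum, Polynomial.sum, Finset.sum_mul, mul_assoc]
  rw [this]
  exact integrable_finsetSum _ fun i _ => (h i).const_mul _

lemma MomFinite.integrable_mul {t : Times} (h : W.MomFinite t) (φ ψ : ℂ[X]) :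
    Integrable fun z => fn φ z * fn ψ z * W.rho t z := by
  simpa only [fn_mul] using h.integrable (φ * ψ)

/-- An additive functional on polynomials in two variables is determined on monomials. -/
lemma form_unique {F : ℂ[X] → ℂ[X] → ℂ} (hl : ∀ φ φ' ψ, F (φ + φ') ψ = F φ ψ + F φ' ψ)
    (hr : ∀ φ ψ ψ', F φ (ψ + ψ') = F φ ψ + F φ ψ')
    (hsl : ∀ (c : ℂ) φ ψ, F (c • φ) ψ = c * F φ ψ) (hsr : ∀ (c : ℂ) φ ψ, F φ (c • ψ) = c * F φ ψ)
    {N : IMat} (hN : ∀ i j, N i j = F (X ^ i) (X ^ j)) (φ ψ : ℂ[X]) : F φ ψ = form N φ ψ := by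
  have hmon : ∀ (a : ℕ) (x : ℂ), (monomial a x : ℂ[X]) = x • X ^ a := fun a x => by
    rw [smul_eq_C_mul, C_mul_X_pow_eq_monomial]
  induction φ using Polynomial.induction_on' with
  | add p q hp hq => rw [hl, hp, hq, map_add, LinearMap.add_apply]
  | monomial a x =>
    induction ψ using Polynomial.induction_on' with
    | add p q hp hq => rw [hr, hp, hq, map_add]
    | monomial b y =>
      rw [hmon a, hmon b, hsl, hsr, map_smul, map_smul, LinearMap.smul_apply, form_X_pow, hN,
        smul_eq_mul, smul_eq_mul]
      ring

lemma innerSy_eq_form {t : Times} (h : W.MomFinite t) (φ ψ : ℂ[X]) :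
    W.innerSy t (fn φ) (fn ψ) = form (W.mom t) φ ψ := by
  refine form_unique (F := fun φ ψ => W.innerSy t (fn φ) (fn ψ)) ?_ ?_ ?_ ?_ (fun _ _ => rfl) φ ψ
  · intro φ φ' ψ
    simp only [innerSy]
    rw [← integral_add (h.integrable_mul _ _) (h.integrable_mul _ _)]
    refine integral_congr_ae (Eventually.of_forall fun z => ?_)
    simp only [fn_add]; ring
  · intro φ ψ ψ'
    simp only [innerSy]
    rw [← integral_add (h.integrable_mul _ _) (h.integrable_mul _ _)]
    refine integral_congr_ae (Eventually.of_forall fun z => ?_)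
    simp only [fn_add]; ring
  · intro c φ ψ
    simp only [innerSy]
    rw [← integral_const_mul]
    refine integral_congr_ae (Eventually.of_forall fun z => ?_)
    simp only [fn_smul]; ring
  · intro c φ ψ
    simp only [innerSy]
    rw [← integral_const_mul]
    refine integral_congr_ae (Eventually.of_forall fun z => ?_)
    simp only [fn_smul]; ring

lemma measurable_eps : Measurable fun w : ℝ × ℝ => eps (w.1 - w.2) :=
  Measurable.ite (measurableSet_le measurable_const (measurable_fst.sub measurable_snd))
    measurable_const measurable_const

lemma norm_eps (x : ℝ) : ‖eps x‖ = 1 := by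
  unfold eps; split_ifs <;> simp

lemma TMomFinite.integrable_skIntegrand {t : Times} (h : W.TMomFinite t) (φ ψ : ℂ[X]) :
    Integrable (W.skIntegrand t (fn φ) (fn ψ)) := by
  have h1 := (h.integrable φ).mul_prod (h.integrable ψ)
  have h2 := h1.bdd_mul (c := 1) measurable_eps.aestronglyMeasurable
    (Eventually.of_forall fun w => (norm_eps _).le)
  refine h2.congr (Eventually.of_forall fun w => ?_)
  simp only [skIntegrand]
  ring

lemma innerSk_eq_form {t : Times} (h : W.TMomFinite t) (φ ψ : ℂ[X]) :
    W.innerSk t (fn φ) (fn ψ) = form (W.tmom t) φ ψ := by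
  refine form_unique (F := fun φ ψ => W.innerSk t (fn φ) (fn ψ)) ?_ ?_ ?_ ?_ (fun _ _ => rfl) φ ψ
  · intro φ φ' ψ
    simp only [innerSk]
    rw [← mul_add, ← integral_add (h.integrable_skIntegrand _ _) (h.integrable_skIntegrand _ _)]
    congr 1
    refine integral_congr_ae (Eventually.of_forall fun z => ?_)
    simp only [skIntegrand, fn_add]; ring
  · intro φ ψ ψ'
    simp only [innerSk]
    rw [← mul_add, ← integral_add (h.integrable_skIntegrand _ _) (h.integrable_skIntegrand _ _)]
    congr 1
    refine integral_congr_ae (Eventually.of_forall fun z => ?_)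
    simp only [skIntegrand, fn_add]; ring
  · intro c φ ψ
    simp only [innerSk]
    rw [mul_left_comm, ← integral_const_mul c]
    congr 1
    refine integral_congr_ae (Eventually.of_forall fun z => ?_)
    simp only [skIntegrand, fn_smul]; ring
  · intro c φ ψ
    simp only [innerSk]
    rw [mul_left_comm, ← integral_const_mul c]
    congr 1
    refine integral_congr_ae (Eventually.of_forall fun z => ?_)
    simp only [skIntegrand, fn_smul]; ring

variable (W)

lemma mom_transpose (t : Times) : (W.mom t).transpose = W.mom t := by
  ext i j
  simp only [Matrix.transpose_apply, mom, innerSy]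
  refine integral_congr_ae (Eventually.of_forall fun z => ?_)
  simp only [mul_comm (fn (X ^ j) z)]

lemma mom_apply (t : Times) (i j : ℕ) :
    W.mom t i j = ∫ z : ℝ, (z : ℂ) ^ (i + j) * W.rho t z := by
  simp only [mom, innerSy, fn_X_pow, ← pow_add]

lemma shift_mom (t : Times) (k : ℕ) :
    ipow shift k ⬝∞ W.mom t = W.mom t ⬝∞ (ipow shift k).transpose := by
  ext i j
  rw [ipow_shift_imul, imul_ipow_shift_transpose, mom_apply, mom_apply]
  congr! 4
  omega

lemma shift_mom_transpose (t : Times) (k : ℕ) :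
    (ipow shift k ⬝∞ W.mom t).transpose = ipow shift k ⬝∞ W.mom t := by
  rw [imul_transpose, mom_transpose, shift_mom]

lemma ae_fst_ne_snd : ∀ᵐ w : ℝ × ℝ, w.1 ≠ w.2 := by
  have hm : MeasurableSet {w : ℝ × ℝ | w.1 ≠ w.2} :=
    (measurableSet_eq_fun measurable_fst measurable_snd).compl
  rw [Measure.volume_eq_prod]
  refine (Measure.ae_prod_iff_ae_ae hm).2 (Eventually.of_forall fun x => ?_)
  have : ∀ᵐ y : ℝ, y ≠ x := by simp [ae_iff]
  exact this.mono fun y hy => hy.symm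

lemma innerSk_comm (t : Times) (φ ψ : ℝ → ℂ) : W.innerSk t ψ φ = -W.innerSk t φ ψ := by
  have h : ∫ w, W.skIntegrand t ψ φ w = ∫ w : ℝ × ℝ, W.skIntegrand t ψ φ w.swap :=
    (integral_prod_swap (μ := volume) (ν := volume) (W.skIntegrand t ψ φ)).symm
  rw [innerSk, innerSk, h, ← mul_neg, ← integral_neg]
  congr 1
  refine integral_congr_ae ?_
  filter_upwards [ae_fst_ne_snd] with w hw
  have : eps (w.2 - w.1) = -eps (w.1 - w.2) := by
    unfold eps
    rcases lt_or_gt_of_ne hw with h | h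
    · rw [if_pos (by linarith), if_neg (by linarith), neg_neg]
    · rw [if_neg (by linarith), if_pos (by linarith)]
  simp only [skIntegrand, Prod.fst_swap, Prod.snd_swap, this]
  ring

lemma tmom_transpose (t : Times) : (W.tmom t).transpose = -W.tmom t := by
  ext i j
  exact W.innerSk_comm t _ _

variable {W}

lemma norm_exp_imaginary (y z : ℝ) : ‖Complex.exp ((y : ℂ) * Complex.I * (z : ℂ))‖ = 1 := by
  rw [Complex.norm_exp]; simp

lemma MomFinite.imaginary {t : Times} (h : W.MomFinite t) (k : ℕ+) (y : ℝ) :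
    W.MomFinite (move t k ((y : ℂ) * Complex.I)) := fun j => by
  have := (h j).mul_bdd (c := 1)
      (g := fun z : ℝ => Complex.exp ((y : ℂ) * Complex.I * ((z ^ (k : ℕ) : ℝ) : ℂ))) (by
    refine Continuous.aestronglyMeasurable ?_
    fun_prop) (Eventually.of_forall fun z => (norm_exp_imaginary _ _).le)
  refine this.congr (Eventually.of_forall fun z => ?_)
  simp only [rho_move]
  ring

lemma TMomFinite.imaginary {t : Times} (h : W.TMomFinite t) (k : ℕ+) (y : ℝ) :
    W.TMomFinite (move t k ((y : ℂ) * Complex.I)) := fun j => by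
  have := (h j).mul_bdd (c := 1)
      (g := fun z : ℝ => Complex.exp ((y : ℂ) * Complex.I * ((z ^ (k : ℕ) : ℝ) : ℂ))) (by
    refine Continuous.aestronglyMeasurable ?_
    fun_prop) (Eventually.of_forall fun z => (norm_exp_imaginary _ _).le)
  refine this.congr (Eventually.of_forall fun z => ?_)
  simp only [trho_move]
  ring

lemma MomFinite.hasEntryDeriv {t : Times} (h : W.MomFinite t) (k : ℕ+) :
    HasEntryDeriv (fun s => W.mom (move t k s)) (ipow shift k ⬝∞ W.mom t)
      {s | W.MomFinite (move t k s)} := fun i j => by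
  have key := hasDerivWithinAt_integral_mul_exp (μ := (volume : Measure ℝ))
    (G := fun z : ℝ => (z : ℂ) ^ (i + j) * W.rho t z) (h := fun z => z ^ (k : ℕ))
    (A := {s | W.MomFinite (move t k s)}) (by simpa [move_zero] using h)
    (fun s hs => (hs (i + j)).congr (Eventually.of_forall fun z => by
      simp only [rho_move]; ring))
    (fun s hs => (hs (k + (i + j))).congr (Eventually.of_forall fun z => by
      simp only [rho_move]; push_cast; ring))
  rw [ipow_shift_imul]
  simp only [mom_apply]
  have e1 : ∀ s, ∫ z : ℝ, (z : ℂ) ^ (i + j) * W.rho (move t k s) z =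
      ∫ z : ℝ, (z : ℂ) ^ (i + j) * W.rho t z * Complex.exp (s * ((z ^ (k : ℕ) : ℝ) : ℂ)) := fun s =>
    integral_congr_ae (Eventually.of_forall fun z => by simp only [rho_move]; ring)
  simp only [e1]
  refine key.congr_deriv (integral_congr_ae (Eventually.of_forall fun z => ?_))
  push_cast
  ring

lemma TMomFinite.hasEntryDeriv {t : Times} (h : W.TMomFinite t) (k : ℕ+) :
    HasEntryDeriv (fun s => W.tmom (move t k s))
      (ipow shift k ⬝∞ W.tmom t + W.tmom t ⬝∞ (ipow shift k).transpose)
      {s | W.TMomFinite (move t k s)} := fun i j => by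
  have e0 : ∀ s (w : ℝ × ℝ), W.skIntegrand t (fn (X ^ i)) (fn (X ^ j)) w *
      Complex.exp (s * ((w.1 ^ (k : ℕ) + w.2 ^ (k : ℕ) : ℝ) : ℂ)) =
      W.skIntegrand (move t k s) (fn (X ^ i)) (fn (X ^ j)) w := fun s w => by
    simp only [skIntegrand, trho_move]
    push_cast
    rw [mul_add, Complex.exp_add]
    ring
  have e2 : ∀ s (w : ℝ × ℝ), ((w.1 ^ (k : ℕ) + w.2 ^ (k : ℕ) : ℝ) : ℂ) *
      W.skIntegrand s (fn (X ^ i)) (fn (X ^ j)) w =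
      W.skIntegrand s (fn (X ^ (i + k))) (fn (X ^ j)) w +
        W.skIntegrand s (fn (X ^ i)) (fn (X ^ (j + k))) w := fun s w => by
    simp only [skIntegrand, fn_X_pow]
    push_cast
    ring
  have key := hasDerivWithinAt_integral_mul_exp (μ := (volume : Measure (ℝ × ℝ)))
    (G := W.skIntegrand t (fn (X ^ i)) (fn (X ^ j)))
    (h := fun w => w.1 ^ (k : ℕ) + w.2 ^ (k : ℕ))
    (A := {s | W.TMomFinite (move t k s)}) (by simpa [move_zero] using h)
    (fun s hs => (TMomFinite.integrable_skIntegrand hs _ _).congr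
      (Eventually.of_forall fun w => (e0 s w).symm))
    (fun s hs => ((TMomFinite.integrable_skIntegrand hs (X ^ (i + k)) (X ^ j)).add
      (TMomFinite.integrable_skIntegrand hs (X ^ i) (X ^ (j + k)))).congr
      (Eventually.of_forall fun w => by beta_reduce; rw [e0, e2]; rfl))
  simp only [e0, e2] at key
  rw [integral_add (h.integrable_skIntegrand _ _) (h.integrable_skIntegrand _ _)] at key
  rw [Matrix.add_apply, ipow_shift_imul, imul_ipow_shift_transpose]
  simp only [tmom, innerSk]
  rw [← mul_add]
  exact key.const_mul _

end Weight

end TodaPfaff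
end

/-! ### Determinants and Pfaffians of moments as multiple integrals -/

noncomputable section

namespace TodaPfaff

/-- The Vandermonde determinant `det (z_i^j)`, as a complex number. -/
def vdet {n : ℕ} (z : Fin n → ℝ) : ℂ := (Matrix.of fun i j : Fin n => (z i : ℂ) ^ (j : ℕ)).det

lemma vdet_eq_sum {n : ℕ} (z : Fin n → ℝ) : vdet z =
    ∑ σ : Equiv.Perm (Fin n), ((Equiv.Perm.sign σ : ℤ) : ℂ) * ∏ i, (z i : ℂ) ^ (σ i : ℕ) := by
  rw [vdet, ← Matrix.det_transpose, Matrix.det_apply']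
  rfl

lemma vdet_eq_prod {n : ℕ} (z : Fin n → ℝ) :
    vdet z = ((∏ i, ∏ j ∈ Finset.Ioi i, (z j - z i) : ℝ) : ℂ) := by
  have := Matrix.det_vandermonde fun i => (z i : ℂ)
  rw [show Matrix.vandermonde (fun i => (z i : ℂ)) =
    Matrix.of fun i j : Fin n => (z i : ℂ) ^ (j : ℕ) from rfl] at this
  rw [vdet, this]
  push_cast
  rfl

lemma abs_vand {n : ℕ} (z : Fin n → ℝ) : |vand z| = ‖vdet z‖ := by
  rw [vdet_eq_prod, Complex.norm_real, Real.norm_eq_abs, vand, Finset.abs_prod, Finset.abs_prod]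
  refine Finset.prod_congr rfl fun i _ => ?_
  rw [Finset.abs_prod, Finset.abs_prod]
  exact Finset.prod_congr rfl fun j _ => abs_sub_comm _ _

lemma vdet_sq {n : ℕ} (z : Fin n → ℝ) : vdet z ^ 2 = ((|vand z| ^ 2 : ℝ) : ℂ) := by
  have h : |vand z| = |∏ i, ∏ j ∈ Finset.Ioi i, (z j - z i)| := by
    rw [abs_vand, vdet_eq_prod, Complex.norm_real, Real.norm_eq_abs]
  rw [h, sq_abs, vdet_eq_prod, Complex.ofReal_pow]

lemma vdet_comp {n : ℕ} (z : Fin n → ℝ) (σ : Equiv.Perm (Fin n)) :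
    vdet (z ∘ σ) = ((Equiv.Perm.sign σ : ℤ) : ℂ) * vdet z :=
  Matrix.det_permute σ (Matrix.of fun i j : Fin n => (z i : ℂ) ^ (j : ℕ))

lemma vdet_eq_zero {n : ℕ} {z : Fin n → ℝ} (h : ¬ Function.Injective z) : vdet z = 0 := by
  simp only [Function.Injective, not_forall] at h
  obtain ⟨i, j, hij, hne⟩ := h
  exact Matrix.det_zero_of_row_eq hne (by funext k; simp [hij])

lemma continuous_vand {n : ℕ} : Continuous (vand : (Fin n → ℝ) → ℝ) :=
  continuous_finsetProd _ fun i _ => continuous_finsetProd _ fun j _ =>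
    (continuous_apply i).sub (continuous_apply j)

section Integrals

variable {n : ℕ} {h : ℝ → ℂ} (hh : ∀ j : ℕ, Integrable fun z : ℝ => (z : ℂ) ^ j * h z)

lemma prod_pow_mul (k : Fin n → ℕ) (z : Fin n → ℝ) :
    (∏ i, (z i : ℂ) ^ k i) * ∏ i, h (z i) = ∏ i, (z i : ℂ) ^ k i * h (z i) :=
  Finset.prod_mul_distrib.symm

lemma vdet_sq_mul (z : Fin n → ℝ) : vdet z ^ 2 * ∏ i, h (z i) =
    ∑ σ : Equiv.Perm (Fin n), ∑ τ : Equiv.Perm (Fin n), ((Equiv.Perm.sign σ : ℤ) : ℂ) *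
      ((Equiv.Perm.sign τ : ℤ) : ℂ) * ((∏ i, (z i : ℂ) ^ ((σ i : ℕ) + τ i)) * ∏ i, h (z i)) := by
  rw [sq, vdet_eq_sum, Finset.sum_mul_sum, Finset.sum_mul]
  refine Finset.sum_congr rfl fun σ _ => ?_
  rw [Finset.sum_mul]
  refine Finset.sum_congr rfl fun τ _ => ?_
  simp only [pow_add, Finset.prod_mul_distrib]
  ring

include hh

lemma integrable_prod_pow (k : Fin n → ℕ) :
    Integrable fun z : Fin n → ℝ => (∏ i, (z i : ℂ) ^ k i) * ∏ i, h (z i) := by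
  simp only [prod_pow_mul]
  exact Integrable.fintype_prod (f := fun i (x : ℝ) => (x : ℂ) ^ k i * h x) fun i => hh (k i)

lemma integrable_vdet : Integrable fun z : Fin n → ℝ => vdet z * ∏ i, h (z i) := by
  simp only [vdet_eq_sum, Finset.sum_mul, mul_assoc]
  exact integrable_finsetSum _ fun σ _ =>
    (integrable_prod_pow hh fun i => (σ i : ℕ)).const_mul _

lemma integrable_vdet_sq : Integrable fun z : Fin n → ℝ => vdet z ^ 2 * ∏ i, h (z i) := by
  simp only [vdet_sq_mul]
  exact integrable_finsetSum _ fun σ _ => integrable_finsetSum _ fun τ _ =>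
    (integrable_prod_pow hh fun i => (σ i : ℕ) + τ i).const_mul _

/-- The Hankel determinant of the moments is an integral over the squared Vandermonde. -/
theorem det_moments : (Matrix.of fun i j : Fin n => ∫ z : ℝ, (z : ℂ) ^ ((i : ℕ) + j) * h z).det =
    (1 / (n.factorial : ℂ)) * ∫ z : Fin n → ℝ, ((|vand z| ^ 2 : ℝ) : ℂ) * ∏ i, h (z i) := by
  set μ : ℕ → ℂ := fun k => ∫ z : ℝ, (z : ℂ) ^ k * h z
  have h1 : ∀ k : Fin n → ℕ,
      ∫ z : Fin n → ℝ, (∏ i, (z i : ℂ) ^ k i) * ∏ i, h (z i) = ∏ i, μ (k i) := fun k => by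
    simp only [prod_pow_mul]
    exact integral_fintype_prod_volume_eq_prod fun i (x : ℝ) => (x : ℂ) ^ k i * h x
  have h2 : ∫ z : Fin n → ℝ, ((|vand z| ^ 2 : ℝ) : ℂ) * ∏ i, h (z i) =
      ∑ σ : Equiv.Perm (Fin n), ∑ τ : Equiv.Perm (Fin n), ((Equiv.Perm.sign σ : ℤ) : ℂ) *
      ((Equiv.Perm.sign τ : ℤ) : ℂ) * ∏ i, μ ((σ i : ℕ) + τ i) := by
    simp only [← vdet_sq, vdet_sq_mul]
    rw [integral_finsetSum _ fun σ _ => integrable_finsetSum _ fun τ _ =>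
      (integrable_prod_pow hh fun i => (σ i : ℕ) + τ i).const_mul _]
    refine Finset.sum_congr rfl fun σ _ => ?_
    rw [integral_finsetSum _ fun τ _ =>
      (integrable_prod_pow hh fun i => (σ i : ℕ) + τ i).const_mul _]
    refine Finset.sum_congr rfl fun τ _ => ?_
    rw [integral_const_mul, h1]
  have h3 : ∀ σ : Equiv.Perm (Fin n), ∑ τ : Equiv.Perm (Fin n), ((Equiv.Perm.sign σ : ℤ) : ℂ) *
      ((Equiv.Perm.sign τ : ℤ) : ℂ) * ∏ i, μ ((σ i : ℕ) + τ i) =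
      (Matrix.of fun i j : Fin n => μ ((i : ℕ) + j)).det := fun σ => by
    rw [← Matrix.det_transpose, Matrix.det_apply', ← Equiv.sum_comp (Equiv.mulRight σ)]
    refine Finset.sum_congr rfl fun τ _ => ?_
    simp only [Equiv.coe_mulRight, Equiv.Perm.sign_mul, Equiv.Perm.coe_mul, Function.comp]
    rw [(Equiv.prod_comp σ fun i => μ ((i : ℕ) + (τ i : ℕ)))]
    have : ((Equiv.Perm.sign σ : ℤ) : ℂ) * ((Equiv.Perm.sign σ : ℤ) : ℂ) = 1 := by
      rw [← Int.cast_mul, ← Units.val_mul, Int.units_mul_self]; simp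
    push_cast
    simp only [Matrix.transpose_apply, Matrix.of_apply]
    linear_combination (((Equiv.Perm.sign τ : ℤ) : ℂ) * ∏ i : Fin n, μ ((i : ℕ) + (τ i : ℕ))) * this
  have hn : (n.factorial : ℂ) ≠ 0 := by exact_mod_cast n.factorial_ne_zero
  rw [h2, Finset.sum_congr rfl fun σ _ => h3 σ]
  simp [Finset.card_univ, Fintype.card_perm]
  field_simp
  rfl

end Integrals

/-- Coordinates `(z_{2k}, z_{2k+1})` instead of `z_0, …, z_{2n-1}`. -/
def pairCoord (n : ℕ) : (Fin n → ℝ × ℝ) ≃ᵐ (Fin (2 * n) → ℝ) where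
  toFun u i := if ((pairEquiv n).symm i).2 = 0 then (u ((pairEquiv n).symm i).1).1
    else (u ((pairEquiv n).symm i).1).2
  invFun z k := (z (fstIdx k), z (sndIdx k))
  left_inv u := by funext k; simp [← pairEquiv_zero, ← pairEquiv_one]
  right_inv z := by
    funext i
    obtain ⟨⟨k, b⟩, rfl⟩ := (pairEquiv n).surjective i
    fin_cases b <;> simp [← pairEquiv_zero, ← pairEquiv_one]
  measurable_toFun := by
    refine measurable_pi_lambda _ fun i => ?_
    by_cases hi : ((pairEquiv n).symm i).2 = 0 <;>
      simp only [Equiv.coe_fn_mk, hi, if_true, if_false] <;> fun_prop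
  measurable_invFun := by
    refine measurable_pi_lambda _ fun i => ?_
    exact (measurable_pi_apply _).prodMk (measurable_pi_apply _)

lemma pairCoord_fst {n : ℕ} (u : Fin n → ℝ × ℝ) (k : Fin n) :
    pairCoord n u (fstIdx k) = (u k).1 := by
  change (if ((pairEquiv n).symm (fstIdx k)).2 = 0 then _ else _) = _
  simp [← pairEquiv_zero]

lemma pairCoord_snd {n : ℕ} (u : Fin n → ℝ × ℝ) (k : Fin n) :
    pairCoord n u (sndIdx k) = (u k).2 := by
  change (if ((pairEquiv n).symm (sndIdx k)).2 = 0 then _ else _) = _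
  simp [← pairEquiv_one]

lemma measurePreserving_pairCoord (n : ℕ) : MeasurePreserving (pairCoord n) := by
  refine ⟨(pairCoord n).measurable, ?_⟩
  refine (Measure.pi_eq fun s hs => ?_).symm
  rw [Measure.map_apply (pairCoord n).measurable (MeasurableSet.univ_pi hs)]
  have : pairCoord n ⁻¹' Set.univ.pi s =
      Set.univ.pi fun k => s (fstIdx k) ×ˢ s (sndIdx k) := by
    ext u
    simp only [Set.mem_preimage, Set.mem_univ_pi, Set.mem_prod]
    constructor
    · intro h k
      rw [← pairCoord_fst, ← pairCoord_snd]
      exact ⟨h _, h _⟩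
    · intro h i
      obtain ⟨⟨k, b⟩, rfl⟩ := (pairEquiv n).surjective i
      fin_cases b
      · change pairCoord n u (fstIdx k) ∈ s (fstIdx k)
        rw [pairCoord_fst]
        exact (h k).1
      · change pairCoord n u (sndIdx k) ∈ s (sndIdx k)
        rw [pairCoord_snd]
        exact (h k).2
  rw [this, volume_pi_pi, prod_pairs]
  exact Finset.prod_congr rfl fun k _ => by rw [Measure.volume_eq_prod, Measure.prod_prod]

lemma measurable_eps_sub {α : Type*} [MeasurableSpace α] {f g : α → ℝ} (hf : Measurable f)
    (hg : Measurable g) : Measurable fun a => eps (f a - g a) :=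
  Measurable.comp (g := fun w : ℝ × ℝ => eps (w.1 - w.2)) Weight.measurable_eps (hf.prodMk hg)

/-- The sign matrix of a configuration. If the `z_i` are distinct, its Pfaffian is the
sign of `vand z`. -/
def epsMat {n : ℕ} (z : Fin n → ℝ) : Matrix (Fin n) (Fin n) ℂ :=
  Matrix.of fun i j => eps (z i - z j)

lemma pfSum_epsMat_comp {n : ℕ} (z : Fin (2 * n) → ℝ) (τ : Equiv.Perm (Fin (2 * n))) :
    pfSum (epsMat (z ∘ τ)) = ((Equiv.Perm.sign τ : ℤ) : ℂ) * pfSum (epsMat z) := by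
  rw [pfSum, pfSum, ← Equiv.sum_comp (Equiv.mulLeft τ⁻¹), Finset.mul_sum]
  refine Finset.sum_congr rfl fun σ _ => ?_
  simp only [Equiv.coe_mulLeft, Equiv.Perm.sign_mul, Equiv.Perm.sign_symm, epsMat,
    Matrix.of_apply, Function.comp, Equiv.Perm.coe_mul, Equiv.Perm.inv_def, Equiv.apply_symm_apply]
  push_cast
  ring

lemma vdet_mul_pfSum_epsMat {n : ℕ} (z : Fin (2 * n) → ℝ) :
    vdet z * pfSum (epsMat z) = (-2) ^ n * n.factorial * ((|vand z| : ℝ) : ℂ) := by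
  by_cases hz : Function.Injective z
  · have hmono : StrictMono (z ∘ Tuple.sort z) :=
      (Tuple.monotone_sort z).strictMono_of_injective (hz.comp (Tuple.sort z).injective)
    set τ := Tuple.sort z
    have hs : ((Equiv.Perm.sign τ : ℤ) : ℂ) * ((Equiv.Perm.sign τ : ℤ) : ℂ) = 1 := by
      rw [← Int.cast_mul, ← Units.val_mul, Int.units_mul_self]; simp
    have hn : ‖((Equiv.Perm.sign τ : ℤ) : ℂ)‖ = 1 := by
      rcases Int.units_eq_one_or (Equiv.Perm.sign τ) with h | h <;> simp [h]
    have h1 : vdet z * pfSum (epsMat z) = vdet (z ∘ τ) * pfSum (epsMat (z ∘ τ)) := by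
      rw [pfSum_epsMat_comp, vdet_comp]
      linear_combination (-vdet z * pfSum (epsMat z)) * hs
    have h2 : |vand z| = |vand (z ∘ τ)| := by
      rw [abs_vand, abs_vand, vdet_comp, norm_mul, hn, one_mul]
    have h3 : vdet (z ∘ τ) = ((|vand (z ∘ τ)| : ℝ) : ℂ) := by
      rw [abs_vand, vdet_eq_prod, Complex.norm_real, Real.norm_of_nonneg]
      exact Finset.prod_nonneg fun i _ => Finset.prod_nonneg fun j hj =>
        sub_nonneg.2 (hmono.monotone (Finset.mem_Ioi.1 hj).le)
    have h4 : pfSum (-epsMat (z ∘ τ)) = 2 ^ n * n.factorial := by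
      refine pfSum_order (fun i j hij => ?_) fun i j hij => ?_
      · have := hmono hij
        simp only [Matrix.neg_apply, epsMat, Matrix.of_apply, eps]
        rw [if_neg (by linarith), neg_neg]
      · have := hmono hij
        simp only [Matrix.neg_apply, epsMat, Matrix.of_apply, eps]
        rw [if_pos (by linarith)]
    have h5 : pfSum (-epsMat (z ∘ τ)) = (-1) ^ n * pfSum (epsMat (z ∘ τ)) := by
      simp only [pfSum, Matrix.neg_apply, Finset.prod_neg, Finset.card_univ, Fintype.card_fin,
        Finset.mul_sum]
      exact Finset.sum_congr rfl fun σ _ => by ring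
    have h6 : ((-1 : ℂ) ^ n) * (-1) ^ n = 1 := by rw [← mul_pow]; simp
    rw [h1, h2, ← h3, show (-2 : ℂ) ^ n = (-1) ^ n * 2 ^ n by rw [← mul_pow]; norm_num]
    rw [h5] at h4
    linear_combination (vdet (z ∘ τ) * (-1) ^ n) * h4 -
      (vdet (z ∘ τ) * pfSum (epsMat (z ∘ τ))) * h6
  · rw [abs_vand, vdet_eq_zero hz]
    simp

section Integrals

variable {n : ℕ} {h : ℝ → ℂ} (hh : ∀ j : ℕ, Integrable fun z : ℝ => (z : ℂ) ^ j * h z)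

include hh

lemma integrable_vdet_mul_eps (σ : Equiv.Perm (Fin (2 * n))) :
    Integrable fun z : Fin (2 * n) → ℝ =>
      vdet z * (∏ k : Fin n, eps (z (σ (fstIdx k)) - z (σ (sndIdx k)))) * ∏ i, h (z i) := by
  have hm : Measurable fun z : Fin (2 * n) → ℝ =>
      ∏ k : Fin n, eps (z (σ (fstIdx k)) - z (σ (sndIdx k))) :=
    Finset.measurable_fun_prod _ fun k _ => measurable_eps_sub
      (measurable_pi_apply _) (measurable_pi_apply _)
  refine ((integrable_vdet hh).bdd_mul (c := 1) hm.aestronglyMeasurable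
    (Eventually.of_forall fun z => ?_)).congr (Eventually.of_forall fun z => ?_)
  · rw [norm_prod]
    simp [Weight.norm_eps]
  · simp only
    ring

/-- The Pfaffian of the skew moments is an integral over the absolute value of the Vandermonde. -/
theorem pf_moments {m : IMat} (hm : ∀ i j, m i j = (1 / 2 : ℂ) * ∫ w : ℝ × ℝ,
      (w.1 : ℂ) ^ i * (w.2 : ℂ) ^ j * eps (w.1 - w.2) * h w.1 * h w.2) :
    pf m n = (1 / ((-2) ^ n * ((2 * n).factorial : ℂ))) *
      ∫ z : Fin (2 * n) → ℝ, ((|vand z| : ℝ) : ℂ) * ∏ i, h (z i) := by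
  let E : (Fin (2 * n) → ℝ) → ℂ := fun z => ∏ k : Fin n, eps (z (fstIdx k) - z (sndIdx k))
  have h1 : ∀ σ : Equiv.Perm (Fin (2 * n)), ∏ k : Fin n, m (σ (fstIdx k)) (σ (sndIdx k)) =
      (1 / 2) ^ n * ∫ z : Fin (2 * n) → ℝ, (∏ i, (z i : ℂ) ^ (σ i : ℕ)) * E z * ∏ i, h (z i) :=
    fun σ => by
    simp only [hm, Finset.prod_mul_distrib, Finset.prod_const, Finset.card_univ, Fintype.card_fin]
    congr 1
    rw [← (measurePreserving_pairCoord n).integral_comp (pairCoord n).measurableEmbedding]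
    rw [← integral_fintype_prod_volume_eq_prod fun (k : Fin n) (w : ℝ × ℝ) =>
      (w.1 : ℂ) ^ (σ (fstIdx k) : ℕ) * (w.2 : ℂ) ^ (σ (sndIdx k) : ℕ) * eps (w.1 - w.2) * h w.1 *
        h w.2]
    refine integral_congr_ae (Eventually.of_forall fun u => ?_)
    simp only [E, prod_pairs, pairCoord_fst, pairCoord_snd, ← Finset.prod_mul_distrib]
    exact Finset.prod_congr rfl fun k _ => by ring
  have hint : ∀ σ : Equiv.Perm (Fin (2 * n)), Integrable fun z : Fin (2 * n) → ℝ =>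
      (∏ i, (z i : ℂ) ^ (σ i : ℕ)) * E z * ∏ i, h (z i) := fun σ => by
    have hmE : Measurable E :=
      Finset.measurable_fun_prod _ fun k _ => measurable_eps_sub
        (measurable_pi_apply _) (measurable_pi_apply _)
    refine ((integrable_prod_pow hh fun i => (σ i : ℕ)).bdd_mul (c := 1) hmE.aestronglyMeasurable
      (Eventually.of_forall fun z => ?_)).congr (Eventually.of_forall fun z => ?_)
    · simp only [E]
      rw [norm_prod]
      simp [Weight.norm_eps]
    · simp only
      ring
  have h2 : pfSum (corner m (2 * n)) =
      (1 / 2) ^ n * ∫ z : Fin (2 * n) → ℝ, vdet z * E z * ∏ i, h (z i) := by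
    have : ∀ z : Fin (2 * n) → ℝ, vdet z * E z * ∏ i, h (z i) =
        ∑ σ : Equiv.Perm (Fin (2 * n)), ((Equiv.Perm.sign σ : ℤ) : ℂ) *
          ((∏ i, (z i : ℂ) ^ (σ i : ℕ)) * E z * ∏ i, h (z i)) := fun z => by
      rw [vdet_eq_sum, Finset.sum_mul, Finset.sum_mul]
      exact Finset.sum_congr rfl fun σ _ => by ring
    simp only [this]
    rw [integral_finsetSum _ fun σ _ => (hint σ).const_mul _, Finset.mul_sum]
    refine Finset.sum_congr rfl fun σ _ => ?_
    rw [integral_const_mul, mul_left_comm, ← h1]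
    rfl
  -- Symmetrization: every permutation of the variables gives the same integral.
  have h3 : ∀ τ : Equiv.Perm (Fin (2 * n)),
      ∫ z : Fin (2 * n) → ℝ, vdet z * E z * ∏ i, h (z i) = ∫ z : Fin (2 * n) → ℝ,
        vdet z * (((Equiv.Perm.sign τ : ℤ) : ℂ) * E (z ∘ τ)) * ∏ i, h (z i) := fun τ => by
    have hp := volume_measurePreserving_piCongrLeft (fun _ : Fin (2 * n) => ℝ) τ.symm
    rw [← hp.integral_comp (MeasurableEquiv.measurableEmbedding _)]
    refine integral_congr_ae (Eventually.of_forall fun z => ?_)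
    have hz : MeasurableEquiv.piCongrLeft (fun _ => ℝ) τ.symm z = z ∘ τ := by
      funext i
      have := MeasurableEquiv.piCongrLeft_apply_apply (β := fun _ => ℝ) τ.symm z (τ i)
      simpa using this
    simp only [hz]
    rw [vdet_comp, Function.comp_def, Equiv.prod_comp τ fun i => h (z i)]
    ring
  have h4 : ((2 * n).factorial : ℂ) * ∫ z : Fin (2 * n) → ℝ, vdet z * E z * ∏ i, h (z i) =
      (-2) ^ n * n.factorial * ∫ z : Fin (2 * n) → ℝ, ((|vand z| : ℝ) : ℂ) * ∏ i, h (z i) := by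
    have e1 : ((2 * n).factorial : ℂ) * ∫ z : Fin (2 * n) → ℝ, vdet z * E z * ∏ i, h (z i) =
        ∑ τ : Equiv.Perm (Fin (2 * n)), ∫ z : Fin (2 * n) → ℝ,
          vdet z * (((Equiv.Perm.sign τ : ℤ) : ℂ) * E (z ∘ τ)) * ∏ i, h (z i) := by
      rw [← Finset.sum_congr rfl fun τ _ => h3 τ]
      simp [Finset.card_univ, Fintype.card_perm]
    rw [e1, ← integral_finsetSum, ← integral_const_mul]
    · refine integral_congr_ae (Eventually.of_forall fun z => ?_)
      simp only
      rw [← Finset.sum_mul, ← Finset.mul_sum, ← mul_assoc, ← vdet_mul_pfSum_epsMat]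
      rfl
    · intro τ _
      refine ((integrable_vdet_mul_eps hh τ).const_mul ((Equiv.Perm.sign τ : ℤ) : ℂ)).congr
        (Eventually.of_forall fun z => ?_)
      simp only [E, Function.comp]
      ring
  have hn : (n.factorial : ℂ) ≠ 0 := by exact_mod_cast n.factorial_ne_zero
  have hn2 : ((2 * n).factorial : ℂ) ≠ 0 := by exact_mod_cast (2 * n).factorial_ne_zero
  have h2n : ((-2 : ℂ)) ^ n * (-2) ^ n = 2 ^ n * 2 ^ n := by rw [← mul_pow, ← mul_pow]; norm_num
  rw [pf_eq, h2]
  have hneg : ((-2 : ℂ)) ^ n ≠ 0 := pow_ne_zero _ (by norm_num)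
  rw [one_div_pow]
  field_simp
  linear_combination (-2 : ℂ) ^ n * h4 + (n.factorial : ℂ) *
    (∫ z : Fin (2 * n) → ℝ, ((|vand z| : ℝ) : ℂ) * ∏ i, h (z i)) * h2n

end Integrals

/-- Strict positivity of the multiple integrals for a nonnegative weight. -/
lemma integral_vand_pos {n : ℕ} (β : ℕ) {r : ℝ → ℝ} {E : Set ℝ} (hE : IsOpen E)
    (hne : E.Nonempty) (h0 : ∀ z, 0 ≤ r z) (hpos : ∀ z ∈ E, 0 < r z)
    (hint : Integrable fun z : Fin n → ℝ => |vand z| ^ β * ∏ i, r (z i)) :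
    0 < ∫ z : Fin n → ℝ, |vand z| ^ β * ∏ i, r (z i) := by
  rw [integral_pos_iff_support_of_nonneg
    (fun z => mul_nonneg (by positivity) (Finset.prod_nonneg fun i _ => h0 _)) hint]
  have hopen : IsOpen ((Set.univ.pi fun _ : Fin n => E) ∩ {z | vand z ≠ 0}) :=
    (isOpen_set_pi Set.finite_univ fun _ _ => hE).inter
      (isOpen_ne_fun continuous_vand continuous_const)
  have hn : ((Set.univ.pi fun _ : Fin n => E) ∩ {z | vand z ≠ 0}).Nonempty := by
    obtain ⟨x, hx⟩ := hne
    have hinf : E.Infinite := infinite_of_mem_nhds x (hE.mem_nhds hx)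
    have := hinf.to_subtype
    let e := Infinite.natEmbedding E
    refine ⟨fun i => e i, fun i _ => (e i).2, ?_⟩
    refine Finset.prod_ne_zero_iff.2 fun i _ => Finset.prod_ne_zero_iff.2 fun j hj hc => ?_
    have : (e i : ℝ) = e j := by linarith
    have := Fin.ext (e.injective (Subtype.ext this))
    exact (Finset.mem_Ioi.1 hj).ne this
  refine (hopen.measure_pos volume hn).trans_le (measure_mono fun z hz => ?_)
  exact mul_ne_zero (pow_ne_zero _ (abs_ne_zero.2 hz.2))
    (Finset.prod_ne_zero_iff.2 fun i _ => (hpos _ (hz.1 i (Set.mem_univ i))).ne')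

end TodaPfaff
end

/-! ### Symmetric moment problems -/

noncomputable section

namespace TodaPfaff

/-- The power sum `∑ zᵢᵏ`. -/
def pws {n : ℕ} (z : Fin n → ℝ) (k : ℕ) : ℝ := ∑ i, z i ^ k

/-- A product of power sums, indexed by the list of exponents. -/
def wordVal {R : Type*} [CommMonoid R] (T : ℕ → R) (w : List ℕ) : R := (w.map T).prod

lemma esymm_mem_adjoin_psum (n k : ℕ) : MvPolynomial.esymm (Fin n) ℝ k ∈
    Algebra.adjoin ℝ (Set.range (MvPolynomial.psum (Fin n) ℝ)) := by
  induction k using Nat.strong_induction_on with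
  | _ k ih =>
    rcases Nat.eq_zero_or_pos k with rfl | hk
    · rw [MvPolynomial.esymm_zero]
      exact one_mem _
    · have h := MvPolynomial.mul_esymm_eq_sum (Fin n) ℝ k
      have hk' : (k : ℝ) ≠ 0 := by exact_mod_cast hk.ne'
      have h2 : MvPolynomial.esymm (Fin n) ℝ k =
          (k : ℝ)⁻¹ • ((k : MvPolynomial (Fin n) ℝ) * MvPolynomial.esymm (Fin n) ℝ k) := by
        rw [← nsmul_eq_mul, ← Nat.cast_smul_eq_nsmul ℝ, smul_smul, inv_mul_cancel₀ hk', one_smul]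
      rw [h2, h]
      refine Subalgebra.smul_mem _ (mul_mem (pow_mem (neg_mem (one_mem _)) _)
        (sum_mem fun a ha => ?_)) _
      rw [Finset.mem_filter] at ha
      exact mul_mem (mul_mem (pow_mem (neg_mem (one_mem _)) _) (ih _ ha.2))
        (Algebra.subset_adjoin ⟨_, rfl⟩)

lemma mem_adjoin_psum {n : ℕ} {P : MvPolynomial (Fin n) ℝ} (hP : P.IsSymmetric) :
    P ∈ Algebra.adjoin ℝ (Set.range (MvPolynomial.psum (Fin n) ℝ)) := by
  obtain ⟨Q, hQ⟩ := (MvPolynomial.esymmAlgEquiv (Fin n) ℝ (Fintype.card_fin n)).surjective ⟨P, hP⟩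
  have h1 : P = MvPolynomial.aeval (fun i : Fin n => MvPolynomial.esymm (Fin n) ℝ (i + 1)) Q := by
    exact (congrArg Subtype.val hQ).symm.trans (MvPolynomial.esymmAlgHom_apply ..)
  have h2 : P ∈ Algebra.adjoin ℝ
      (Set.range fun i : Fin n => MvPolynomial.esymm (Fin n) ℝ (i + 1)) := by
    rw [Algebra.adjoin_range_eq_range_aeval]
    exact ⟨Q, h1.symm⟩
  refine Algebra.adjoin_le ?_ h2
  rintro _ ⟨i, rfl⟩
  exact esymm_mem_adjoin_psum n _

lemma eval_psum {n : ℕ} (z : Fin n → ℝ) (k : ℕ) :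
    MvPolynomial.eval z (MvPolynomial.psum (Fin n) ℝ k) = pws z k := by
  simp [MvPolynomial.psum, pws]

section Moments

variable {n : ℕ} {μ ν : Measure (Fin n → ℝ)} {c : ℝ}

/-- Equality of the expectations of products of power sums extends to symmetric polynomials. -/
lemma integral_eval_of_words (hμ : ∀ w, Integrable (fun z => wordVal (pws z) w) μ)
    (hν : ∀ w, Integrable (fun z => wordVal (pws z) w) ν)
    (h : ∀ w, ∫ z, wordVal (pws z) w ∂μ = c * ∫ z, wordVal (pws z) w ∂ν)
    {P : MvPolynomial (Fin n) ℝ} (hP : P.IsSymmetric) :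
    ∫ z, MvPolynomial.eval z P ∂μ = c * ∫ z, MvPolynomial.eval z P ∂ν := by
  have hmem := mem_adjoin_psum hP
  rw [← Subalgebra.mem_toSubmodule, Algebra.adjoin_eq_span] at hmem
  have key : Integrable (fun z => MvPolynomial.eval z P) μ ∧
      Integrable (fun z => MvPolynomial.eval z P) ν ∧
      ∫ z, MvPolynomial.eval z P ∂μ = c * ∫ z, MvPolynomial.eval z P ∂ν := by
    refine Submodule.span_induction (p := fun P _ =>
      Integrable (fun z => MvPolynomial.eval z P) μ ∧
      Integrable (fun z => MvPolynomial.eval z P) ν ∧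
      ∫ z, MvPolynomial.eval z P ∂μ = c * ∫ z, MvPolynomial.eval z P ∂ν) ?_ ?_ ?_ ?_ hmem
    · intro P hP
      obtain ⟨l, hl, rfl⟩ := Submonoid.exists_list_of_mem_closure hP
      obtain ⟨w, rfl⟩ : ∃ w : List ℕ, l = w.map (MvPolynomial.psum (Fin n) ℝ) := by
        clear hP
        induction l with
        | nil => exact ⟨[], rfl⟩
        | cons a l ih =>
          obtain ⟨w, hw⟩ := ih fun y hy => hl y (List.mem_cons_of_mem _ hy)
          obtain ⟨k, hk⟩ := hl a List.mem_cons_self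
          exact ⟨k :: w, by rw [List.map_cons, hw, hk]⟩
      have hev : ∀ z, MvPolynomial.eval z (w.map (MvPolynomial.psum (Fin n) ℝ)).prod =
          wordVal (pws z) w := fun z => by
        rw [map_list_prod, List.map_map, wordVal]
        congr 2
        funext k
        exact eval_psum z k
      simp only [hev]
      exact ⟨hμ w, hν w, h w⟩
    · simp
    · rintro P Q - - ⟨h1, h2, h3⟩ ⟨h1', h2', h3'⟩
      simp only [map_add]
      refine ⟨h1.add h1', h2.add h2', ?_⟩
      rw [integral_add h1 h1', integral_add h2 h2', h3, h3', mul_add]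
    · rintro a P - ⟨h1, h2, h3⟩
      simp only [MvPolynomial.smul_eval]
      refine ⟨h1.const_mul a, h2.const_mul a, ?_⟩
      rw [integral_const_mul, integral_const_mul, h3]
      ring
  exact key.2.2

lemma hasSum_integral_exp (hμ : ∀ C : ℝ, Integrable (fun z => Real.exp (C * ‖z‖)) μ)
    {g : (Fin n → ℝ) → ℝ} (hg : Continuous g) {C : ℝ} (hC : ∀ z, |g z| ≤ C * ‖z‖) :
    HasSum (fun k : ℕ => Complex.I ^ k / k.factorial * ((∫ z, g z ^ k ∂μ : ℝ) : ℂ))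
      (∫ z, Complex.exp (g z * Complex.I) ∂μ) := by
  have h := hasSum_integral_of_dominated_convergence (μ := μ)
    (F := fun (k : ℕ) z => ((g z : ℂ) * Complex.I) ^ k / k.factorial)
    (f := fun z => Complex.exp (g z * Complex.I)) (fun k z => |g z| ^ k / k.factorial)
    (fun k => by
      refine Continuous.aestronglyMeasurable ?_
      fun_prop)
    (fun k => Eventually.of_forall fun z => by simp)
    (Eventually.of_forall fun z => Real.summable_pow_div_factorial _)
    (by
      have he : ∀ z, ∑' k : ℕ, |g z| ^ k / k.factorial = Real.exp |g z| := fun z => by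
        rw [Real.exp_eq_exp_ℝ, NormedSpace.exp_eq_tsum_div]
      simp only [he]
      refine (hμ C).mono' (by fun_prop) (Eventually.of_forall fun z => ?_)
      rw [Real.norm_of_nonneg (Real.exp_pos _).le]
      exact Real.exp_le_exp.2 (hC z))
    (Eventually.of_forall fun z => by
      rw [Complex.exp_eq_exp_ℂ]
      exact NormedSpace.exp_series_hasSum_exp' ((g z : ℂ) * Complex.I) |>.congr_fun
        fun k => by rw [smul_eq_mul, inv_mul_eq_div])
  convert! h using 2 with k
  rw [show ((∫ z, g z ^ k ∂μ : ℝ) : ℂ) = ∫ z, ((g z ^ k : ℝ) : ℂ) ∂μ from integral_ofReal.symm,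
    ← integral_const_mul]
  refine integral_congr_ae (Eventually.of_forall fun z => ?_)
  simp only
  push_cast
  rw [mul_pow]
  ring

/-- Two measures with exponential moments and proportional expectations of all products of power
sums have proportional symmetrizations. -/
theorem sum_map_perm_eq [IsFiniteMeasure μ] [IsFiniteMeasure ν] (hc : 0 ≤ c)
    (hμ : ∀ C : ℝ, Integrable (fun z => Real.exp (C * ‖z‖)) μ)
    (hν : ∀ C : ℝ, Integrable (fun z => Real.exp (C * ‖z‖)) ν)
    (hμw : ∀ w, Integrable (fun z => wordVal (pws z) w) μ)
    (hνw : ∀ w, Integrable (fun z => wordVal (pws z) w) ν)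
    (h : ∀ w, ∫ z, wordVal (pws z) w ∂μ = c * ∫ z, wordVal (pws z) w ∂ν) :
    ∑ σ : Equiv.Perm (Fin n), μ.map (fun z => z ∘ σ) =
      ENNReal.ofReal c • ∑ σ : Equiv.Perm (Fin n), ν.map (fun z => z ∘ σ) := by
  have hmeas : ∀ σ : Equiv.Perm (Fin n), Measurable fun z : Fin n → ℝ => z ∘ σ := fun σ =>
    measurable_pi_lambda _ fun i => measurable_pi_apply _
  have hcont : ∀ σ : Equiv.Perm (Fin n), Continuous fun z : Fin n → ℝ => z ∘ σ := fun σ =>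
    continuous_pi fun i => continuous_apply _
  have hfin : IsFiniteMeasure (ENNReal.ofReal c • ∑ σ : Equiv.Perm (Fin n),
      ν.map (fun z => z ∘ σ)) := Measure.smul_finite _ ENNReal.ofReal_ne_top
  refine Measure.ext_of_charFunDual (funext fun L => ?_)
  rw [charFunDual_apply, charFunDual_apply]
  have hexp : Continuous fun v : Fin n → ℝ => Complex.exp (L v * Complex.I) := by fun_prop
  have hsum : ∀ (m : Measure (Fin n → ℝ)) [IsFiniteMeasure m],
      ∫ v, Complex.exp (L v * Complex.I) ∂(∑ σ : Equiv.Perm (Fin n), m.map (fun z => z ∘ σ)) =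
        ∑ σ : Equiv.Perm (Fin n), ∫ z, Complex.exp (L (z ∘ σ) * Complex.I) ∂m := fun m _ => by
    rw [integral_finsetSum_measure]
    · refine Finset.sum_congr rfl fun σ _ => ?_
      rw [integral_map (hmeas σ).aemeasurable hexp.aestronglyMeasurable]
    · intro σ _
      refine Integrable.of_bound hexp.aestronglyMeasurable 1 (Eventually.of_forall fun v => ?_)
      rw [Complex.norm_exp_ofReal_mul_I]
  rw [integral_smul_measure, hsum μ, hsum ν, ENNReal.toReal_ofReal hc]
  have hbd : ∀ (σ : Equiv.Perm (Fin n)) z, |L (z ∘ σ)| ≤ ‖L‖ * ‖z‖ := fun σ z => by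
    refine (L.le_opNorm _).trans (mul_le_mul_of_nonneg_left ?_ (norm_nonneg _))
    exact (pi_norm_le_iff_of_nonneg (norm_nonneg _)).2 fun i => norm_le_pi_norm z (σ i)
  have hLc : ∀ σ : Equiv.Perm (Fin n), Continuous fun z => L (z ∘ σ) := fun σ =>
    L.continuous.comp (hcont σ)
  have s1 := hasSum_sum (s := Finset.univ) fun (σ : Equiv.Perm (Fin n)) _ =>
    hasSum_integral_exp hμ (hLc σ) (hbd σ)
  have s2 := (hasSum_sum (s := Finset.univ) fun (σ : Equiv.Perm (Fin n)) _ =>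
    hasSum_integral_exp hν (hLc σ) (hbd σ)).const_smul c
  refine s1.unique ?_
  convert! s2 using 2 with k
  simp only [← Finset.mul_sum]
  rw [Complex.real_smul, mul_left_comm, ← Complex.ofReal_sum, ← Complex.ofReal_sum,
    ← Complex.ofReal_mul]
  congr 2
  -- The `k`-th moment of the symmetrized linear functional is a symmetric polynomial.
  let ℓ : MvPolynomial (Fin n) ℝ := ∑ i, MvPolynomial.C (L (Pi.single i 1)) * MvPolynomial.X i
  let P : MvPolynomial (Fin n) ℝ := ∑ σ : Equiv.Perm (Fin n), MvPolynomial.rename σ (ℓ ^ k)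
  have hP : P.IsSymmetric := fun τ => by
    simp only [P, map_sum, MvPolynomial.rename_rename]
    exact Equiv.sum_comp (Equiv.mulLeft τ) fun σ => MvPolynomial.rename σ (ℓ ^ k)
  have hL : ∀ z, L z = MvPolynomial.eval z ℓ := fun z => by
    have hz : z = ∑ i, z i • Pi.single i (1 : ℝ) := by
      funext j
      simp [Finset.sum_apply, Pi.single_apply]
    conv_lhs => rw [hz]
    simp [ℓ, mul_comm]
  have hPe : ∀ z, MvPolynomial.eval z P = ∑ σ : Equiv.Perm (Fin n), L (z ∘ σ) ^ k := fun z => by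
    simp only [P, map_sum, MvPolynomial.eval_rename, map_pow, hL]
  have hint : ∀ (m : Measure (Fin n → ℝ)), (∀ C : ℝ, Integrable (fun z => Real.exp (C * ‖z‖)) m) →
      ∀ σ : Equiv.Perm (Fin n), Integrable (fun z => L (z ∘ σ) ^ k) m := fun m hm σ => by
    refine ((hm ‖L‖).const_mul (k.factorial : ℝ)).mono'
      ((hLc σ).pow k).aestronglyMeasurable (Eventually.of_forall fun z => ?_)
    have h1 := Real.pow_div_factorial_le_exp (‖L‖ * ‖z‖) (by positivity) k
    rw [div_le_iff₀ (by positivity)] at h1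
    rw [norm_pow, mul_comm]
    exact (pow_le_pow_left₀ (norm_nonneg _) (hbd σ z) k).trans h1
  have e := integral_eval_of_words hμw hνw h hP
  simp only [hPe] at e
  rwa [integral_finsetSum _ fun σ _ => hint μ hμ σ, integral_finsetSum _ fun σ _ => hint ν hν σ]
    at e

end Moments

end TodaPfaff
end

/-! ### Loop equations -/

noncomputable section

namespace TodaPfaff

/-- The Leibniz sum that results from letting a derivation with `T l ↦ l T (k + l - 1)` act on the
word `w`, for a functional `A` on words. -/
def leib (k : ℕ) : List ℕ → (List ℕ → ℂ) → ℂ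
  | [], _ => 0
  | l :: w, A => l * A ((k + l - 1) :: w) + leib k w fun v => A (l :: v)

/-- The loop equations of the Gaussian ensemble of `n` eigenvalues with repulsion exponent `β`, for
the expectations `A w` of the products of power sums. -/
structure LoopEq (β : ℝ) (n : ℕ) (A : List ℕ → ℂ) : Prop where
  zero : ∀ w, A (0 :: w) = n * A w
  succ : ∀ k w, A ((k + 1) :: w) = β / 2 * ∑ p ∈ Finset.range k, A (p :: (k - 1 - p) :: w) +
    (1 - β / 2) * (k * A ((k - 1) :: w)) + leib k w A

lemma leib_congr {c : ℂ} {k : ℕ} {w : List ℕ} {A B : List ℕ → ℂ}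
    (h : ∀ v : List ℕ, v.length = w.length → v.sum + 1 ≤ k + w.sum → A v = c * B v) :
    leib k w A = c * leib k w B := by
  induction w generalizing A B with
  | nil => simp [leib]
  | cons l w ih =>
    rw [leib, leib, mul_add]
    congr 1
    · rcases Nat.eq_zero_or_pos l with rfl | hl
      · simp
      · rw [h _ (by simp) (by simp only [List.sum_cons]; omega)]
        ring
    · refine ih fun v hv hs => h _ (by simp [hv]) ?_
      simp only [List.sum_cons]
      omega

/-- The loop equations determine all expectations in terms of the total mass. -/
theorem LoopEq.unique {β : ℝ} {n : ℕ} {A B : List ℕ → ℂ} (hA : LoopEq β n A) (hB : LoopEq β n B)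
    {c : ℂ} (h0 : A [] = c * B []) (w : List ℕ) : A w = c * B w := by
  induction hN : w.sum + w.length using Nat.strong_induction_on generalizing w with
  | _ N ih =>
    match w, hN with
    | [], _ => exact h0
    | 0 :: w, hN =>
      rw [hA.zero, hB.zero,
        ih _ (by simp only [List.sum_cons, List.length_cons] at hN; omega) w rfl]
      ring
    | (k + 1) :: w, hN =>
      simp only [List.sum_cons, List.length_cons] at hN
      rw [hA.succ, hB.succ, leib_congr (c := c) fun v hv hs => ih _ (by omega) v rfl]
      have e1 : ∀ p ∈ Finset.range k, A (p :: (k - 1 - p) :: w) = c * B (p :: (k - 1 - p) :: w) :=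
        fun p hp => ih _ (by
          rw [Finset.mem_range] at hp
          simp only [List.sum_cons, List.length_cons]
          omega) _ rfl
      -- For `k = 0` the truncated `k - 1` does no harm, since the term has the factor `k`.
      have e2 : (k : ℂ) * A ((k - 1) :: w) = c * (k * B ((k - 1) :: w)) := by
        rw [ih _ (by simp only [List.sum_cons, List.length_cons]; omega) ((k - 1) :: w) rfl]
        ring
      rw [Finset.sum_congr rfl e1, e2, ← Finset.mul_sum]
      ring

/-- The derivative of a word in `T` when `T l` has the derivative `l Y l`. -/
def dWord (T Y : ℕ → ℂ) : List ℕ → ℂ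
  | [] => 0
  | l :: w => l * Y l * wordVal T w + T l * dWord T Y w

lemma wordVal_cons {R : Type*} [CommMonoid R] (T : ℕ → R) (l : ℕ) (w : List ℕ) :
    wordVal T (l :: w) = T l * wordVal T w := by
  rw [wordVal, List.map_cons, List.prod_cons, wordVal]

lemma hasDerivAt_wordVal {T : ℕ → ℝ → ℂ} {Y : ℕ → ℂ} {x : ℝ}
    (h : ∀ l, HasDerivAt (T l) (l * Y l) x) (w : List ℕ) :
    HasDerivAt (fun s => wordVal (fun l => T l s) w) (dWord (fun l => T l x) Y w) x := by
  induction w with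
  | nil => exact hasDerivAt_const x (1 : ℂ)
  | cons l w ih =>
    simp only [wordVal_cons, dWord]
    exact (h l).mul ih

lemma leib_mul_left (k : ℕ) (w : List ℕ) (A : List ℕ → ℂ) (c : ℂ) :
    leib k w (fun v => c * A v) = c * leib k w A := leib_congr fun _ _ _ => rfl

lemma sum_mul_dWord {ι : Type*} {s : Finset ι} {k : ℕ} {T : ℕ → ℂ} {φ : ι → ℂ} {Y : ι → ℕ → ℂ}
    (h : ∀ l, 0 < l → ∑ a ∈ s, φ a * Y a l = T (k + l - 1)) (w : List ℕ) :
    ∑ a ∈ s, φ a * dWord T (Y a) w = leib k w (wordVal T) := by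
  induction w with
  | nil => simp [dWord, leib]
  | cons l w ih =>
    have e : ∀ a, φ a * dWord T (Y a) (l :: w) =
        l * wordVal T w * (φ a * Y a l) + T l * (φ a * dWord T (Y a) w) := fun a => by
      rw [dWord]
      ring
    simp only [e, Finset.sum_add_distrib, ← Finset.mul_sum, ih, leib, wordVal_cons, leib_mul_left]
    congr 1
    rcases Nat.eq_zero_or_pos l with rfl | hl
    · simp
    · rw [h l hl]
      ring

lemma leib_integral {α : Type*} [MeasurableSpace α] {μ : Measure α} {F : α → List ℕ → ℂ} (k : ℕ)
    (w : List ℕ) (h : ∀ v, Integrable (fun x => F x v) μ) :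
    Integrable (fun x => leib k w (F x)) μ ∧
      leib k w (fun v => ∫ x, F x v ∂μ) = ∫ x, leib k w (F x) ∂μ := by
  induction w generalizing F with
  | nil => exact ⟨integrable_zero _ _ _, by simp [leib]⟩
  | cons l w ih =>
    obtain ⟨i1, i2⟩ := ih (F := fun x v => F x (l :: v)) fun v => h _
    refine ⟨((h _).const_mul _).add i1, ?_⟩
    simp only [leib]
    rw [integral_add ((h _).const_mul _) i1, integral_const_mul, i2]

/-- Measurable functions of at most exponential growth. -/
def Tame {E : Type*} [NormedAddCommGroup E] [MeasurableSpace E] (f : E → ℂ) : Prop :=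
  Measurable f ∧ ∃ K, 0 ≤ K ∧ ∀ x, ‖f x‖ ≤ K * Real.exp (K * ‖x‖)

section Tame

variable {E : Type*} [NormedAddCommGroup E] [MeasurableSpace E] {f g : E → ℂ}

lemma tame_const (c : ℂ) : Tame fun _ : E => c :=
  ⟨measurable_const, ‖c‖, norm_nonneg _, fun x =>
    le_mul_of_one_le_right (norm_nonneg _) (Real.one_le_exp (by positivity))⟩

lemma Tame.add (hf : Tame f) (hg : Tame g) : Tame fun x => f x + g x := by
  obtain ⟨mf, K, hK, hf⟩ := hf
  obtain ⟨mg, L, hL, hg⟩ := hg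
  refine ⟨mf.add mg, K + L, add_nonneg hK hL, fun x => (norm_add_le _ _).trans ?_⟩
  rw [add_mul]
  refine add_le_add ((hf x).trans ?_) ((hg x).trans ?_) <;> gcongr <;> linarith

lemma Tame.mul (hf : Tame f) (hg : Tame g) : Tame fun x => f x * g x := by
  obtain ⟨mf, K, hK, hf⟩ := hf
  obtain ⟨mg, L, hL, hg⟩ := hg
  refine ⟨mf.mul mg, K + L + K * L, by positivity, fun x => ?_⟩
  rw [norm_mul]
  calc ‖f x‖ * ‖g x‖ ≤ (K * Real.exp (K * ‖x‖)) * (L * Real.exp (L * ‖x‖)) :=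
        mul_le_mul (hf x) (hg x) (norm_nonneg _) (by positivity)
    _ = (K * L) * Real.exp ((K + L) * ‖x‖) := by
        rw [add_mul, Real.exp_add]
        ring
    _ ≤ _ := by
        have := mul_nonneg hK hL
        refine mul_le_mul (by linarith) (Real.exp_le_exp.2 ?_) (Real.exp_pos _).le (by positivity)
        exact mul_le_mul_of_nonneg_right (by linarith) (norm_nonneg _)

lemma Tame.sum {ι : Type*} {s : Finset ι} {F : ι → E → ℂ} (h : ∀ i ∈ s, Tame (F i)) :
    Tame fun x => ∑ i ∈ s, F i x := by
  classical
  induction s using Finset.induction_on with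
  | empty => simpa using tame_const (E := E) 0
  | insert a s ha ih =>
    simp only [Finset.sum_insert ha]
    exact (h a (Finset.mem_insert_self _ _)).add
      (ih fun i hi => h i (Finset.mem_insert_of_mem hi))

lemma Tame.prod {ι : Type*} {s : Finset ι} {F : ι → E → ℂ} (h : ∀ i ∈ s, Tame (F i)) :
    Tame fun x => ∏ i ∈ s, F i x := by
  classical
  induction s using Finset.induction_on with
  | empty => simpa using tame_const (E := E) 1
  | insert a s ha ih =>
    simp only [Finset.prod_insert ha]
    exact (h a (Finset.mem_insert_self _ _)).mul
      (ih fun i hi => h i (Finset.mem_insert_of_mem hi))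

lemma Tame.pow (hf : Tame f) (k : ℕ) : Tame fun x => f x ^ k := by
  simpa using Tame.prod (s := Finset.range k) fun _ _ => hf

lemma Tame.of_le (hm : Measurable f) (hg : Tame g) (h : ∀ x, ‖f x‖ ≤ ‖g x‖) : Tame f := by
  obtain ⟨-, K, hK, hg⟩ := hg
  exact ⟨hm, K, hK, fun x => (h x).trans (hg x)⟩

lemma tame_exp [OpensMeasurableSpace E] (C : ℝ) :
    Tame fun x : E => ((Real.exp (C * ‖x‖) : ℝ) : ℂ) := by
  refine ⟨by fun_prop, |C| + 1, by positivity, fun x => ?_⟩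
  rw [Complex.norm_real, Real.norm_of_nonneg (Real.exp_pos _).le]
  have h1 : C * ‖x‖ ≤ (|C| + 1) * ‖x‖ :=
    mul_le_mul_of_nonneg_right (by linarith [le_abs_self C]) (norm_nonneg _)
  calc Real.exp (C * ‖x‖) ≤ 1 * Real.exp ((|C| + 1) * ‖x‖) := by
        rw [one_mul]
        exact Real.exp_le_exp.2 h1
    _ ≤ _ := by
        gcongr
        linarith [abs_nonneg C]

lemma Tame.wordVal {T : ℕ → E → ℂ} (hT : ∀ l, Tame (T l)) (w : List ℕ) :
    Tame fun x => wordVal (fun l => T l x) w := by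
  induction w with
  | nil => exact tame_const 1
  | cons l w ih =>
    simp only [wordVal_cons]
    exact (hT l).mul ih

lemma Tame.dWord {T Y : ℕ → E → ℂ} (hT : ∀ l, Tame (T l)) (hY : ∀ l, Tame (Y l)) (w : List ℕ) :
    Tame fun x => dWord (fun l => T l x) (fun l => Y l x) w := by
  induction w with
  | nil => exact tame_const 0
  | cons l w ih =>
    simp only [TodaPfaff.dWord]
    exact (((tame_const _).mul (hY l)).mul (Tame.wordVal hT w)).add ((hT l).mul ih)

variable [NormedSpace ℝ E] [FiniteDimensional ℝ E] [BorelSpace E] {μ : Measure E}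
  [μ.IsAddHaarMeasure]

/-- A tame function is integrable against a Gaussian. -/
lemma Tame.integrable_gauss (hf : Tame f) {G : E → ℂ} (hG : Measurable G)
    (hb : ∀ x, ‖G x‖ ≤ Real.exp (-‖x‖ ^ 2 / 2)) : Integrable (fun x => f x * G x) μ := by
  obtain ⟨mf, K, hK, hf⟩ := hf
  set r : ℝ := Module.finrank ℝ E + 1 with hr
  have hr0 : 0 ≤ r := by positivity
  refine ((integrable_one_add_norm (μ := μ) (r := r) (by simp [hr])).const_mul
    (K * Real.exp ((K + r) ^ 2 / 2))).mono' (mf.mul hG).aestronglyMeasurable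
    (Eventually.of_forall fun x => ?_)
  have h1 : 0 < 1 + ‖x‖ := by positivity
  have h2 : (1 + ‖x‖) ^ r ≤ Real.exp (r * ‖x‖) := by
    rw [mul_comm, Real.exp_mul]
    exact Real.rpow_le_rpow h1.le (by linarith [Real.add_one_le_exp ‖x‖]) hr0
  rw [Real.rpow_neg h1.le, ← div_eq_mul_inv, le_div_iff₀ (Real.rpow_pos_of_pos h1 _), norm_mul]
  calc ‖f x‖ * ‖G x‖ * (1 + ‖x‖) ^ r ≤
      (K * Real.exp (K * ‖x‖)) * Real.exp (-‖x‖ ^ 2 / 2) * Real.exp (r * ‖x‖) := by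
        have := hf x
        have := hb x
        gcongr
    _ = K * Real.exp (K * ‖x‖ + -‖x‖ ^ 2 / 2 + r * ‖x‖) := by
        rw [Real.exp_add, Real.exp_add]
        ring
    _ ≤ _ := by
        gcongr
        nlinarith [sq_nonneg (‖x‖ - (K + r))]

/-- The integral of a directional derivative vanishes. -/
lemma integral_eq_zero_of_hasLineDerivAt {F F' : E → ℂ} {v : E} (hF : Integrable F μ)
    (hF' : Integrable F' μ) (h : ∀ x, HasDerivAt (fun s : ℝ => F (x + s • v)) (F' x) 0) :
    ∫ x, F' x ∂μ = 0 := by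
  have := integral_bilinear_hasLineDerivAt_right_eq_neg_left_of_integrable (μ := μ) (v := v)
    (f := fun _ : E => (1 : ℂ)) (f' := fun _ => 0) (g := F) (g' := F')
    (B := ContinuousLinearMap.mul ℝ ℂ) (by simp) (by simpa using hF') (by simpa using hF)
    (fun x _ => hasDerivAt_const _ _) (fun x _ => h x)
  simpa using this

/-- Integration by parts along the fields `φ k a ∂_a` gives the loop equations. -/
theorem loopEq_of_fields {β : ℝ} {n : ℕ} {ι : Type*} [Fintype ι] {d : ι → E} {T : ℕ → E → ℂ}
    {φ φ' : ℕ → ι → E → ℂ} {Y : ι → ℕ → E → ℂ} {D : E → ℂ} {D' : ι → E → ℂ}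
    (hT0 : ∀ x, T 0 x = n) (tT : ∀ l, Tame (T l)) (tφ : ∀ k a, Tame (φ k a))
    (tφ' : ∀ k a, Tame (φ' k a)) (tY : ∀ a l, Tame (Y a l))
    (hD : ∀ f, Tame f → Integrable (fun x => f x * D x) μ)
    (hD' : ∀ a f, Tame f → Integrable (fun x => f x * D' a x) μ)
    (dT : ∀ l a x, HasDerivAt (fun s : ℝ => T l (x + s • d a)) (l * Y a l x) 0)
    (dφ : ∀ k a x, HasDerivAt (fun s : ℝ => φ k a (x + s • d a)) (φ' k a x) 0)
    (dD : ∀ a x, HasDerivAt (fun s : ℝ => D (x + s • d a)) (D' a x) 0)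
    (h1 : ∀ k x, ∑ a, (φ' k a x * D x + φ k a x * D' a x) =
      (β / 2 * ∑ p ∈ Finset.range k, T p x * T (k - 1 - p) x + (1 - β / 2) * (k * T (k - 1) x) -
        T (k + 1) x) * D x)
    (h2 : ∀ k l x, 0 < l → ∑ a, φ k a x * Y a l x = T (k + l - 1) x) :
    LoopEq β n fun w => ∫ x, wordVal (fun l => T l x) w * D x ∂μ := by
  have iW : ∀ w, Integrable (fun x => wordVal (fun l => T l x) w * D x) μ := fun w =>
    hD _ (Tame.wordVal tT w)
  refine ⟨fun w => ?_, fun k w => ?_⟩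
  · simp only [wordVal_cons, hT0, mul_assoc]
    exact integral_const_mul _ _
  · -- The derivative of `φ k a w(T) D` in the direction `d a`.
    let F' : ι → E → ℂ := fun a x =>
      φ' k a x * wordVal (fun l => T l x) w * D x +
        φ k a x * dWord (fun l => T l x) (fun l => Y a l x) w * D x +
        φ k a x * wordVal (fun l => T l x) w * D' a x
    have iF' : ∀ a, Integrable (F' a) μ := fun a =>
      ((hD _ ((tφ' k a).mul (Tame.wordVal tT w))).add
        (hD _ ((tφ k a).mul (Tame.dWord tT (tY a) w)))).add
        (hD' a _ ((tφ k a).mul (Tame.wordVal tT w)))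
    have hz : ∫ x, ∑ a, F' a x ∂μ = 0 := by
      rw [integral_finsetSum _ fun a _ => iF' a]
      refine Finset.sum_eq_zero fun a _ => ?_
      refine integral_eq_zero_of_hasLineDerivAt (v := d a)
        (F := fun x => φ k a x * wordVal (fun l => T l x) w * D x)
        (hD _ ((tφ k a).mul (Tame.wordVal tT w))) (iF' a) fun x => ?_
      have hw := hasDerivAt_wordVal (T := fun l s => T l (x + s • d a)) (Y := fun l => Y a l x)
        (x := 0) (fun l => dT l a x) w
      have := ((dφ k a x).fun_mul hw).fun_mul (dD a x)
      simp only [zero_smul, add_zero] at this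
      convert! this using 1
      simp only [F']
      ring
    have hp : ∀ x, ∑ a, F' a x =
        (β / 2 * ∑ p ∈ Finset.range k, wordVal (fun l => T l x) (p :: (k - 1 - p) :: w) * D x +
          (1 - β / 2) * (k * (wordVal (fun l => T l x) ((k - 1) :: w) * D x)) -
          wordVal (fun l => T l x) ((k + 1) :: w) * D x) +
          leib k w fun v => wordVal (fun l => T l x) v * D x := fun x => by
      have e : ∀ a, F' a x = wordVal (fun l => T l x) w * (φ' k a x * D x + φ k a x * D' a x) +
          D x * (φ k a x * dWord (fun l => T l x) (fun l => Y a l x) w) := fun a => by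
        simp only [F']
        ring
      simp only [e, Finset.sum_add_distrib (s := Finset.univ), ← Finset.mul_sum]
      rw [← Finset.sum_add_distrib, h1 k x,
        sum_mul_dWord (T := fun l => T l x) fun l hl => h2 k l x hl,
        leib_congr (c := D x) (A := fun v => wordVal (fun l => T l x) v * D x)
          (B := wordVal fun l => T l x) fun v _ _ => mul_comm _ _]
      simp only [wordVal_cons, mul_sub, sub_mul, mul_add, add_mul, Finset.mul_sum, Finset.sum_mul]
      congr 2
      · congr 1
        · exact Finset.sum_congr rfl fun p _ => by ring
        · ring
      · ring
    obtain ⟨il, el⟩ := leib_integral (μ := μ) (F := fun x v => wordVal (fun l => T l x) v * D x)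
      k w iW
    simp only [hp] at hz
    have i1 : Integrable (fun x => (β / 2 : ℂ) * ∑ p ∈ Finset.range k,
        wordVal (fun l => T l x) (p :: (k - 1 - p) :: w) * D x) μ :=
      (integrable_finsetSum _ fun p _ => iW _).const_mul _
    have i2 : Integrable (fun x => (1 - β / 2 : ℂ) * (k *
        (wordVal (fun l => T l x) ((k - 1) :: w) * D x))) μ := ((iW _).const_mul _).const_mul _
    have i12 : Integrable (fun x => (β / 2 : ℂ) * ∑ p ∈ Finset.range k,
        wordVal (fun l => T l x) (p :: (k - 1 - p) :: w) * D x + (1 - β / 2 : ℂ) * (k *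
        (wordVal (fun l => T l x) ((k - 1) :: w) * D x))) μ := i1.add i2
    have i3 : Integrable (fun x => (β / 2 : ℂ) * ∑ p ∈ Finset.range k,
        wordVal (fun l => T l x) (p :: (k - 1 - p) :: w) * D x + (1 - β / 2 : ℂ) * (k *
        (wordVal (fun l => T l x) ((k - 1) :: w) * D x)) -
        wordVal (fun l => T l x) ((k + 1) :: w) * D x) μ := i12.sub (iW _)
    rw [integral_add i3 il, integral_sub i12 (iW _), integral_add i1 i2, integral_const_mul,
      integral_const_mul, integral_const_mul,
      integral_finsetSum _ fun p _ => iW _] at hz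
    rw [el]
    linear_combination -hz

end Tame

end TodaPfaff
end

/-! ### The loop equations for the eigenvalues -/

noncomputable section

namespace TodaPfaff

variable {n : ℕ}

/-- The pairs `i < j`. -/
def upairs (n : ℕ) : Finset (Σ _ : Fin n, Fin n) := Finset.univ.sigma fun i => Finset.Ioi i

lemma vand_eq_prod (z : Fin n → ℝ) : vand z = ∏ a ∈ upairs n, (z a.1 - z a.2) := by
  rw [vand, upairs, Finset.prod_sigma]

/-- The partial derivatives of the Vandermonde determinant. -/
def dvand (i : Fin n) (z : Fin n → ℝ) : ℝ :=
  ∑ a ∈ upairs n, (∏ b ∈ (upairs n).erase a, (z b.1 - z b.2)) *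
    ((Pi.single i 1 : Fin n → ℝ) a.1 - (Pi.single i 1 : Fin n → ℝ) a.2)

lemma hasDerivAt_coord (z v : Fin n → ℝ) (j : Fin n) :
    HasDerivAt (fun s : ℝ => (z + s • v) j) (v j) 0 := by
  simpa using ((hasDerivAt_id (0 : ℝ)).mul_const (v j)).const_add (z j)

lemma hasDerivAt_vand (z : Fin n → ℝ) (i : Fin n) :
    HasDerivAt (fun s : ℝ => vand (z + s • (Pi.single i 1 : Fin n → ℝ))) (dvand i z) 0 := by
  simp only [vand_eq_prod]
  have := HasDerivAt.fun_finsetProd (u := upairs n) fun a _ =>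
    (hasDerivAt_coord z (Pi.single i 1) a.1).fun_sub (hasDerivAt_coord z (Pi.single i 1) a.2)
  simp only [zero_smul, add_zero, smul_eq_mul] at this
  exact this

lemma sum_pow_mul_single (z : Fin n → ℝ) (k : ℕ) (j : Fin n) :
    ∑ i, z i ^ k * (Pi.single i 1 : Fin n → ℝ) j = z j ^ k := by
  simp [Pi.single_apply]

lemma sum_pow_mul_dvand (k : ℕ) (z : Fin n → ℝ) :
    ∑ i, z i ^ k * dvand i z =
      (∑ p ∈ Finset.range k, pws z p * pws z (k - 1 - p) - k * pws z (k - 1)) / 2 * vand z := by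
  have h1 : ∑ i, z i ^ k * dvand i z = ∑ a ∈ upairs n,
      (∑ p ∈ Finset.range k, z a.1 ^ p * z a.2 ^ (k - 1 - p)) * vand z := by
    simp only [dvand, Finset.mul_sum]
    rw [Finset.sum_comm]
    refine Finset.sum_congr rfl fun a ha => ?_
    have e : ∀ i, z i ^ k * ((∏ b ∈ (upairs n).erase a, (z b.1 - z b.2)) *
        ((Pi.single i 1 : Fin n → ℝ) a.1 - (Pi.single i 1 : Fin n → ℝ) a.2)) =
        (∏ b ∈ (upairs n).erase a, (z b.1 - z b.2)) * (z i ^ k * (Pi.single i 1 : Fin n → ℝ) a.1 -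
          z i ^ k * (Pi.single i 1 : Fin n → ℝ) a.2) := fun i => by ring
    simp only [e]
    rw [← Finset.mul_sum, Finset.sum_sub_distrib, sum_pow_mul_single, sum_pow_mul_single,
      ← geom_sum₂_mul, vand_eq_prod, ← Finset.mul_prod_erase _ _ ha]
    ring
  rw [h1, ← Finset.sum_mul]
  congr 1
  -- Half of the sum over all pairs, minus the diagonal.
  set h : Fin n → Fin n → ℝ := fun i j => ∑ p ∈ Finset.range k, z i ^ p * z j ^ (k - 1 - p) with hh
  have hsymm : ∀ i j, h i j = h j i := fun i j => by
    simp only [hh]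
    rw [← Finset.sum_range_reflect]
    refine Finset.sum_congr rfl fun p hp => ?_
    rw [Finset.mem_range] at hp
    rw [show k - 1 - (k - 1 - p) = p by omega, mul_comm]
  have hdiag : ∀ i, h i i = k * z i ^ (k - 1) := fun i => by
    simp only [hh]
    rw [Finset.sum_congr rfl fun p hp => show z i ^ p * z i ^ (k - 1 - p) = z i ^ (k - 1) by
      rw [Finset.mem_range] at hp
      rw [← pow_add, show p + (k - 1 - p) = k - 1 by omega]]
    simp
  have hall : ∑ i, ∑ j, h i j = ∑ p ∈ Finset.range k, pws z p * pws z (k - 1 - p) := by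
    simp only [hh, pws, Finset.sum_mul_sum]
    simp_rw [Finset.sum_comm (s := Finset.range k)]
  have hsplit : ∑ i, ∑ j, h i j = ∑ i, h i i + 2 * ∑ a ∈ upairs n, h a.1 a.2 := by
    have e1 : ∀ i : Fin n, ∑ j, h i j =
        ∑ j ∈ Finset.Iio i, h i j + h i i + ∑ j ∈ Finset.Ioi i, h i j := fun i => by
      rw [← Finset.sum_filter_add_sum_filter_not Finset.univ (fun j => j < i),
        show Finset.univ.filter (fun j => j < i) = Finset.Iio i by ext; simp,
        show Finset.univ.filter (fun j => ¬ j < i) = insert i (Finset.Ioi i) by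
          ext j
          simp only [Finset.mem_filter, Finset.mem_univ, true_and, Finset.mem_insert,
            Finset.mem_Ioi, not_lt, le_iff_eq_or_lt]
          tauto, Finset.sum_insert (by simp)]
      ring
    have e2 : ∑ i, ∑ j ∈ Finset.Iio i, h i j = ∑ i, ∑ j ∈ Finset.Ioi i, h i j := by
      rw [Finset.sum_comm' (t' := Finset.univ) (s' := fun j => Finset.Ioi j) (by simp)]
      exact Finset.sum_congr rfl fun i _ => Finset.sum_congr rfl fun j _ => hsymm _ _
    rw [upairs, Finset.sum_sigma]
    simp only [e1, Finset.sum_add_distrib, e2]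
    ring
  rw [← hall, hsplit, pws, Finset.sum_congr rfl fun i _ => hdiag i, ← Finset.mul_sum]
  ring

/-- The Gaussian `e^{-∑ zᵢ²/2}`. -/
def gauss (z : Fin n → ℝ) : ℝ := Real.exp (-(∑ i, z i ^ 2) / 2)

lemma gauss_pos (z : Fin n → ℝ) : 0 < gauss z := Real.exp_pos _

lemma continuous_gauss : Continuous (gauss : (Fin n → ℝ) → ℝ) := by
  unfold gauss
  fun_prop

lemma norm_sq_le_sum (z : Fin n → ℝ) : ‖z‖ ^ 2 ≤ ∑ i, z i ^ 2 := by
  have h0 : 0 ≤ ∑ i, z i ^ 2 := Finset.sum_nonneg fun i _ => sq_nonneg _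
  refine (Real.le_sqrt (norm_nonneg _) h0).1 ((pi_norm_le_iff_of_nonneg (Real.sqrt_nonneg _)).2
    fun i => Real.le_sqrt_of_sq_le ?_)
  rw [Real.norm_eq_abs, sq_abs]
  exact Finset.single_le_sum (f := fun i => z i ^ 2) (fun i _ => sq_nonneg _) (Finset.mem_univ i)

lemma gauss_le (z : Fin n → ℝ) : ‖((gauss z : ℝ) : ℂ)‖ ≤ Real.exp (-‖z‖ ^ 2 / 2) := by
  rw [Complex.norm_real, Real.norm_of_nonneg (gauss_pos z).le, gauss]
  exact Real.exp_le_exp.2 (by linarith [norm_sq_le_sum z])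

lemma tame_coord (i : Fin n) : Tame fun z : Fin n → ℝ => ((z i : ℝ) : ℂ) := by
  refine Tame.of_le (by fun_prop) (tame_exp 1) fun z => ?_
  rw [Complex.norm_real, Complex.norm_real, Real.norm_of_nonneg (Real.exp_pos _).le, one_mul]
  linarith [norm_le_pi_norm z i, Real.add_one_le_exp ‖z‖]

lemma tame_pws (k : ℕ) : Tame fun z : Fin n → ℝ => ((pws z k : ℝ) : ℂ) := by
  simp only [pws, Complex.ofReal_sum, Complex.ofReal_pow]
  exact Tame.sum fun i _ => (tame_coord i).pow k

lemma tame_vand : Tame fun z : Fin n → ℝ => ((vand z : ℝ) : ℂ) := by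
  simp only [vand_eq_prod, Complex.ofReal_prod, sub_eq_add_neg, Complex.ofReal_add,
    Complex.ofReal_neg]
  refine Tame.prod fun a _ => (tame_coord a.1).add ?_
  simpa using (tame_const (-1)).mul (tame_coord a.2)

lemma tame_dvand (i : Fin n) : Tame fun z : Fin n → ℝ => ((dvand i z : ℝ) : ℂ) := by
  simp only [dvand, Complex.ofReal_sum, Complex.ofReal_mul, Complex.ofReal_prod]
  refine Tame.sum fun a _ => Tame.mul (Tame.prod fun b _ => ?_) (tame_const _)
  simp only [sub_eq_add_neg, Complex.ofReal_add, Complex.ofReal_neg]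
  simpa using (tame_coord b.1).add ((tame_const (-1)).mul (tame_coord b.2))

lemma abs_rpow_le {x q : ℝ} (hq0 : 0 ≤ q) (hq2 : q ≤ 2) : |x| ^ q ≤ 1 + |x| ^ 2 := by
  rcases le_total |x| 1 with h | h
  · exact (Real.rpow_le_one (abs_nonneg _) h hq0).trans (by nlinarith [sq_nonneg |x|])
  · have := Real.rpow_le_rpow_of_exponent_le h hq2
    rw [Real.rpow_two] at this
    linarith

lemma tame_abs_vand_rpow {q : ℝ} (hq0 : 0 ≤ q) (hq2 : q ≤ 2) :
    Tame fun z : Fin n → ℝ => ((|vand z| ^ q : ℝ) : ℂ) := by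
  have hm : Measurable (vand : (Fin n → ℝ) → ℝ) := continuous_vand.measurable
  refine Tame.of_le (by fun_prop) ((tame_const 1).add (tame_vand.pow 2)) fun z => ?_
  rw [Complex.norm_real, Real.norm_of_nonneg (by positivity)]
  have e : (1 : ℂ) + ((vand z : ℝ) : ℂ) ^ 2 = ((1 + |vand z| ^ 2 : ℝ) : ℂ) := by
    push_cast
    rw [← Complex.ofReal_pow |vand z|, sq_abs]
    push_cast
    rfl
  rw [e, Complex.norm_real, Real.norm_of_nonneg (by positivity)]
  exact abs_rpow_le hq0 hq2

/-- The weight `|Δ(z)|^β e^{-∑ zᵢ²/2}`. -/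
def gaussVand (β : ℝ) (z : Fin n → ℝ) : ℝ := |vand z| ^ β * gauss z

lemma integrable_gaussVand {β : ℝ} (hβ0 : 0 ≤ β) (hβ2 : β ≤ 2) {f : (Fin n → ℝ) → ℂ}
    (hf : Tame f) : Integrable fun z => f z * ((gaussVand β z : ℝ) : ℂ) := by
  have := (hf.mul (tame_abs_vand_rpow hβ0 hβ2)).integrable_gauss (μ := volume)
    (G := fun z => ((gauss z : ℝ) : ℂ)) (by have := continuous_gauss (n := n); fun_prop) gauss_le
  refine this.congr (Eventually.of_forall fun z => ?_)
  simp only [gaussVand, Complex.ofReal_mul]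
  ring

lemma hasDerivAt_gauss (z : Fin n → ℝ) (i : Fin n) :
    HasDerivAt (fun s : ℝ => gauss (z + s • (Pi.single i 1 : Fin n → ℝ))) (-z i * gauss z) 0 := by
  have h1 := HasDerivAt.fun_sum (u := Finset.univ) fun (j : Fin n) _ =>
    (hasDerivAt_coord z (Pi.single i 1) j).fun_pow 2
  have h2 := (h1.fun_neg.div_const 2).exp
  simp only [zero_smul, add_zero] at h2
  convert! h2 using 1
  rw [gauss]
  simp [Pi.single_apply]
  ring

/-- The loop equations for the density `|Δ|^β e^{-∑ zᵢ²/2}`, away from `β = 1`, where `|Δ|` is not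
differentiable. -/
lemma loopEq_gaussVand_of_one_lt {β : ℝ} (hβ : 1 < β) (hβ2 : β ≤ 2) :
    LoopEq β n fun w => ∫ z : Fin n → ℝ, wordVal (fun l => ((pws z l : ℝ) : ℂ)) w *
      ((gaussVand β z : ℝ) : ℂ) := by
  have hg0 : Continuous (gauss : (Fin n → ℝ) → ℝ) := continuous_gauss
  have hm : Measurable (vand : (Fin n → ℝ) → ℝ) := continuous_vand.measurable
  -- The derivative of `|x|^β`, at most of the size of `|x|^{β-1}`, which is locally bounded.
  have hbd : ∀ x : ℝ, |β * |x| ^ (β - 2) * x| ≤ 2 * |x| ^ (β - 1) := fun x => by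
    rcases eq_or_ne x 0 with rfl | hx
    · simp [Real.zero_rpow (show β - 1 ≠ 0 by linarith)]
    · rw [abs_mul, abs_mul, abs_of_pos (by linarith : (0 : ℝ) < β),
        abs_of_nonneg (by positivity : (0 : ℝ) ≤ |x| ^ (β - 2)), mul_assoc,
        ← Real.rpow_add_one (abs_ne_zero.2 hx), show β - 2 + 1 = β - 1 by ring]
      gcongr
  have td : Tame fun z : Fin n → ℝ => ((β * |vand z| ^ (β - 2) * vand z : ℝ) : ℂ) := by
    refine Tame.of_le (by fun_prop)
      ((tame_const 2).mul (tame_abs_vand_rpow (q := β - 1) (by linarith) (by linarith))) fun z => ?_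
    have := hbd (vand z)
    rw [norm_mul, Complex.norm_real, Complex.norm_real, Real.norm_eq_abs,
      Real.norm_of_nonneg (by positivity)]
    simpa using this
  refine loopEq_of_fields (ι := Fin n) (d := fun i => Pi.single i 1)
    (T := fun l z => ((pws z l : ℝ) : ℂ))
    (φ := fun k i z => ((z i : ℝ) : ℂ) ^ k) (φ' := fun k i z => k * ((z i : ℝ) : ℂ) ^ (k - 1))
    (Y := fun i l z => ((z i : ℝ) : ℂ) ^ (l - 1)) (D := fun z => ((gaussVand β z : ℝ) : ℂ))
    (D' := fun i z => ((β * |vand z| ^ (β - 2) * vand z * dvand i z * gauss z +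
      |vand z| ^ β * (-z i * gauss z) : ℝ) : ℂ)) ?_ tame_pws
    (fun k i => (tame_coord i).pow k) (fun k i => (tame_const _).mul ((tame_coord i).pow _))
    (fun i l => (tame_coord i).pow _) (fun f hf => integrable_gaussVand (by linarith) hβ2 hf)
    ?_ ?_ ?_ ?_ ?_ ?_
  · intro z
    simp [pws]
  · intro i f hf
    have := ((hf.mul td).mul (tame_dvand i)).integrable_gauss (μ := volume)
      (G := fun z => ((gauss z : ℝ) : ℂ)) (by fun_prop) gauss_le
    have h2 := integrable_gaussVand (β := β) (by linarith) hβ2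
      (hf.mul ((tame_const (-1)).mul (tame_coord i)))
    refine (this.add h2).congr (Eventually.of_forall fun z => ?_)
    simp only [gaussVand, Pi.add_apply]
    push_cast
    ring
  · intro l i z
    have h1 := HasDerivAt.fun_sum (u := Finset.univ) fun (j : Fin n) _ =>
      (hasDerivAt_coord z (Pi.single i 1) j).fun_pow l
    have h2 := h1.ofReal_comp
    simp only [zero_smul, add_zero] at h2
    convert! h2 using 1
    simp [Pi.single_apply]
  · intro k i z
    have h1 := ((hasDerivAt_coord z (Pi.single i 1) i).fun_pow k).ofReal_comp
    simpa using h1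
  · intro i z
    have h1 := hasDerivAt_abs_rpow (vand (z + (0 : ℝ) • (Pi.single i 1 : Fin n → ℝ))) hβ
    have h2 := ((h1.comp (0 : ℝ) (hasDerivAt_vand z i)).fun_mul (hasDerivAt_gauss z i)).ofReal_comp
    simp only [zero_smul, add_zero, Function.comp_def] at h2
    exact h2
  · intro k z
    have hv : |vand z| ^ (β - 2) * vand z * vand z = |vand z| ^ β := by
      rcases eq_or_ne (vand z) 0 with h | h
      · simp [h, Real.zero_rpow (show β ≠ 0 by linarith)]
      · rw [mul_assoc, ← sq, ← sq_abs, ← Real.rpow_natCast, ← Real.rpow_add (abs_pos.2 h)]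
        norm_num
    have hs := sum_pow_mul_dvand k z
    have real : ∑ i, (k * z i ^ (k - 1) * gaussVand β z +
        z i ^ k * (β * |vand z| ^ (β - 2) * vand z * dvand i z * gauss z +
          |vand z| ^ β * (-z i * gauss z))) =
        (β / 2 * ∑ p ∈ Finset.range k, pws z p * pws z (k - 1 - p) +
          (1 - β / 2) * (k * pws z (k - 1)) - pws z (k + 1)) * gaussVand β z := by
      have e : ∀ i, k * z i ^ (k - 1) * gaussVand β z +
          z i ^ k * (β * |vand z| ^ (β - 2) * vand z * dvand i z * gauss z +
          |vand z| ^ β * (-z i * gauss z)) =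
          z i ^ (k - 1) * (k * gaussVand β z) + z i ^ k * dvand i z *
            (β * |vand z| ^ (β - 2) * vand z * gauss z) - z i ^ (k + 1) * gaussVand β z :=
        fun i => by
          rw [gaussVand]
          ring
      simp only [e, Finset.sum_sub_distrib, Finset.sum_add_distrib, ← Finset.sum_mul, hs]
      rw [show ∀ a : ℝ, a / 2 * vand z * (β * |vand z| ^ (β - 2) * vand z * gauss z) =
        a / 2 * β * ((|vand z| ^ (β - 2) * vand z * vand z) * gauss z) from fun a => by ring,
        hv]
      simp only [gaussVand, pws]
      ring
    have := congrArg ((↑) : ℝ → ℂ) real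
    push_cast at this ⊢
    exact this
  · intro k l z hl
    simp only [pws, Complex.ofReal_sum, Complex.ofReal_pow, ← pow_add]
    rw [show k + (l - 1) = k + l - 1 by omega]

/-- The loop equations for the density `|Δ|^β e^{-∑ zᵢ²/2}`; at `β = 1` they are obtained as a limit
from larger exponents. -/
theorem loopEq_gaussVand {β : ℝ} (hβ : 1 ≤ β) (hβ2 : β ≤ 2) :
    LoopEq β n fun w => ∫ z : Fin n → ℝ, wordVal (fun l => ((pws z l : ℝ) : ℂ)) w *
      ((gaussVand β z : ℝ) : ℂ) := by
  rcases hβ.lt_or_eq with h | rfl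
  · exact loopEq_gaussVand_of_one_lt h hβ2
  set A : ℝ → List ℕ → ℂ := fun β w =>
    ∫ z : Fin n → ℝ, wordVal (fun l => ((pws z l : ℝ) : ℂ)) w * ((gaussVand β z : ℝ) : ℂ) with hA
  have hev : ∀ᶠ β in 𝓝[>] (1 : ℝ), 1 < β ∧ β ≤ 2 :=
    (eventually_mem_nhdsWithin).and ((eventually_le_nhds (by norm_num)).filter_mono inf_le_left)
  have hm : Measurable (vand : (Fin n → ℝ) → ℝ) := continuous_vand.measurable
  have hg0 : Continuous (gauss : (Fin n → ℝ) → ℝ) := continuous_gauss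
  have lim : ∀ w, Tendsto (fun β => A β w) (𝓝[>] 1) (𝓝 (A 1 w)) := fun w => by
    have tw := Tame.wordVal (E := Fin n → ℝ) tame_pws w
    have mw := tw.1
    -- The densities for `1 < β ≤ 2` are dominated by the sum of those for `β = 0` and `β = 2`.
    have hb := (integrable_gaussVand (β := 0) le_rfl (by norm_num) tw).norm.add
      (integrable_gaussVand (β := 2) (by norm_num) le_rfl tw).norm
    refine tendsto_integral_filter_of_dominated_convergence _
      (Eventually.of_forall fun β => ?_) (hev.mono fun β hβ => Eventually.of_forall fun z => ?_)
      hb (Eventually.of_forall fun z => ?_)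
    · unfold gaussVand
      exact (mw.mul (by fun_prop)).aestronglyMeasurable
    · have h0 := gauss_pos z
      have h1 := abs_rpow_le (x := vand z) (q := β) (by linarith) hβ.2
      simp only [gaussVand, Pi.add_apply, norm_mul, Complex.norm_real, Real.norm_eq_abs,
        Real.rpow_zero, Real.rpow_two, one_mul, abs_of_pos h0, abs_pow, abs_abs]
      rw [← mul_add, abs_of_nonneg (by positivity : 0 ≤ |vand z| ^ β)]
      gcongr
      nlinarith
    · refine Tendsto.const_mul _ ?_
      refine (Complex.continuous_ofReal.tendsto _).comp ?_
      unfold gaussVand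
      refine Tendsto.mul_const _ ?_
      refine Tendsto.mono_left ?_ inf_le_left
      exact (Real.continuousAt_const_rpow' one_ne_zero).tendsto
  have limβ : Tendsto (fun β : ℝ => (β : ℂ)) (𝓝[>] 1) (𝓝 ((1 : ℝ) : ℂ)) :=
    (Complex.continuous_ofReal.tendsto _).mono_left inf_le_left
  have leib_lim : ∀ (k : ℕ) (w : List ℕ) (B : ℝ → List ℕ → ℂ) (B' : List ℕ → ℂ),
      (∀ v, Tendsto (fun β => B β v) (𝓝[>] 1) (𝓝 (B' v))) →
      Tendsto (fun β => leib k w (B β)) (𝓝[>] 1) (𝓝 (leib k w B')) := fun k w => by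
    induction w with
    | nil => exact fun B B' _ => tendsto_const_nhds
    | cons l w ih =>
      intro B B' h
      exact ((h _).const_mul _).add (ih (fun β v => B β (l :: v)) (fun v => B' (l :: v))
        fun v => h _)
  refine ⟨fun w => ?_, fun k w => ?_⟩
  · exact tendsto_nhds_unique_of_eventuallyEq (lim _) ((lim w).const_mul _)
      (hev.mono fun β hβ => (loopEq_gaussVand_of_one_lt hβ.1 hβ.2).zero w)
  · refine tendsto_nhds_unique_of_eventuallyEq (lim _) ?_
      (hev.mono fun β hβ => (loopEq_gaussVand_of_one_lt hβ.1 hβ.2).succ k w)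
    exact (((limβ.div_const 2).mul (tendsto_finsetSum _ fun p _ => lim _)).add
      ((tendsto_const_nhds.sub (limβ.div_const 2)).mul ((lim _).const_mul _))).add
      (leib_lim k w A (A 1) lim)

end TodaPfaff
end

/-! ### Eigenvalues of Hermitean matrices -/

noncomputable section

namespace TodaPfaff

lemma antitone_eq_of_prod_eq {N : ℕ} {u v : Fin N → ℝ} (hu : Antitone u) (hv : Antitone v)
    (h : ∀ m : ℕ, ∏ i, ((m : ℝ) - u i) = ∏ i, ((m : ℝ) - v i)) : u = v := by
  have key : ∀ w : Fin N → ℝ, (∏ i, (X - C (w i))).roots = Finset.univ.val.map w := fun w => by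
    rw [Finset.prod, ← Polynomial.roots_multiset_prod_X_sub_C (Finset.univ.val.map w),
      Multiset.map_map]
    rfl
  have hp : ∏ i, (X - C (u i)) = ∏ i, (X - C (v i)) := by
    refine Polynomial.eq_of_infinite_eval_eq _ _
      (Set.infinite_of_injective_forall_mem (f := fun m : ℕ => (m : ℝ)) Nat.cast_injective
        fun m => ?_)
    simpa [Polynomial.eval_prod] using h m
  have hm := congrArg Polynomial.roots hp
  rw [key, key, Fin.univ_val_map, Fin.univ_val_map, Multiset.coe_eq_coe] at hm
  refine List.ofFn_injective (hm.eq_of_pairwise (le := (· ≥ ·))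
    (fun a b _ _ h1 h2 => le_antisymm h2 h1) ?_ ?_)
  · exact List.pairwise_ofFn.2 fun i j hij => hu hij.le
  · exact List.pairwise_ofFn.2 fun i j hij => hv hij.le

/-- A decreasing vector depends measurably on the values of the polynomial whose roots are its
entries, by the Lusin–Souslin theorem. -/
lemma measurable_of_antitone {α : Type*} [MeasurableSpace α] {N : ℕ} {F : α → Fin N → ℝ}
    (hF : ∀ a, Antitone (F a)) (h : ∀ m : ℕ, Measurable fun a => ∏ i, ((m : ℝ) - F a i)) :
    Measurable F := by
  have hcl : IsClosed {v : Fin N → ℝ | Antitone v} := by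
    have : {v : Fin N → ℝ | Antitone v} = ⋂ i, ⋂ j, ⋂ (_ : i ≤ j), {v | v j ≤ v i} := by
      ext v
      simp only [Set.mem_ofPred_eq, Set.mem_iInter]
      rfl
    rw [this]
    exact isClosed_iInter fun i => isClosed_iInter fun j => isClosed_iInter fun _ =>
      isClosed_le (continuous_apply j) (continuous_apply i)
  have : PolishSpace {v : Fin N → ℝ // Antitone v} := hcl.polishSpace
  let P : {v : Fin N → ℝ // Antitone v} → ℕ → ℝ := fun v m => ∏ i, ((m : ℝ) - v.1 i)
  have hP : Continuous P := continuous_pi fun m => by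
    change Continuous fun v : {v : Fin N → ℝ // Antitone v} => ∏ i, ((m : ℝ) - v.1 i)
    exact continuous_finsetProd _ fun i _ => continuous_const.sub
      ((continuous_apply i).comp continuous_subtype_val)
  have hPi : Function.Injective P := fun u v huv =>
    Subtype.ext (antitone_eq_of_prod_eq u.2 v.2 fun m => congrFun huv m)
  have hemb := hP.measurableEmbedding hPi
  have hG : Measurable fun a => (⟨F a, hF a⟩ : {v : Fin N → ℝ // Antitone v}) := by
    rw [← hemb.measurable_comp_iff]
    exact measurable_pi_lambda _ h
  exact measurable_subtype_coe.comp hG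

section Hermitian

variable {n : ℕ} {A : Matrix (Fin n) (Fin n) ℂ} (hA : A.IsHermitian)
include hA

lemma trace_cfc (g : ℝ → ℝ) : (cfc g A).trace = ∑ i, ((g (hA.eigenvalues i) : ℝ) : ℂ) := by
  rw [hA.cfc_eq, Matrix.IsHermitian.cfc, Unitary.conjStarAlgAut_apply, Matrix.trace_mul_cycle]
  rw [Unitary.coe_star_mul_self, one_mul, Matrix.trace_diagonal]
  rfl

lemma trace_pow_eq (k : ℕ) : (A ^ k).trace = ((pws hA.eigenvalues k : ℝ) : ℂ) := by
  rw [← cfc_pow_id (R := ℝ) A k hA.isSelfAdjoint, trace_cfc hA, pws, Complex.ofReal_sum]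

lemma prod_eigenvalues₀ (m : ℕ) :
    ∏ i, ((m : ℝ) - hA.eigenvalues₀ i) = ((Matrix.scalar (Fin n) (m : ℂ) - A).det).re := by
  rw [← Matrix.eval_charpoly, hA.charpoly_eq, Polynomial.eval_prod]
  simp only [Polynomial.eval_sub, Polynomial.eval_X, Polynomial.eval_C]
  have e : ∏ i, ((m : ℂ) - ((hA.eigenvalues i : ℝ) : ℂ)) =
      ((∏ i, ((m : ℝ) - hA.eigenvalues i) : ℝ) : ℂ) := by push_cast; rfl
  erw [e]
  rw [Complex.ofReal_re]
  exact (Equiv.prod_comp (Fintype.equivOfCardEq (Fintype.card_fin _)).symm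
    fun i => (m : ℝ) - hA.eigenvalues₀ i).symm

lemma expTr_eq (V : ℝ → ℝ) (t : Times) : expTr V t A =
    ∏ i, Complex.exp (-(V (hA.eigenvalues i) : ℂ) + (xi t).eval ((hA.eigenvalues i : ℝ) : ℂ)) := by
  rw [expTr, ← Complex.exp_sum, Matrix.trace_add, Matrix.trace_neg, trace_cfc hA,
    Finset.sum_add_distrib, Finset.sum_neg_distrib]
  congr 2
  simp only [xi, Finsupp.sum, Polynomial.eval_finsetSum, Polynomial.eval_monomial]
  rw [Matrix.trace_sum, Finset.sum_comm]
  refine Finset.sum_congr rfl fun k _ => ?_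
  rw [Matrix.trace_smul, trace_pow_eq hA, pws, smul_eq_mul, Complex.ofReal_sum, Finset.mul_sum]
  simp only [Complex.ofReal_pow]

end Hermitian

/-! ### The Weyl integration formula -/

/-- A linear parametrization of a space of Hermitean matrices, with a family of directions whose
contractions show the repulsion exponent `β` of the eigenvalues. The directions `X_a`
form a tight frame for `Tr X²`, normalized by `∑ Tr(X_a Y) X_a = 4 Y`. -/
structure MatrixModel (β n : ℕ) (E : Type*) [NormedAddCommGroup E] [NormedSpace ℝ E] where
  mat : E →ₗ[ℝ] Matrix (Fin n) (Fin n) ℂ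
  isHermitian : ∀ c, (mat c).IsHermitian
  norm_sq_le : ∀ c, ‖c‖ ^ 2 ≤ (mat c * mat c).trace.re
  ι : Type
  fintype : Fintype ι
  dir : ι → E
  sum_trace_mul_trace : ∀ c k l,
    ∑ a, (mat (dir a) * mat c ^ k).trace * (mat (dir a) * mat c ^ l).trace =
      4 * (mat c ^ (k + l)).trace
  sum_trace_mul_mul_mul : ∀ c p q,
    ∑ a, (mat (dir a) * mat c ^ p * mat (dir a) * mat c ^ q).trace =
      4 * (β / 2 * ((mat c ^ p).trace * (mat c ^ q).trace) +
        (1 - β / 2) * (mat c ^ (p + q)).trace)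

lemma hasDerivAt_pow_entry {n : ℕ} (A D : Matrix (Fin n) (Fin n) ℂ) (k : ℕ) (i j : Fin n) :
    HasDerivAt (fun s : ℝ => ((A + s • D) ^ k) i j)
      ((∑ p ∈ Finset.range k, A ^ p * D * A ^ (k - 1 - p)) i j) 0 := by
  induction k generalizing i j with
  | zero => simpa using hasDerivAt_const (0 : ℝ) ((1 : Matrix (Fin n) (Fin n) ℂ) i j)
  | succ k ih =>
    have h1 : ∀ m, HasDerivAt (fun s : ℝ => (A + s • D) m j) (D m j) 0 := fun m => by
      simpa using ((hasDerivAt_id (0 : ℝ)).smul_const (D m j)).const_add (A m j)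
    have h2 := HasDerivAt.fun_sum (u := Finset.univ) fun (m : Fin n) _ => (ih i m).fun_mul (h1 m)
    simp only [zero_smul, add_zero] at h2
    simp only [pow_succ, Matrix.mul_apply]
    convert! h2 using 1
    rw [Finset.sum_add_distrib, ← Matrix.mul_apply, ← Matrix.mul_apply, ← Matrix.add_apply]
    rw [Finset.sum_range_succ, Finset.sum_mul, Nat.add_sub_cancel, Nat.sub_self, pow_zero, mul_one,
      Finset.sum_congr rfl fun p hp => show A ^ p * D * A ^ (k - p) =
        A ^ p * D * A ^ (k - 1 - p) * A by
          rw [Finset.mem_range] at hp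
          rw [mul_assoc _ _ A, ← pow_succ, show k - 1 - p + 1 = k - p by omega]]

lemma hasDerivAt_trace_mul_pow {n : ℕ} (A D B : Matrix (Fin n) (Fin n) ℂ) (k : ℕ) :
    HasDerivAt (fun s : ℝ => (B * (A + s • D) ^ k).trace)
      (∑ p ∈ Finset.range k, (B * (A ^ p * D * A ^ (k - 1 - p))).trace) 0 := by
  rw [← Matrix.trace_sum (Finset.range k), ← Finset.mul_sum]
  simp only [Matrix.trace, Matrix.diag_apply, Matrix.mul_apply]
  exact HasDerivAt.fun_sum fun i _ => HasDerivAt.fun_sum fun j _ =>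
    (hasDerivAt_pow_entry A D k j i).const_mul _

namespace MatrixModel

variable {β n : ℕ} {E : Type*} [NormedAddCommGroup E] [NormedSpace ℝ E] (M : MatrixModel β n E)

instance : Fintype M.ι := M.fintype

/-- The eigenvalues, in decreasing order. -/
def eig (c : E) : Fin n → ℝ := (M.isHermitian c).eigenvalues

variable [FiniteDimensional ℝ E]

lemma continuous_mat : Continuous M.mat := M.mat.continuous_of_finiteDimensional

variable [MeasurableSpace E] [BorelSpace E]

lemma measurable_eig : Measurable M.eig := by
  have h : Measurable fun c => (M.isHermitian c).eigenvalues₀ := by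
    refine measurable_of_antitone (fun c => (M.isHermitian c).eigenvalues₀_antitone) fun m => ?_
    simp only [prod_eigenvalues₀]
    have := M.continuous_mat
    exact (Complex.continuous_re.comp (Continuous.matrix_det (by fun_prop))).measurable
  exact measurable_pi_lambda _ fun i => (measurable_pi_apply
    ((Fintype.equivOfCardEq (Fintype.card_fin _)).symm i)).comp h

omit [MeasurableSpace E] [BorelSpace E] in
lemma continuous_entry (i j : Fin n) : Continuous fun c => M.mat c i j :=
  (continuous_apply j).comp ((continuous_apply i).comp M.continuous_mat)

omit [MeasurableSpace E] [BorelSpace E] in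
lemma exists_norm_entry_le (i j : Fin n) : ∃ K, 0 ≤ K ∧ ∀ c, ‖M.mat c i j‖ ≤ K * ‖c‖ := by
  let L : E →L[ℝ] ℂ :=
    { toFun := fun c => M.mat c i j
      map_add' := fun _ _ => by simp
      map_smul' := fun _ _ => by simp
      cont := M.continuous_entry i j }
  exact ⟨‖L‖, norm_nonneg _, fun c => L.le_opNorm c⟩

lemma tame_entry (i j : Fin n) : Tame fun c => M.mat c i j := by
  obtain ⟨K, hK, h⟩ := M.exists_norm_entry_le i j
  refine ⟨(M.continuous_entry i j).measurable, K + 1, by positivity, fun c => (h c).trans ?_⟩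
  have h1 : ‖c‖ ≤ Real.exp ((K + 1) * ‖c‖) := by
    refine le_trans ?_ (Real.add_one_le_exp _)
    nlinarith [mul_nonneg hK (norm_nonneg c)]
  exact mul_le_mul (by linarith) h1 (norm_nonneg _) (by positivity)

lemma tame_pow_entry (k : ℕ) (i j : Fin n) : Tame fun c => (M.mat c ^ k) i j := by
  induction k generalizing i j with
  | zero =>
    simp only [pow_zero]
    exact tame_const _
  | succ k ih =>
    simp only [pow_succ, Matrix.mul_apply]
    exact Tame.sum fun m _ => (ih i m).mul (M.tame_entry m j)

lemma tame_trace_mul (B : Matrix (Fin n) (Fin n) ℂ) (k : ℕ) :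
    Tame fun c => (B * M.mat c ^ k).trace := by
  simp only [Matrix.trace, Matrix.diag_apply, Matrix.mul_apply]
  exact Tame.sum fun i _ => Tame.sum fun j _ => (tame_const _).mul (M.tame_pow_entry k j i)

lemma tame_trace_mul_mul (B : Matrix (Fin n) (Fin n) ℂ) (p q : ℕ) :
    Tame fun c => (B * M.mat c ^ p * B * M.mat c ^ q).trace := by
  have e : ∀ c, (B * M.mat c ^ p * B * M.mat c ^ q).trace =
      ∑ i, ∑ j, (∑ l, (∑ m, B i m * (M.mat c ^ p) m l) * B l j) * (M.mat c ^ q) j i := fun c => by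
    simp only [Matrix.trace, Matrix.diag_apply, Matrix.mul_apply]
  simp only [e]
  exact Tame.sum fun i _ => Tame.sum fun j _ => (Tame.sum fun l _ => (Tame.sum fun m _ =>
    (tame_const _).mul (M.tame_pow_entry p m l)).mul (tame_const _)).mul (M.tame_pow_entry q j i)

/-- The Gaussian density `e^{-Tr X²/2}`. -/
def gaussTr (c : E) : ℂ := Complex.exp (-(M.mat c ^ 2).trace / 2)

omit [FiniteDimensional ℝ E] [MeasurableSpace E] [BorelSpace E] in
lemma gaussTr_eq (c : E) : M.gaussTr c = ((gauss (M.eig c) : ℝ) : ℂ) := by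
  rw [gaussTr, trace_pow_eq (M.isHermitian c), gauss, Complex.ofReal_exp, pws, eig]
  push_cast
  rfl

omit [FiniteDimensional ℝ E] [MeasurableSpace E] [BorelSpace E] in
lemma norm_gaussTr_le (c : E) : ‖M.gaussTr c‖ ≤ Real.exp (-‖c‖ ^ 2 / 2) := by
  rw [gaussTr, Complex.norm_exp]
  have h := M.norm_sq_le c
  rw [← sq] at h
  refine Real.exp_le_exp.2 ?_
  have e : (-(M.mat c ^ 2).trace / 2).re = -(M.mat c ^ 2).trace.re / 2 := by simp
  rw [e]
  linarith

lemma measurable_gaussTr : Measurable M.gaussTr := by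
  have := M.continuous_mat
  unfold gaussTr
  exact (Complex.continuous_exp.comp
    ((Continuous.matrix_trace (by fun_prop)).neg.div_const 2)).measurable

variable {μ : Measure E} [μ.IsAddHaarMeasure]

lemma integrable_gaussTr {f : E → ℂ} (hf : Tame f) :
    Integrable (fun c => f c * M.gaussTr c) μ :=
  hf.integrable_gauss M.measurable_gaussTr M.norm_gaussTr_le

theorem loopEq : LoopEq β n fun w =>
    ∫ c, wordVal (fun l => (M.mat c ^ l).trace) w * M.gaussTr c ∂μ := by
  have tT : ∀ l, Tame fun c => (M.mat c ^ l).trace := fun l => by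
    simpa using M.tame_trace_mul 1 l
  have dT : ∀ (l : ℕ) a c, HasDerivAt (fun s : ℝ => (M.mat (c + s • M.dir a) ^ l).trace)
      (l * (M.mat (M.dir a) * M.mat c ^ (l - 1)).trace) 0 := fun l a c => by
    have h := hasDerivAt_trace_mul_pow (M.mat c) (M.mat (M.dir a)) 1 l
    simp only [one_mul] at h
    simp only [map_add, map_smul]
    convert! h using 1
    rw [Finset.sum_congr rfl fun p hp => show (M.mat c ^ p * M.mat (M.dir a) *
      M.mat c ^ (l - 1 - p)).trace = (M.mat (M.dir a) * M.mat c ^ (l - 1)).trace by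
        rw [Finset.mem_range] at hp
        rw [mul_assoc, Matrix.trace_mul_comm, mul_assoc, ← pow_add,
          show l - 1 - p + p = l - 1 by omega]]
    simp
  -- In coordinates, the vector field `X ↦ Xᵏ` is the sum of `¼ Tr(X_a Xᵏ) X_a` over the directions.
  refine loopEq_of_fields (ι := M.ι) (d := M.dir) (T := fun l c => (M.mat c ^ l).trace)
    (φ := fun k a c => (1 / 4) * (M.mat (M.dir a) * M.mat c ^ k).trace)
    (φ' := fun k a c => (1 / 4) * ∑ p ∈ Finset.range k,
      (M.mat (M.dir a) * M.mat c ^ p * M.mat (M.dir a) * M.mat c ^ (k - 1 - p)).trace)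
    (Y := fun a l c => (M.mat (M.dir a) * M.mat c ^ (l - 1)).trace) (D := M.gaussTr)
    (D' := fun a c => -(M.mat (M.dir a) * M.mat c ^ 1).trace * M.gaussTr c)
    (by simp) tT (fun k a => (tame_const _).mul (M.tame_trace_mul _ _))
    (fun k a => (tame_const _).mul (Tame.sum fun p _ => M.tame_trace_mul_mul _ _ _))
    (fun a l => M.tame_trace_mul _ _) (fun f hf => M.integrable_gaussTr hf) ?_ dT ?_ ?_ ?_ ?_
  · intro a f hf
    refine (M.integrable_gaussTr (μ := μ) (hf.mul ((tame_const (-1)).mul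
      (M.tame_trace_mul (M.mat (M.dir a)) 1)))).congr (Eventually.of_forall fun c => ?_)
    simp only
    ring
  · intro k a c
    simp only [map_add, map_smul]
    have h := hasDerivAt_trace_mul_pow (M.mat c) (M.mat (M.dir a)) (M.mat (M.dir a)) k
    simpa only [mul_assoc] using h.const_mul (1 / 4)
  · intro a c
    have h := ((dT 2 a c).neg.div_const 2).cexp
    simp only [zero_smul, add_zero, Pi.neg_apply] at h
    convert! h using 1
    rw [gaussTr]
    push_cast
    ring
  · intro k c
    have e : ∀ a, (1 / 4 : ℂ) * ∑ p ∈ Finset.range k,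
        (M.mat (M.dir a) * M.mat c ^ p * M.mat (M.dir a) * M.mat c ^ (k - 1 - p)).trace *
          M.gaussTr c + 1 / 4 * (M.mat (M.dir a) * M.mat c ^ k).trace *
          (-(M.mat (M.dir a) * M.mat c ^ 1).trace * M.gaussTr c) =
        (∑ p ∈ Finset.range k,
        (M.mat (M.dir a) * M.mat c ^ p * M.mat (M.dir a) * M.mat c ^ (k - 1 - p)).trace -
          (M.mat (M.dir a) * M.mat c ^ k).trace * (M.mat (M.dir a) * M.mat c ^ 1).trace) *
          (1 / 4 * M.gaussTr c) := fun a => by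
      rw [← Finset.sum_mul]
      ring
    have e' := Finset.sum_congr (rfl : (Finset.univ : Finset M.ι) = _) fun a _ => e a
    simp only [← Finset.sum_mul, mul_assoc] at e' ⊢
    rw [e']
    rw [Finset.sum_sub_distrib]
    have e2 := M.sum_trace_mul_trace c k 1
    have e3 := M.sum_trace_mul_mul_mul c
    simp only [mul_assoc] at e2 e3
    rw [e2, Finset.sum_comm, Finset.sum_congr rfl fun p _ => e3 p (k - 1 - p),
      ← Finset.mul_sum, Finset.sum_add_distrib, ← Finset.mul_sum, ← Finset.mul_sum,
      Finset.sum_congr rfl fun p hp => show (M.mat c ^ (p + (k - 1 - p))).trace =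
        (M.mat c ^ (k - 1)).trace by
          rw [Finset.mem_range] at hp
          rw [show p + (k - 1 - p) = k - 1 by omega]]
    simp only [Finset.sum_const, Finset.card_range, nsmul_eq_mul, Complex.ofReal_natCast]
    ring
  · intro k l c hl
    simp only [mul_assoc, ← Finset.mul_sum]
    rw [M.sum_trace_mul_trace, show k + (l - 1) = k + l - 1 by omega]
    ring

end MatrixModel

end TodaPfaff
end

noncomputable section

namespace TodaPfaff

section Density

variable {α : Type*} [MeasurableSpace α] {m : Measure α} {r : α → ℝ}

lemma integral_withDensity_ofReal (hr : Measurable r) (h0 : ∀ x, 0 ≤ r x) (f : α → ℝ) :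
    ∫ x, f x ∂(m.withDensity fun x => ENNReal.ofReal (r x)) = ∫ x, r x * f x ∂m := by
  rw [integral_withDensity_eq_integral_toReal_smul (by fun_prop)
    (Eventually.of_forall fun _ => ENNReal.ofReal_lt_top)]
  exact integral_congr_ae (Eventually.of_forall fun x => by
    simp only [ENNReal.toReal_ofReal (h0 x), smul_eq_mul])

lemma integrable_withDensity_ofReal (hr : Measurable r) (h0 : ∀ x, 0 ≤ r x) (f : α → ℝ) :
    Integrable f (m.withDensity fun x => ENNReal.ofReal (r x)) ↔
      Integrable (fun x => r x * f x) m := by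
  rw [integrable_withDensity_iff_integrable_smul' (by fun_prop)
    (Eventually.of_forall fun _ => ENNReal.ofReal_lt_top)]
  simp only [ENNReal.toReal_ofReal (h0 _), smul_eq_mul]

end Density

lemma ofReal_wordVal {n : ℕ} (z : Fin n → ℝ) (w : List ℕ) :
    ((wordVal (pws z) w : ℝ) : ℂ) = wordVal (fun l => ((pws z l : ℝ) : ℂ)) w := by
  induction w with
  | nil => simp [wordVal]
  | cons l w ih => rw [wordVal_cons, wordVal_cons, Complex.ofReal_mul, ih]

section Symmetric

variable {n : ℕ} {μ ν : Measure (Fin n → ℝ)}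

lemma measurable_comp_perm (σ : Equiv.Perm (Fin n)) :
    Measurable fun z : Fin n → ℝ => z ∘ σ :=
  measurable_pi_lambda _ fun _ => measurable_pi_apply _

lemma lintegral_sum_map_perm {F : (Fin n → ℝ) → ENNReal} (hF : Measurable F)
    (hs : ∀ (σ : Equiv.Perm (Fin n)) z, F (z ∘ σ) = F z) :
    ∫⁻ z, F z ∂(∑ σ : Equiv.Perm (Fin n), μ.map fun z => z ∘ σ) =
      (n.factorial : ENNReal) * ∫⁻ z, F z ∂μ := by
  rw [lintegral_finsetSum_measure]
  have : ∀ σ : Equiv.Perm (Fin n), ∫⁻ z, F z ∂(μ.map fun z => z ∘ σ) = ∫⁻ z, F z ∂μ := fun σ => by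
    rw [lintegral_map hF (measurable_comp_perm σ)]
    simp only [hs]
  simp [this, Fintype.card_perm]

/-- Measures with equal integrals of symmetric functions have equal symmetrizations. -/
lemma sum_map_perm_congr
    (h : ∀ F : (Fin n → ℝ) → ENNReal, Measurable F →
      (∀ (σ : Equiv.Perm (Fin n)) z, F (z ∘ σ) = F z) → ∫⁻ z, F z ∂μ = ∫⁻ z, F z ∂ν) :
    ∑ σ : Equiv.Perm (Fin n), μ.map (fun z => z ∘ σ) =
      ∑ σ : Equiv.Perm (Fin n), ν.map fun z => z ∘ σ := by
  refine Measure.ext fun s hs => ?_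
  have key : ∀ m : Measure (Fin n → ℝ), (∑ σ : Equiv.Perm (Fin n), m.map (fun z => z ∘ σ)) s =
      ∫⁻ z, ∑ σ : Equiv.Perm (Fin n), s.indicator 1 (z ∘ σ) ∂m := fun m => by
    have hi : ∀ σ : Equiv.Perm (Fin n), Measurable fun z : Fin n → ℝ =>
        s.indicator (1 : (Fin n → ℝ) → ENNReal) (z ∘ σ) := fun σ =>
      (measurable_one.indicator hs).comp (measurable_comp_perm σ)
    rw [lintegral_finsetSum _ fun σ _ => hi σ, Measure.finsetSum_apply]
    refine Finset.sum_congr rfl fun σ _ => ?_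
    rw [← lintegral_map (measurable_one.indicator hs) (measurable_comp_perm σ),
      lintegral_indicator_one hs]
  rw [key, key]
  refine h _ (Finset.measurable_sum _ fun σ _ =>
    (measurable_one.indicator hs).comp (measurable_comp_perm σ)) fun τ z => ?_
  exact Equiv.sum_comp (Equiv.mulLeft τ) fun σ => s.indicator 1 (z ∘ σ)

lemma integral_eq_of_lintegral_symmetric
    (h : ∀ F : (Fin n → ℝ) → ENNReal, Measurable F →
      (∀ (σ : Equiv.Perm (Fin n)) z, F (z ∘ σ) = F z) → ∫⁻ z, F z ∂μ = ∫⁻ z, F z ∂ν)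
    {f : (Fin n → ℝ) → ℂ} (hf : Measurable f)
    (hs : ∀ (σ : Equiv.Perm (Fin n)) z, f (z ∘ σ) = f z) (hint : Integrable f ν) :
    Integrable f μ ∧ ∫ z, f z ∂μ = ∫ z, f z ∂ν := by
  have h1 : Integrable f μ := by
    refine ⟨hf.aestronglyMeasurable, ?_⟩
    have e := h (fun z => ‖f z‖ₑ) (by fun_prop) fun σ z => by rw [hs]
    have := hint.2
    rw [HasFiniteIntegral] at this ⊢
    rwa [e]
  refine ⟨h1, ?_⟩
  have key : ∀ m : Measure (Fin n → ℝ), Integrable f m →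
      ∫ z, f z ∂(∑ σ : Equiv.Perm (Fin n), m.map fun z => z ∘ σ) =
        (n.factorial : ℂ) * ∫ z, f z ∂m := fun m hm => by
    have hi : ∀ σ : Equiv.Perm (Fin n), Integrable f (m.map fun z => z ∘ σ) := fun σ => by
      rw [integrable_map_measure hf.aestronglyMeasurable (measurable_comp_perm σ).aemeasurable]
      exact hm.congr (Eventually.of_forall fun z => (hs σ z).symm)
    rw [integral_finsetSum_measure fun σ _ => hi σ]
    have : ∀ σ : Equiv.Perm (Fin n), ∫ z, f z ∂(m.map fun z => z ∘ σ) = ∫ z, f z ∂m := fun σ => by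
      rw [integral_map (measurable_comp_perm σ).aemeasurable hf.aestronglyMeasurable]
      simp only [hs]
    simp [this, Fintype.card_perm]
  have e := key μ h1
  rw [sum_map_perm_congr h, key ν hint] at e
  exact (mul_left_cancel₀ (by exact_mod_cast n.factorial_ne_zero) e).symm

end Symmetric

namespace MatrixModel

variable {β n : ℕ} {E : Type*} [NormedAddCommGroup E] [NormedSpace ℝ E] (M : MatrixModel β n E)
  [FiniteDimensional ℝ E] [MeasurableSpace E] [BorelSpace E] {μ : Measure E} [μ.IsAddHaarMeasure]

omit [MeasurableSpace E] [BorelSpace E] in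
lemma exists_norm_eig_le : ∃ K, 0 ≤ K ∧ ∀ x, ‖M.eig x‖ ≤ K * ‖x‖ := by
  choose K hK0 hK using fun i j => M.exists_norm_entry_le i j
  set S : ℝ := ∑ i, ∑ j, K i j * K j i with hS
  have hS0 : 0 ≤ S := Finset.sum_nonneg fun i _ => Finset.sum_nonneg fun j _ =>
    mul_nonneg (hK0 i j) (hK0 j i)
  refine ⟨√S, Real.sqrt_nonneg _, fun x => ?_⟩
  refine (pow_le_pow_iff_left₀ (norm_nonneg _) (by positivity) two_ne_zero).1 ?_
  rw [mul_pow, Real.sq_sqrt hS0]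
  refine (norm_sq_le_sum _).trans ?_
  have h2 : ∑ i, M.eig x i ^ 2 = ‖(M.mat x ^ 2).trace‖ := by
    rw [trace_pow_eq (M.isHermitian x), Complex.norm_real, Real.norm_of_nonneg]
    · rfl
    · exact Finset.sum_nonneg fun i _ => sq_nonneg _
  rw [h2, sq, hS, Finset.sum_mul]
  simp only [Matrix.trace, Matrix.diag_apply, Matrix.mul_apply]
  refine (norm_sum_le _ _).trans (Finset.sum_le_sum fun i _ => ?_)
  rw [Finset.sum_mul]
  refine (norm_sum_le _ _).trans (Finset.sum_le_sum fun j _ => ?_)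
  rw [norm_mul]
  calc ‖M.mat x i j‖ * ‖M.mat x j i‖ ≤ (K i j * ‖x‖) * (K j i * ‖x‖) :=
        mul_le_mul (hK i j x) (hK j i x) (norm_nonneg _) (mul_nonneg (hK0 i j) (norm_nonneg _))
    _ = _ := by ring

/-- The Weyl integration formula up to the normalization: symmetric functions of the eigenvalues are
integrated with the density `|Δ|^β`. -/
lemma exists_lintegral_eig (hβ1 : 1 ≤ β) (hβ2 : β ≤ 2) : ∃ c : ℝ, ∀ F : (Fin n → ℝ) → ENNReal,
    Measurable F → (∀ (σ : Equiv.Perm (Fin n)) z, F (z ∘ σ) = F z) →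
    ∫⁻ x, F (M.eig x) ∂μ = ENNReal.ofReal c * ∫⁻ z, F z * ENNReal.ofReal (|vand z| ^ β) := by
  have hβ1' : (1 : ℝ) ≤ (β : ℝ) := by exact_mod_cast hβ1
  have hβ2' : (β : ℝ) ≤ 2 := by exact_mod_cast hβ2
  have hβ0' : (0 : ℝ) ≤ (β : ℝ) := by linarith
  have hme := M.measurable_eig
  have mv : Measurable (vand : (Fin n → ℝ) → ℝ) := continuous_vand.measurable
  have mg : Measurable (gauss : (Fin n → ℝ) → ℝ) := continuous_gauss.measurable
  have mgv : Measurable (gaussVand β : (Fin n → ℝ) → ℝ) := by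
    unfold gaussVand
    fun_prop
  have hgv0 : ∀ z : Fin n → ℝ, 0 ≤ gaussVand β z := fun z =>
    mul_nonneg (by positivity) (gauss_pos z).le
  set ρ : Measure E := μ.withDensity fun x => ENNReal.ofReal (gauss (M.eig x)) with hρ
  set ν : Measure (Fin n → ℝ) :=
    volume.withDensity fun z => ENNReal.ofReal (gaussVand β z) with hν
  -- Tame functions of the eigenvalues are integrable on both sides.
  have iν : ∀ f : (Fin n → ℝ) → ℝ, Tame (fun z => ((f z : ℝ) : ℂ)) → Integrable f ν :=
      fun f hf => by
    rw [hν, integrable_withDensity_ofReal mgv hgv0]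
    have := (integrable_gaussVand hβ0' hβ2' hf).re
    simpa [mul_comm] using this
  have tword : ∀ w, Tame fun z : Fin n → ℝ => ((wordVal (pws z) w : ℝ) : ℂ) := fun w => by
    simp only [ofReal_wordVal]
    exact Tame.wordVal tame_pws w
  have eword : ∀ w x, ((wordVal (pws (M.eig x)) w : ℝ) : ℂ) =
      wordVal (fun l => (M.mat x ^ l).trace) w := fun w x => by
    rw [ofReal_wordVal]
    congr 1
    funext l
    rw [trace_pow_eq (M.isHermitian x), eig]
  have iμ : ∀ f : (Fin n → ℝ) → ℝ, Measurable f →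
      Integrable (fun x => f (M.eig x) * gauss (M.eig x)) μ → Integrable f (ρ.map M.eig) :=
    fun f mf hf => by
      rw [integrable_map_measure mf.aestronglyMeasurable hme.aemeasurable, hρ,
        integrable_withDensity_ofReal (r := fun x => gauss (M.eig x)) (mg.comp hme)
          fun x => (gauss_pos _).le]
      exact hf.congr (Eventually.of_forall fun x => mul_comm _ _)
  have iμw : ∀ w, Integrable (fun z => wordVal (pws z) w) (ρ.map M.eig) := fun w => by
    refine iμ _ (Complex.measurable_re.comp (tword w).1) ?_
    have tT : ∀ l, Tame fun c => (M.mat c ^ l).trace := fun l => by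
      simpa using M.tame_trace_mul 1 l
    have := (M.integrable_gaussTr (μ := μ) (Tame.wordVal tT w)).re
    refine this.congr (Eventually.of_forall fun x => ?_)
    simp only [← eword, gaussTr_eq, ← Complex.ofReal_mul]
    exact Complex.ofReal_re _
  have hμe : ∀ C : ℝ, Integrable (fun z => Real.exp (C * ‖z‖)) (ρ.map M.eig) := fun C => by
    obtain ⟨K, hK0, hK⟩ := M.exists_norm_eig_le
    refine iμ _ (by fun_prop) ?_
    have tt : Tame fun x => ((Real.exp (C * ‖M.eig x‖) : ℝ) : ℂ) := by
      refine Tame.of_le (by fun_prop) (tame_exp (|C| * K)) fun x => ?_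
      rw [Complex.norm_real, Complex.norm_real, Real.norm_of_nonneg (Real.exp_pos _).le,
        Real.norm_of_nonneg (Real.exp_pos _).le]
      refine Real.exp_le_exp.2 ?_
      calc C * ‖M.eig x‖ ≤ |C| * (K * ‖x‖) :=
            mul_le_mul (le_abs_self C) (hK x) (norm_nonneg _) (abs_nonneg _)
        _ = _ := by ring
    refine (M.integrable_gaussTr (μ := μ) tt).re.congr (Eventually.of_forall fun x => ?_)
    simp only [gaussTr_eq, ← Complex.ofReal_mul]
    exact Complex.ofReal_re _
  have hνe : ∀ C : ℝ, Integrable (fun z => Real.exp (C * ‖z‖)) ν := fun C => iν _ (tame_exp C)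
  have fin1 : IsFiniteMeasure (ρ.map M.eig) := by
    have := hμe 0
    simp only [zero_mul, Real.exp_zero] at this
    exact (integrable_const_iff_isFiniteMeasure one_ne_zero).1 this
  have fin2 : IsFiniteMeasure ν := by
    have := hνe 0
    simp only [zero_mul, Real.exp_zero] at this
    exact (integrable_const_iff_isFiniteMeasure one_ne_zero).1 this
  have e1 : ∀ w, ((∫ z, wordVal (pws z) w ∂(ρ.map M.eig) : ℝ) : ℂ) =
      ∫ x, wordVal (fun l => (M.mat x ^ l).trace) w * M.gaussTr x ∂μ := fun w => by
    rw [integral_map hme.aemeasurable (iμw w).1, hρ,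
      integral_withDensity_ofReal (r := fun x => gauss (M.eig x)) (mg.comp hme)
        fun x => (gauss_pos _).le]
    refine (integral_ofReal (𝕜 := ℂ)).symm.trans
      (integral_congr_ae <| Eventually.of_forall fun x => ?_)
    simp only [← eword, gaussTr_eq, Complex.coe_algebraMap, Complex.ofReal_mul]
    exact mul_comm _ _
  have e2 : ∀ w, ((∫ z, wordVal (pws z) w ∂ν : ℝ) : ℂ) =
      ∫ z : Fin n → ℝ, wordVal (fun l => ((pws z l : ℝ) : ℂ)) w * ((gaussVand β z : ℝ) : ℂ) :=
    fun w => by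
      rw [hν, integral_withDensity_ofReal mgv hgv0]
      refine (integral_ofReal (𝕜 := ℂ)).symm.trans
        (integral_congr_ae <| Eventually.of_forall fun x => ?_)
      simp only [← ofReal_wordVal, Complex.coe_algebraMap, Complex.ofReal_mul]
      exact mul_comm _ _
  have hB : 0 < ∫ z, wordVal (pws z) [] ∂ν := by
    have hi := (integrable_gaussVand (n := n) hβ0' hβ2' (tame_const 1)).re
    have hg : ∀ z : Fin n → ℝ, gaussVand β z =
        |vand z| ^ β * ∏ i, Real.exp (-(z i) ^ 2 / 2) := fun z => by
      rw [gaussVand, Real.rpow_natCast, gauss, ← Real.exp_sum]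
      congr 2
      rw [← Finset.sum_div, Finset.sum_neg_distrib]
    rw [hν, integral_withDensity_ofReal mgv hgv0]
    simp only [wordVal, List.map_nil, List.prod_nil, mul_one, hg]
    refine integral_vand_pos β (r := fun x => Real.exp (-x ^ 2 / 2)) isOpen_univ
      Set.univ_nonempty (fun _ => (Real.exp_pos _).le) (fun _ _ => Real.exp_pos _) ?_
    refine hi.congr (Eventually.of_forall fun z => ?_)
    simp only [one_mul, ← hg]
    exact Complex.ofReal_re _
  -- The ratio of the total masses.
  set c : ℝ := (∫ z, wordVal (pws z) [] ∂(ρ.map M.eig)) / ∫ z, wordVal (pws z) [] ∂ν with hc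
  have hc0 : 0 ≤ c := div_nonneg (integral_nonneg fun z => by simp [wordVal]) hB.le
  have hw : ∀ w, ∫ z, wordVal (pws z) w ∂(ρ.map M.eig) = c * ∫ z, wordVal (pws z) w ∂ν :=
    fun w => by
      have := LoopEq.unique (M.loopEq (μ := μ)) (loopEq_gaussVand hβ1' hβ2') (c := (c : ℂ))
        (by rw [← e1, ← e2, ← Complex.ofReal_mul, hc, div_mul_cancel₀ _ hB.ne']) w
      rw [← e1, ← e2, ← Complex.ofReal_mul] at this
      exact_mod_cast this
  have hsum := sum_map_perm_eq hc0 hμe hνe iμw (fun w => iν _ (tword w)) hw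
  refine ⟨c, fun F hF hs => ?_⟩
  -- The Gaussian is divided out.
  have mG : Measurable fun z : Fin n → ℝ => F z * ENNReal.ofReal (gauss z)⁻¹ := by fun_prop
  have sG : ∀ (σ : Equiv.Perm (Fin n)) z, F (z ∘ σ) * ENNReal.ofReal (gauss (z ∘ σ))⁻¹ =
      F z * ENNReal.ofReal (gauss z)⁻¹ := fun σ z => by
    have : gauss (z ∘ σ) = gauss z := by
      rw [gauss, gauss]
      congr 3
      exact Equiv.sum_comp σ fun i => z i ^ 2
    rw [hs, this]
  have h := congrArg (fun m => ∫⁻ z, F z * ENNReal.ofReal (gauss z)⁻¹ ∂m) hsum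
  simp only [lintegral_smul_measure, lintegral_sum_map_perm mG sG] at h
  rw [smul_eq_mul, mul_left_comm, ENNReal.mul_right_inj (by simpa using n.factorial_ne_zero)
    (by simp), lintegral_map mG hme, hρ, hν, lintegral_withDensity_eq_lintegral_mul _
    (by fun_prop) (g := fun x => F (M.eig x) * ENNReal.ofReal (gauss (M.eig x))⁻¹) (mG.comp hme),
    lintegral_withDensity_eq_lintegral_mul _ (by fun_prop) mG] at h
  have cancel : ∀ z : Fin n → ℝ, ENNReal.ofReal (gauss z) * ENNReal.ofReal (gauss z)⁻¹ = 1 :=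
    fun z => by
      rw [← ENNReal.ofReal_mul (gauss_pos z).le, mul_inv_cancel₀ (gauss_pos z).ne',
        ENNReal.ofReal_one]
  refine Eq.trans ?_ (h.trans ?_)
  · refine lintegral_congr fun x => ?_
    simp only [Pi.mul_apply]
    rw [mul_left_comm, cancel, mul_one]
  · congr 1
    refine lintegral_congr fun z => ?_
    simp only [Pi.mul_apply, gaussVand, Real.rpow_natCast]
    rw [ENNReal.ofReal_mul (by positivity), mul_assoc, mul_left_comm (ENNReal.ofReal (gauss z)),
      cancel, mul_one, mul_comm]

/-- The mass of the ball `Tr X² ≤ 1` identifies the constant. -/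
theorem lintegral_eig (hβ1 : 1 ≤ β) (hβ2 : β ≤ 2) {F : (Fin n → ℝ) → ENNReal}
    (hF : Measurable F) (hs : ∀ (σ : Equiv.Perm (Fin n)) z, F (z ∘ σ) = F z) :
    ∫⁻ x, F (M.eig x) ∂(ENNReal.ofReal (radialMass β n /
      μ.real {c | (M.mat c * M.mat c).trace.re ≤ 1}) • μ) =
      ∫⁻ z, F z * ENNReal.ofReal (|vand z| ^ β) := by
  obtain ⟨c, hc⟩ := M.exists_lintegral_eig (μ := μ) hβ1 hβ2
  have hcm := M.continuous_mat
  have htr : Continuous fun x => (M.mat x * M.mat x).trace.re :=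
    Complex.continuous_re.comp (Continuous.matrix_trace (by fun_prop))
  set B : Set (Fin n → ℝ) := {z | ∑ i, z i ^ 2 ≤ 1} with hB
  have hBc : IsClosed B := isClosed_le (by fun_prop) continuous_const
  have hBk : IsCompact B := by
    refine Metric.isCompact_of_isClosed_isBounded hBc (isBounded_iff_forall_norm_le.2 ⟨1, ?_⟩)
    intro z hz
    have := (norm_sq_le_sum z).trans hz
    exact (sq_le_one_iff₀ (norm_nonneg z)).1 this
  have hball := hc (B.indicator 1) (measurable_one.indicator hBc.measurableSet) fun σ z => by
    have : z ∘ σ ∈ B ↔ z ∈ B := by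
      simp only [hB, Set.mem_ofPred_eq, Function.comp_apply]
      rw [Equiv.sum_comp σ fun i => z i ^ 2]
    by_cases h : z ∈ B
    · rw [Set.indicator_of_mem h, Set.indicator_of_mem (this.2 h)]
      rfl
    · rw [Set.indicator_of_notMem h, Set.indicator_of_notMem (fun h' => h (this.1 h'))]
  have hset : ∀ x, M.eig x ∈ B ↔ (M.mat x * M.mat x).trace.re ≤ 1 := fun x => by
    rw [← sq, trace_pow_eq (M.isHermitian x), Complex.ofReal_re]
    rfl
  have el : ∫⁻ x, B.indicator 1 (M.eig x) ∂μ = μ {c | (M.mat c * M.mat c).trace.re ≤ 1} := by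
    rw [← lintegral_indicator_one (isClosed_le htr continuous_const).measurableSet]
    refine lintegral_congr fun x => ?_
    by_cases h : M.eig x ∈ B
    · rw [Set.indicator_of_mem h, Set.indicator_of_mem (show x ∈ _ from (hset x).1 h)]
      rfl
    · rw [Set.indicator_of_notMem h,
        Set.indicator_of_notMem (show x ∉ _ from fun h' => h ((hset x).2 h'))]
  have er : ∫⁻ z, B.indicator 1 z * ENNReal.ofReal (|vand z| ^ β) =
      ENNReal.ofReal (radialMass β n) := by
    have hi : IntegrableOn (fun z : Fin n → ℝ => |vand z| ^ β) B :=
      (continuous_vand.abs.pow β).continuousOn.integrableOn_compact hBk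
    rw [radialMass, ofReal_integral_eq_lintegral_ofReal hi
      (Eventually.of_forall fun z => by positivity),
      ← lintegral_indicator hBc.measurableSet]
    refine lintegral_congr fun z => ?_
    by_cases h : z ∈ B
    · rw [Set.indicator_of_mem h, Set.indicator_of_mem h]
      simp
    · rw [Set.indicator_of_notMem h, Set.indicator_of_notMem h, zero_mul]
  rw [el, er] at hball
  have hpos : μ {c | (M.mat c * M.mat c).trace.re ≤ 1} ≠ 0 := by
    have ho : IsOpen {c | (M.mat c * M.mat c).trace.re < 1} := isOpen_lt htr continuous_const
    have := ho.measure_pos μ ⟨0, by simp⟩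
    refine (this.trans_le (measure_mono ?_)).ne'
    exact Set.ofPred_subset_ofPred.2 fun x hx => hx.le
  rw [hball] at hpos
  have hc0 : 0 < c := by
    by_contra hcon
    exact hpos (by rw [ENNReal.ofReal_of_nonpos (not_lt.1 hcon), zero_mul])
  have hr0 : 0 < radialMass β n := by
    by_contra hcon
    exact hpos (by rw [ENNReal.ofReal_of_nonpos (not_lt.1 hcon), mul_zero])
  rw [Measure.real, hball, ← ENNReal.ofReal_mul hc0.le, ENNReal.toReal_ofReal (by positivity),
    lintegral_smul_measure, hc F hF hs, smul_eq_mul, ← mul_assoc,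
    ← ENNReal.ofReal_mul (by positivity)]
  have : radialMass β n / (c * radialMass β n) * c = 1 := by field_simp
  rw [this, ENNReal.ofReal_one, one_mul]

/-- The Weyl integration formula. -/
theorem integral_eig (hβ1 : 1 ≤ β) (hβ2 : β ≤ 2) {f : (Fin n → ℝ) → ℂ} (hf : Measurable f)
    (hs : ∀ (σ : Equiv.Perm (Fin n)) z, f (z ∘ σ) = f z)
    (hint : Integrable fun z => ((|vand z| ^ β : ℝ) : ℂ) * f z) :
    Integrable (fun x => f (M.eig x)) (ENNReal.ofReal (radialMass β n /
      μ.real {c | (M.mat c * M.mat c).trace.re ≤ 1}) • μ) ∧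
    ∫ x, f (M.eig x) ∂(ENNReal.ofReal (radialMass β n /
      μ.real {c | (M.mat c * M.mat c).trace.re ≤ 1}) • μ) =
      ∫ z, ((|vand z| ^ β : ℝ) : ℂ) * f z := by
  set κ := ENNReal.ofReal (radialMass β n / μ.real {c | (M.mat c * M.mat c).trace.re ≤ 1}) • μ
  have mv : Measurable fun z : Fin n → ℝ => ENNReal.ofReal (|vand z| ^ β) := by
    have := (continuous_vand (n := n)).measurable
    fun_prop
  have key := integral_eq_of_lintegral_symmetric (μ := κ.map M.eig)
    (ν := volume.withDensity fun z => ENNReal.ofReal (|vand z| ^ β)) (fun F hF hFs => by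
      rw [lintegral_map hF M.measurable_eig, M.lintegral_eig hβ1 hβ2 hF hFs,
        lintegral_withDensity_eq_lintegral_mul _ mv hF]
      exact lintegral_congr fun z => mul_comm _ _) hf hs (by
      rw [integrable_withDensity_iff_integrable_smul' mv
        (Eventually.of_forall fun _ => ENNReal.ofReal_lt_top)]
      refine hint.congr (Eventually.of_forall fun z => ?_)
      simp only [ENNReal.toReal_ofReal (pow_nonneg (abs_nonneg (vand z)) β), Complex.real_smul])
  rw [integrable_map_measure hf.aestronglyMeasurable M.measurable_eig.aemeasurable,
    integral_map M.measurable_eig.aemeasurable hf.aestronglyMeasurable,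
    integral_withDensity_eq_integral_toReal_smul mv
      (Eventually.of_forall fun _ => ENNReal.ofReal_lt_top)] at key
  refine ⟨key.1, key.2.trans (integral_congr_ae (Eventually.of_forall fun z => ?_))⟩
  simp only [ENNReal.toReal_ofReal (pow_nonneg (abs_nonneg (vand z)) β), Complex.real_smul]

end MatrixModel

end TodaPfaff
end

/-! ### Matrix integrals -/

noncomputable section

namespace TodaPfaff

instance (n : ℕ) : (volume : Measure (HermCoord n)).IsAddHaarMeasure := by
  have : (volume : Measure (ℝ × ℝ)).IsAddHaarMeasure := Measure.prod.instIsAddHaarMeasure _ _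
  exact Measure.prod.instIsAddHaarMeasure _ _

lemma trace_single_mul {n : ℕ} (i j : Fin n) (P : Matrix (Fin n) (Fin n) ℂ) :
    (Matrix.single i j (1 : ℂ) * P).trace = P j i := by
  rw [Matrix.trace_single_mul]
  exact one_mul _

lemma trace_single_mul_mul {n : ℕ} (i j k l : Fin n) (P R : Matrix (Fin n) (Fin n) ℂ) :
    (Matrix.single i j (1 : ℂ) * P * Matrix.single k l 1 * R).trace = P j k * R l i := by
  rw [mul_assoc, mul_assoc, trace_single_mul, Matrix.mul_apply, Finset.sum_eq_single k]
  · congr 1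
    rw [Matrix.mul_apply, Finset.sum_eq_single l]
    · simp
    · intro b _ hb
      simp [hb.symm]
    · simp
  · intro b _ hb
    rw [Matrix.mul_apply, Finset.sum_eq_zero, mul_zero]
    intro c _
    simp [hb.symm]
  · simp

lemma trace_add_single_mul {n : ℕ} (i j : Fin n) (x y : ℂ) (P : Matrix (Fin n) (Fin n) ℂ) :
    ((x • Matrix.single i j (1 : ℂ) + y • Matrix.single j i 1) * P).trace =
      x * P j i + y * P i j := by
  rw [add_mul, Matrix.trace_add, Matrix.smul_mul, Matrix.smul_mul, Matrix.trace_smul,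
    Matrix.trace_smul, trace_single_mul, trace_single_mul, smul_eq_mul, smul_eq_mul]

lemma trace_add_single_mul_mul {n : ℕ} (i j : Fin n) (x y : ℂ) (P R : Matrix (Fin n) (Fin n) ℂ) :
    ((x • Matrix.single i j (1 : ℂ) + y • Matrix.single j i 1) * P *
      (x • Matrix.single i j (1 : ℂ) + y • Matrix.single j i 1) * R).trace =
      x * x * (P j i * R j i) + x * y * (P j j * R i i) + y * x * (P i i * R j j) +
        y * y * (P i j * R i j) := by
  simp only [add_mul, mul_add, Matrix.trace_add, Matrix.smul_mul, Matrix.mul_smul,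
    Matrix.trace_smul, smul_smul, trace_single_mul_mul, smul_eq_mul]
  ring

lemma sum_mul_swap {n : ℕ} (P R : Matrix (Fin n) (Fin n) ℂ) :
    ∑ i, ∑ j, P j i * R i j = (P * R).trace := by
  simp only [Matrix.trace, Matrix.diag_apply, Matrix.mul_apply]
  exact Finset.sum_comm

lemma sum_mul_diag {n : ℕ} (P R : Matrix (Fin n) (Fin n) ℂ) :
    ∑ i, ∑ j, P i i * R j j = P.trace * R.trace := by
  simp only [Matrix.trace, Matrix.diag_apply, Finset.sum_mul_sum]

/-- Coordinates of `Eᵢⱼ + Eⱼᵢ`. -/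
def symDir {n : ℕ} (i j : Fin n) : SymCoord n := fun p =>
  (if p.1 = (i, j) then 1 else 0) + if p.1 = (j, i) then 1 else 0

lemma symMat_symDir {n : ℕ} (i j : Fin n) : symMat (symDir i j) =
    (1 : ℂ) • Matrix.single i j (1 : ℂ) + (1 : ℂ) • Matrix.single j i 1 := by
  ext a b
  simp only [symMat, symDir, Matrix.add_apply, Matrix.single_apply, one_smul, Prod.mk.injEq,
    eq_comm (a := i), eq_comm (a := j)]
  by_cases h : a ≤ b
  · rw [dif_pos h]
    simp only [Complex.ofReal_add, apply_ite Complex.ofReal, Complex.ofReal_one,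
      Complex.ofReal_zero]
  · rw [dif_neg h, add_comm]
    simp only [Complex.ofReal_add, apply_ite Complex.ofReal, Complex.ofReal_one,
      Complex.ofReal_zero]
    congr 1 <;> exact if_congr and_comm rfl rfl

lemma symMat_transpose {n : ℕ} (c : SymCoord n) : (symMat c).transpose = symMat c := by
  ext a b
  rw [Matrix.transpose_apply, symMat, symMat]
  rcases lt_trichotomy a b with h | rfl | h
  · rw [dif_neg (not_le.2 h), dif_pos h.le]
  · rfl
  · rw [dif_pos h.le, dif_neg (not_le.2 h)]

lemma symMat_isHermitian {n : ℕ} (c : SymCoord n) : (symMat c).IsHermitian := by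
  have h := symMat_transpose c
  ext a b
  rw [Matrix.conjTranspose_apply, ← h, Matrix.transpose_apply, h, symMat]
  split_ifs <;> simp

lemma hermMat_isHermitian {n : ℕ} (c : HermCoord n) : (hermMat c).IsHermitian := by
  ext a b
  rw [Matrix.conjTranspose_apply, hermMat, hermMat]
  rcases lt_trichotomy a b with h | rfl | h
  · rw [dif_neg h.not_gt, dif_pos h, dif_pos h]
    exact Complex.ext rfl (neg_neg _)
  · simp
  · rw [dif_pos h, dif_neg h.not_gt, dif_pos h]
    rfl

/-- Coordinates of a Hermitean matrix. -/
def hermCoord {n : ℕ} (A : Matrix (Fin n) (Fin n) ℂ) : HermCoord n :=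
  (fun i => (A i i).re, fun p => ((A p.1.1 p.1.2).re, (A p.1.1 p.1.2).im))

lemma hermMat_hermCoord {n : ℕ} {A : Matrix (Fin n) (Fin n) ℂ} (hA : A.IsHermitian) :
    hermMat (hermCoord A) = A := by
  ext a b
  rw [hermMat]
  rcases lt_trichotomy a b with h | rfl | h
  · rw [dif_pos h]
    rfl
  · simp only [lt_irrefl, dite_false]
    exact hA.coe_re_apply_self a
  · rw [dif_neg h.not_gt, dif_pos h, ← hA.apply a b]
    rfl

/-- The Hermitean matrix `x Eᵢⱼ + x̄ Eⱼᵢ`. -/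
def hermUnit {n : ℕ} (x : ℂ) (i j : Fin n) : Matrix (Fin n) (Fin n) ℂ :=
  x • Matrix.single i j (1 : ℂ) + star x • Matrix.single j i 1

lemma hermUnit_isHermitian {n : ℕ} (x : ℂ) (i j : Fin n) : (hermUnit x i j).IsHermitian := by
  rw [Matrix.IsHermitian, hermUnit, Matrix.conjTranspose_add, Matrix.conjTranspose_smul,
    Matrix.conjTranspose_smul, Matrix.conjTranspose_single, Matrix.conjTranspose_single, star_star,
    star_one, add_comm]

lemma norm_entry_sq_le {n : ℕ} {A : Matrix (Fin n) (Fin n) ℂ} (hA : A.IsHermitian) (i j : Fin n) :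
    ‖A i j‖ ^ 2 ≤ (A * A).trace.re := by
  have e : (A * A).trace.re = ∑ i, ∑ j, ‖A i j‖ ^ 2 := by
    simp only [Matrix.trace, Matrix.diag_apply, Matrix.mul_apply, Complex.re_sum]
    refine Finset.sum_congr rfl fun a _ => Finset.sum_congr rfl fun b _ => ?_
    rw [← hA.apply b a, ← Complex.normSq_eq_norm_sq]
    exact congrArg Complex.re (Complex.mul_conj (A a b))
  rw [e]
  exact (Finset.single_le_sum (f := fun j => ‖A i j‖ ^ 2) (fun _ _ => sq_nonneg _)
    (Finset.mem_univ j)).trans (Finset.single_le_sum (f := fun i => ∑ j, ‖A i j‖ ^ 2)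
      (fun _ _ => Finset.sum_nonneg fun _ _ => sq_nonneg _) (Finset.mem_univ i))

/-- Real symmetric matrices, with repulsion exponent `1`. -/
def symModel (n : ℕ) : MatrixModel 1 n (SymCoord n) where
  mat :=
    { toFun := symMat
      map_add' := fun c d => by
        ext a b
        simp only [symMat, Matrix.add_apply]
        split_ifs <;> simp
      map_smul' := fun r c => by
        ext a b
        simp only [symMat, Matrix.smul_apply, RingHom.id_apply]
        split_ifs <;> simp }
  isHermitian := symMat_isHermitian
  norm_sq_le := fun c => by
    have h := norm_entry_sq_le (symMat_isHermitian c)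
    by_cases hn : IsEmpty {p : Fin n × Fin n // p.1 ≤ p.2}
    · have : Subsingleton (SymCoord n) := inferInstance
      have hE : IsEmpty (Fin n) := ⟨fun i => hn.elim ⟨(i, i), le_rfl⟩⟩
      simp [Subsingleton.elim c 0, Matrix.trace]
    · rw [not_isEmpty_iff] at hn
      obtain ⟨p0⟩ := hn
      have h0 := (sq_nonneg _).trans (h p0.1.1 p0.1.2)
      refine (Real.le_sqrt (norm_nonneg _) h0).1
        ((pi_norm_le_iff_of_nonneg (Real.sqrt_nonneg _)).2 fun p => Real.le_sqrt_of_sq_le ?_)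
      have := h p.1.1 p.1.2
      rw [symMat, dif_pos p.2, Complex.norm_real] at this
      exact this
  ι := Fin n × Fin n
  fintype := inferInstance
  dir := fun a => symDir a.1 a.2
  sum_trace_mul_trace := fun c k l => by
    have hs : ∀ k i j, (symMat c ^ k) i j = (symMat c ^ k) j i := fun k i j => by
      conv_lhs => rw [← symMat_transpose c, ← Matrix.transpose_pow, Matrix.transpose_apply]
    simp only [LinearMap.coe_mk, AddHom.coe_mk, symMat_symDir, trace_add_single_mul,
      Fintype.sum_prod_type]
    rw [pow_add, ← sum_mul_swap]
    simp only [Finset.mul_sum]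
    refine Finset.sum_congr rfl fun i _ => Finset.sum_congr rfl fun j _ => ?_
    rw [hs k i j, hs l i j]
    ring
  sum_trace_mul_mul_mul := fun c p q => by
    have hs : ∀ k i j, (symMat c ^ k) i j = (symMat c ^ k) j i := fun k i j => by
      conv_lhs => rw [← symMat_transpose c, ← Matrix.transpose_pow, Matrix.transpose_apply]
    simp only [LinearMap.coe_mk, AddHom.coe_mk, symMat_symDir, trace_add_single_mul_mul,
      Fintype.sum_prod_type]
    have e : ∀ i j, (1 : ℂ) * 1 * ((symMat c ^ p) j i * (symMat c ^ q) j i) +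
        1 * 1 * ((symMat c ^ p) j j * (symMat c ^ q) i i) +
        1 * 1 * ((symMat c ^ p) i i * (symMat c ^ q) j j) +
        1 * 1 * ((symMat c ^ p) i j * (symMat c ^ q) i j) =
        (symMat c ^ p) j i * (symMat c ^ q) i j + (symMat c ^ p) j i * (symMat c ^ q) i j +
          ((symMat c ^ q) i i * (symMat c ^ p) j j) +
          ((symMat c ^ p) i i * (symMat c ^ q) j j) := fun i j => by
      rw [hs q i j, hs p i j]
      ring
    simp only [e, Finset.sum_add_distrib, sum_mul_swap, sum_mul_diag]
    rw [pow_add]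
    push_cast
    ring

/-- Hermitean matrices, with repulsion exponent `2`. -/
def hermModel (n : ℕ) : MatrixModel 2 n (HermCoord n) where
  mat :=
    { toFun := hermMat
      map_add' := fun c d => by
        ext a b
        simp only [hermMat, Matrix.add_apply]
        split_ifs
        · exact Complex.ext rfl rfl
        · exact Complex.ext rfl (neg_add _ _)
        · simp
      map_smul' := fun r c => by
        ext a b
        simp only [hermMat, Matrix.smul_apply, RingHom.id_apply]
        split_ifs
        · exact Complex.ext (by simp) (by simp)
        · exact Complex.ext (by simp) (by simp)
        · simp }
  isHermitian := hermMat_isHermitian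
  norm_sq_le := fun c => by
    have h := norm_entry_sq_le (hermMat_isHermitian c)
    by_cases hn : IsEmpty (Fin n)
    · have : IsEmpty {p : Fin n × Fin n // p.1 < p.2} := ⟨fun p => hn.elim p.1.1⟩
      have : Subsingleton (HermCoord n) := inferInstance
      simp [Subsingleton.elim c 0, Matrix.trace]
    · rw [not_isEmpty_iff] at hn
      obtain ⟨i0⟩ := hn
      have h0 := (sq_nonneg _).trans (h i0 i0)
      refine (Real.le_sqrt (norm_nonneg _) h0).1 (max_le
        ((pi_norm_le_iff_of_nonneg (Real.sqrt_nonneg _)).2 fun i => Real.le_sqrt_of_sq_le ?_)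
        ((pi_norm_le_iff_of_nonneg (Real.sqrt_nonneg _)).2 fun p => max_le
          (Real.le_sqrt_of_sq_le ?_) (Real.le_sqrt_of_sq_le ?_)))
      · have := h i i
        rw [hermMat, dif_neg (lt_irrefl i), dif_neg (lt_irrefl i), Complex.norm_real] at this
        exact this
      · have h1 := h p.1.1 p.1.2
        rw [hermMat, dif_pos p.2] at h1
        exact (pow_le_pow_left₀ (abs_nonneg _) (Complex.abs_re_le_norm _) 2).trans h1
      · have h1 := h p.1.1 p.1.2
        rw [hermMat, dif_pos p.2] at h1
        exact (pow_le_pow_left₀ (abs_nonneg _) (Complex.abs_im_le_norm _) 2).trans h1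
  ι := (Fin n × Fin n) × Bool
  fintype := inferInstance
  dir := fun a => hermCoord (hermUnit (if a.2 then 1 else Complex.I) a.1.1 a.1.2)
  sum_trace_mul_trace := fun c k l => by
    simp only [LinearMap.coe_mk, AddHom.coe_mk, hermMat_hermCoord (hermUnit_isHermitian _ _ _)]
    simp only [hermUnit, trace_add_single_mul, Fintype.sum_prod_type, Fintype.sum_bool]
    have e : ∀ i j, (1 * (hermMat c ^ k) j i + star 1 * (hermMat c ^ k) i j) *
        (1 * (hermMat c ^ l) j i + star 1 * (hermMat c ^ l) i j) +
        (Complex.I * (hermMat c ^ k) j i + star Complex.I * (hermMat c ^ k) i j) *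
        (Complex.I * (hermMat c ^ l) j i + star Complex.I * (hermMat c ^ l) i j) =
        ((hermMat c ^ k) j i * (hermMat c ^ l) i j + (hermMat c ^ k) j i * (hermMat c ^ l) i j) +
          ((hermMat c ^ l) j i * (hermMat c ^ k) i j +
            (hermMat c ^ l) j i * (hermMat c ^ k) i j) := fun i j => by
      simp only [star_one, Complex.star_def, Complex.conj_I]
      linear_combination ((hermMat c ^ k) j i - (hermMat c ^ k) i j) *
        ((hermMat c ^ l) j i - (hermMat c ^ l) i j) * Complex.I_sq
    simp only [if_true, Bool.false_eq_true, if_false]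
    simp only [e]
    simp only [Finset.sum_add_distrib, sum_mul_swap, ← pow_add]
    rw [add_comm l k]
    ring
  sum_trace_mul_mul_mul := fun c p q => by
    simp only [LinearMap.coe_mk, AddHom.coe_mk, hermMat_hermCoord (hermUnit_isHermitian _ _ _)]
    simp only [hermUnit, trace_add_single_mul_mul, Fintype.sum_prod_type, Fintype.sum_bool]
    have e : ∀ i j, 1 * 1 * ((hermMat c ^ p) j i * (hermMat c ^ q) j i) +
        1 * star 1 * ((hermMat c ^ p) j j * (hermMat c ^ q) i i) +
        star 1 * 1 * ((hermMat c ^ p) i i * (hermMat c ^ q) j j) +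
        star 1 * star 1 * ((hermMat c ^ p) i j * (hermMat c ^ q) i j) +
        (Complex.I * Complex.I * ((hermMat c ^ p) j i * (hermMat c ^ q) j i) +
        Complex.I * star Complex.I * ((hermMat c ^ p) j j * (hermMat c ^ q) i i) +
        star Complex.I * Complex.I * ((hermMat c ^ p) i i * (hermMat c ^ q) j j) +
        star Complex.I * star Complex.I * ((hermMat c ^ p) i j * (hermMat c ^ q) i j)) =
        ((hermMat c ^ q) i i * (hermMat c ^ p) j j + (hermMat c ^ q) i i * (hermMat c ^ p) j j) +
          ((hermMat c ^ p) i i * (hermMat c ^ q) j j +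
            (hermMat c ^ p) i i * (hermMat c ^ q) j j) := fun i j => by
      simp only [star_one, Complex.star_def, Complex.conj_I]
      linear_combination ((hermMat c ^ p) j i * (hermMat c ^ q) j i -
        (hermMat c ^ p) j j * (hermMat c ^ q) i i - (hermMat c ^ p) i i * (hermMat c ^ q) j j +
        (hermMat c ^ p) i j * (hermMat c ^ q) i j) * Complex.I_sq
    simp only [if_true, Bool.false_eq_true, if_false]
    simp only [e]
    simp only [Finset.sum_add_distrib, sum_mul_diag]
    push_cast
    ring

section Integrals

lemma integrable_abs_vand {n : ℕ} {h : ℝ → ℂ}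
    (hh : ∀ k : ℕ, Integrable fun z : ℝ => (z : ℂ) ^ k * h z) :
    Integrable fun z : Fin n → ℝ => ((|vand z| : ℝ) : ℂ) * ∏ i, h (z i) := by
  have h0 : Integrable h := by simpa using hh 0
  have hp : AEStronglyMeasurable (fun z : Fin n → ℝ => ∏ i, h (z i)) volume :=
    (Integrable.fintype_prod (f := fun (_ : Fin n) => h) fun _ => h0).1
  have hv : Continuous fun z : Fin n → ℝ => ((|vand z| : ℝ) : ℂ) :=
    Complex.continuous_ofReal.comp continuous_vand.abs
  refine (integrable_vdet (n := n) hh).mono (hv.aestronglyMeasurable.mul hp)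
    (Eventually.of_forall fun z => ?_)
  rw [norm_mul, norm_mul, abs_vand, Complex.norm_real, norm_norm]

variable {β n : ℕ} {E : Type*} [NormedAddCommGroup E] [NormedSpace ℝ E] (M : MatrixModel β n E)
  [FiniteDimensional ℝ E] [MeasurableSpace E] [BorelSpace E] {μ : Measure E} [μ.IsAddHaarMeasure]

/-- The matrix integral over the matrices with spectrum in `I`, as an eigenvalue integral. -/
lemma MatrixModel.integral_expTr (hβ1 : 1 ≤ β) (hβ2 : β ≤ 2) {I : Set ℝ} (hI : MeasurableSet I)
    {V : ℝ → ℝ} {t : Times} {h : ℝ → ℂ} (hm : Measurable h)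
    (hh : h = I.indicator fun z => Complex.exp (-(V z : ℂ) + (xi t).eval (z : ℂ)))
    (hint : Integrable fun z : Fin n → ℝ => ((|vand z| ^ β : ℝ) : ℂ) * ∏ i, h (z i)) :
    IntegrableOn (fun c => expTr V t (M.mat c)) {c | spectrum ℝ (M.mat c) ⊆ I}
      (ENNReal.ofReal (radialMass β n / μ.real {c | (M.mat c * M.mat c).trace.re ≤ 1}) • μ) ∧
    ∫ c in {c | spectrum ℝ (M.mat c) ⊆ I}, expTr V t (M.mat c)
      ∂(ENNReal.ofReal (radialMass β n / μ.real {c | (M.mat c * M.mat c).trace.re ≤ 1}) • μ) =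
      ∫ z : Fin n → ℝ, ((|vand z| ^ β : ℝ) : ℂ) * ∏ i, h (z i) := by
  have hset : {c | spectrum ℝ (M.mat c) ⊆ I} = M.eig ⁻¹' Set.univ.pi fun _ => I := by
    ext c
    rw [Set.mem_ofPred_eq, (M.isHermitian c).spectrum_real_eq_range_eigenvalues,
      Set.range_subset_iff, Set.mem_preimage, Set.mem_univ_pi]
    rfl
  have hms : MeasurableSet {c | spectrum ℝ (M.mat c) ⊆ I} := by
    rw [hset]
    exact M.measurable_eig (MeasurableSet.univ_pi fun _ => hI)
  have hind : {c | spectrum ℝ (M.mat c) ⊆ I}.indicator (fun c => expTr V t (M.mat c)) =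
      fun c => ∏ i, h (M.eig c i) := by
    funext c
    by_cases hc : c ∈ {c | spectrum ℝ (M.mat c) ⊆ I}
    · rw [Set.indicator_of_mem hc, expTr_eq (M.isHermitian c)]
      rw [hset, Set.mem_preimage, Set.mem_univ_pi] at hc
      refine Finset.prod_congr rfl fun i _ => ?_
      rw [hh, Set.indicator_of_mem (hc i)]
      rfl
    · rw [Set.indicator_of_notMem hc]
      rw [hset, Set.mem_preimage, Set.mem_univ_pi] at hc
      push Not at hc
      obtain ⟨i, hi⟩ := hc
      rw [Finset.prod_eq_zero (Finset.mem_univ i)]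
      rw [hh, Set.indicator_of_notMem hi]
  have key := M.integral_eig (μ := μ) hβ1 hβ2 (f := fun z => ∏ i, h (z i))
    (Finset.measurable_prod _ fun i _ => hm.comp (measurable_pi_apply i))
    (fun σ z => Equiv.prod_comp σ fun i => h (z i)) hint
  rw [← integrable_indicator_iff hms, ← integral_indicator hms, hind]
  exact key

end Integrals

namespace Weight

variable (W : Weight)

lemma measurable_indicator_exp {V : ℝ → ℝ} (hV : ContinuousOn V W.E) (t : Times) :
    Measurable (W.E.indicator fun z => Complex.exp (-(V z : ℂ) + (xi t).eval (z : ℂ))) := by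
  classical
  rw [← Set.piecewise_eq_indicator]
  refine ContinuousOn.measurable_piecewise ?_ continuousOn_const W.isOpen_E.measurableSet
  have := continuous_fn (xi t)
  exact Complex.continuous_exp.comp_continuousOn
    ((Complex.continuous_ofReal.comp_continuousOn hV).neg.add this.continuousOn)

variable {W}

lemma MomFinite.tau_eq {t : Times} (h : W.MomFinite t) (n : ℕ) :
    IntegrableOn (fun c => expTr W.V t (hermMat c)) (hermSet W.E n) (hermHaar n) ∧
    W.tau n t = (1 / (n.factorial : ℂ)) *
      ∫ c in hermSet W.E n, expTr W.V t (hermMat c) ∂hermHaar n := by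
  have hi := integrable_vdet_sq (n := n) h
  simp only [vdet_sq] at hi
  have key := (hermModel n).integral_expTr (μ := volume) (by norm_num) le_rfl
    W.isOpen_E.measurableSet (V := W.V) (t := t) (h := W.rho t)
    (W.measurable_indicator_exp (continuousOn_V W) t) rfl hi
  refine ⟨key.1, ?_⟩
  have e : ∫ c in hermSet W.E n, expTr W.V t (hermMat c) ∂hermHaar n = _ := key.2
  rw [e, ← det_moments h]
  simp only [tau, mom_apply]

lemma TMomFinite.ttau_eq {t : Times} (h : W.TMomFinite t) (n : ℕ) :
    IntegrableOn (fun c => expTr W.tV t (symMat c)) (symSet W.E (2 * n)) (symHaar (2 * n)) ∧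
    W.ttau n t = (1 / ((-2) ^ n * ((2 * n).factorial : ℂ))) *
      ∫ c in symSet W.E (2 * n), expTr W.tV t (symMat c) ∂symHaar (2 * n) := by
  have hi := integrable_abs_vand (n := 2 * n) h
  have key := (symModel (2 * n)).integral_expTr (μ := volume) le_rfl (by norm_num)
    W.isOpen_E.measurableSet (V := W.tV) (t := t) (h := W.trho t)
    (W.measurable_indicator_exp (continuousOn_tV W) t) rfl (by simpa only [pow_one] using hi)
  refine ⟨key.1, ?_⟩
  have e : ∫ c in symSet W.E (2 * n), expTr W.tV t (symMat c) ∂symHaar (2 * n) = _ := key.2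
  rw [e]
  simp only [pow_one]
  exact pf_moments h fun i j => by simp only [tmom, innerSk, skIntegrand, fn_X_pow]

variable (W)

lemma xi_im {t : Times} (ht : ∀ k, (t k).im = 0) (z : ℝ) : ((xi t).eval (z : ℂ)).im = 0 := by
  simp only [xi, Finsupp.sum, eval_finsetSum, eval_monomial, Complex.im_sum]
  refine Finset.sum_eq_zero fun k _ => ?_
  rw [← Complex.ofReal_pow, Complex.im_mul_ofReal, ht, zero_mul]

/-- For real times the weights are positive on `E`, and so are the eigenvalue integrals. -/
lemma integral_vand_mul_ne_zero (V : ℝ → ℝ) {t : Times} (ht : ∀ k, (t k).im = 0) (β n : ℕ)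
    {h : ℝ → ℂ}
    (hh : h = W.E.indicator fun z => Complex.exp (-(V z : ℂ) + (xi t).eval (z : ℂ)))
    (hint : Integrable fun z : Fin n → ℝ => ((|vand z| ^ β : ℝ) : ℂ) * ∏ i, h (z i)) :
    ∫ z : Fin n → ℝ, ((|vand z| ^ β : ℝ) : ℂ) * ∏ i, h (z i) ≠ 0 := by
  set r : ℝ → ℝ := W.E.indicator fun z => Real.exp (-V z + ((xi t).eval (z : ℂ)).re) with hr
  have hhr : ∀ z, h z = ((r z : ℝ) : ℂ) := fun z => by
    rw [hh, hr]
    by_cases hz : z ∈ W.E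
    · rw [Set.indicator_of_mem hz, Set.indicator_of_mem hz, Complex.ofReal_exp]
      congr 1
      exact Complex.ext (by simp) (by simp [xi_im ht])
    · rw [Set.indicator_of_notMem hz, Set.indicator_of_notMem hz, Complex.ofReal_zero]
  have e : ∀ z : Fin n → ℝ, ((|vand z| ^ β : ℝ) : ℂ) * ∏ i, h (z i) =
      ((|vand z| ^ β * ∏ i, r (z i) : ℝ) : ℂ) := fun z => by
    simp only [hhr, Complex.ofReal_mul, Complex.ofReal_prod]
  simp only [e] at hint ⊢
  have hpos := integral_vand_pos (n := n) β (r := r) W.isOpen_E W.nonempty_E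
    (fun z => Set.indicator_nonneg (fun _ _ => (Real.exp_pos _).le) z)
    (fun z hz => by rw [hr, Set.indicator_of_mem hz]; exact Real.exp_pos _)
    (hint.re.congr (Eventually.of_forall fun z => Complex.ofReal_re _))
  rw [show ∫ z : Fin n → ℝ, ((|vand z| ^ β * ∏ i, r (z i) : ℝ) : ℂ) = _ from
    integral_ofReal (𝕜 := ℂ)]
  exact Complex.ofReal_ne_zero.2 hpos.ne'

variable {W}

lemma MomFinite.tau_ne_zero {t : Times} (h : W.MomFinite t) (ht : ∀ k, (t k).im = 0) (n : ℕ) :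
    W.tau n t ≠ 0 := by
  have hi := integrable_vdet_sq (n := n) h
  simp only [vdet_sq] at hi
  have e := det_moments (n := n) h
  simp only [tau, mom_apply]
  rw [e]
  exact mul_ne_zero (one_div_ne_zero (by exact_mod_cast n.factorial_ne_zero))
    (W.integral_vand_mul_ne_zero W.V ht 2 n rfl hi)

lemma TMomFinite.ttau_ne_zero {t : Times} (h : W.TMomFinite t) (ht : ∀ k, (t k).im = 0) (n : ℕ) :
    W.ttau n t ≠ 0 := by
  have hi := integrable_abs_vand (n := 2 * n) h
  have e := pf_moments (n := n) h (m := W.tmom t)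
    fun i j => by simp only [tmom, innerSk, skIntegrand, fn_X_pow]
  rw [ttau, e]
  refine mul_ne_zero (one_div_ne_zero (mul_ne_zero (pow_ne_zero _ (by norm_num))
    (by exact_mod_cast (2 * n).factorial_ne_zero))) ?_
  have := W.integral_vand_mul_ne_zero W.tV ht 1 (2 * n) (h := W.trho t) rfl
    (by simpa only [pow_one] using hi)
  simpa only [pow_one] using this

end Weight

end TodaPfaff
end

/-! ### The skew inverse of `n_t` -/

noncomputable section

namespace TodaPfaff

/-- An interval has at most one endpoint on each side. -/
lemma countable_frontier {E : Set ℝ} (ho : IsOpen E) (hc : E.OrdConnected) :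
    (frontier E).Countable := by
  have hmem : ∀ a ∈ frontier E, a ∈ closure E ∧ a ∉ E := fun a ha =>
    ⟨frontier_subset_closure ha, fun h => by rw [ho.frontier_eq] at ha; exact ha.2 h⟩
  have hside : ∀ a ∈ frontier E, (∀ x ∈ E, a < x) ∨ ∀ x ∈ E, x < a := fun a ha => by
    obtain ⟨-, haE⟩ := hmem a ha
    by_contra! hcon
    obtain ⟨⟨x, hx, hxa⟩, y, hy, hay⟩ := hcon
    exact haE (hc.out hx hy ⟨hxa, hay⟩)
  have h1 : {a ∈ frontier E | ∀ x ∈ E, a < x}.Subsingleton := by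
    have key : ∀ a b, a ∈ frontier E → (∀ x ∈ E, b < x) → b ≤ a := fun a b ha hb => by
      by_contra hlt
      obtain ⟨x, hx1, hx2⟩ := mem_closure_iff.1 (hmem a ha).1 (Set.Iio b) isOpen_Iio (not_le.1 hlt)
      exact lt_asymm hx1 (hb x hx2)
    exact fun a ha b hb => le_antisymm (key b a hb.1 ha.2) (key a b ha.1 hb.2)
  have h2 : {a ∈ frontier E | ∀ x ∈ E, x < a}.Subsingleton := by
    have key : ∀ a b, a ∈ frontier E → (∀ x ∈ E, x < b) → a ≤ b := fun a b ha hb => by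
      by_contra hlt
      obtain ⟨x, hx1, hx2⟩ := mem_closure_iff.1 (hmem a ha).1 (Set.Ioi b) isOpen_Ioi (not_le.1 hlt)
      exact lt_asymm hx1 (hb x hx2)
    exact fun a ha b hb => le_antisymm (key a b ha.1 hb.2) (key b a hb.1 ha.2)
  refine (h1.countable.union h2.countable).mono fun a ha => ?_
  rcases hside a ha with h | h
  · exact Or.inl ⟨ha, h⟩
  · exact Or.inr ⟨ha, h⟩

lemma hasDerivAt_fn (φ : ℂ[X]) (z : ℝ) : HasDerivAt (fn φ) (fn (derivative φ) z) z :=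
  (φ.hasDerivAt (z : ℂ)).comp_ofReal

lemma fn_map (p : ℝ[X]) (z : ℝ) : fn (p.map Complex.ofRealHom) z = ((p.eval z : ℝ) : ℂ) := by
  have := Polynomial.eval_map_apply (f := Complex.ofRealHom) (p := p) z
  exact this

namespace Weight

variable (W : Weight)

/-- The function `√(f ρ_t)`, on `E`. -/
def amp (t : Times) (z : ℝ) : ℂ :=
  Complex.exp (((Real.log (W.f.eval z) - W.V z : ℝ) + (xi t).eval (z : ℂ)) / 2)

lemma amp_ne_zero (t : Times) (z : ℝ) : W.amp t z ≠ 0 := Complex.exp_ne_zero _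

lemma trho_ne_zero (t : Times) {z : ℝ} (hz : z ∈ W.E) : W.trho t z ≠ 0 := by
  rw [trho, Set.indicator_of_mem hz]
  exact Complex.exp_ne_zero _

lemma amp_eq (t : Times) {z : ℝ} (hz : z ∈ W.E) :
    W.amp ((2 : ℂ) • t) z = ((W.f.eval z : ℝ) : ℂ) * W.trho t z := by
  have hf : ((W.f.eval z : ℝ) : ℂ) = Complex.exp ((Real.log (W.f.eval z) : ℝ) : ℂ) := by
    rw [← Complex.ofReal_exp, Real.exp_log (W.f_pos z hz)]
  rw [amp, trho, Set.indicator_of_mem hz, hf, ← Complex.exp_add, xi_smul]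
  congr 1
  simp only [tV, eval_smul, smul_eq_mul]
  push_cast
  ring

lemma rho_two (t : Times) (z : ℝ) :
    W.rho ((2 : ℂ) • t) z = W.trho t z * W.amp ((2 : ℂ) • t) z := by
  by_cases hz : z ∈ W.E
  · have hf : ((W.f.eval z : ℝ) : ℂ) ≠ 0 := by exact_mod_cast (W.f_pos z hz).ne'
    have h := W.trho_sq t hz
    rw [eq_div_iff hf] at h
    rw [W.amp_eq t hz, ← h]
    ring
  · rw [rho, trho, Set.indicator_of_notMem hz, Set.indicator_of_notMem hz, zero_mul]

lemma nOp_eq (t : Times) (φ : ℝ → ℂ) {z : ℝ} (hz : z ∈ W.E) :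
    W.nOp ((2 : ℂ) • t) φ z =
      (W.trho t z)⁻¹ * deriv (fun y => W.amp ((2 : ℂ) • t) y * φ y) z := by
  rw [nOp]
  congr 1
  rw [trho, Set.indicator_of_mem hz, ← Complex.exp_neg, xi_smul]
  congr 1
  simp only [tV, eval_smul, smul_eq_mul]
  push_cast
  ring

lemma hasDerivAt_amp (t : Times) {z : ℝ} (hz : z ∈ W.E) :
    HasDerivAt (W.amp t) (W.amp t z * ((((derivative W.f).eval z / W.f.eval z -
      W.g.eval z / W.f.eval z : ℝ) + fn (derivative (xi t)) z) / 2)) z := by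
  have h1 := (((W.f.hasDerivAt z).log (W.f_pos z hz).ne').sub (W.hasDerivAt_V z hz)).ofReal_comp
  exact ((h1.add (hasDerivAt_fn (xi t) z)).div_const 2).cexp

lemma fn_nPoly (t : Times) (φ : ℂ[X]) (z : ℝ) : fn (W.nPoly t φ) z =
    ((W.f.eval z : ℝ) : ℂ) * fn (derivative φ) z +
      (((derivative W.f).eval z - W.g.eval z : ℝ) +
        ((W.f.eval z : ℝ) : ℂ) * fn (derivative (xi t)) z) / 2 * fn φ z := by
  have e : W.nPoly t φ = (W.f.map Complex.ofRealHom) * derivative φ + C (1 / 2) *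
      ((derivative W.f).map Complex.ofRealHom - W.g.map Complex.ofRealHom +
        W.f.map Complex.ofRealHom * derivative (xi t)) * φ := by
    have hc : (C (1 / 2 : ℂ) : ℂ[X]) + C (1 / 2) = 1 := by rw [← C_add]; norm_num
    rw [nPoly, derivative_mul, derivative_map]
    linear_combination -(derivative W.f).map Complex.ofRealHom * φ * hc
  have hC : fn (C (1 / 2)) z = 1 / 2 := by simp [fn]
  have hs : ∀ a b : ℂ[X], fn (a - b) z = fn a z - fn b z := fun a b => eval_sub ..
  rw [e, fn_add, fn_mul, fn_mul, fn_mul, fn_add, hs, fn_mul, fn_map, fn_map, fn_map, hC]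
  push_cast
  ring

lemma hasDerivAt_amp_mul (t : Times) (φ : ℂ[X]) {z : ℝ} (hz : z ∈ W.E) :
    HasDerivAt (fun y => W.amp ((2 : ℂ) • t) y * fn φ y)
      (fn (W.nPoly ((2 : ℂ) • t) φ) z * W.trho t z) z := by
  refine ((W.hasDerivAt_amp _ hz).fun_mul (hasDerivAt_fn φ z)).congr_deriv ?_
  have hf : ((W.f.eval z : ℝ) : ℂ) ≠ 0 := by exact_mod_cast (W.f_pos z hz).ne'
  rw [fn_nPoly, W.amp_eq t hz]
  push_cast
  field_simp
  ring

lemma nOp_fn (t : Times) (φ : ℂ[X]) {z : ℝ} (hz : z ∈ W.E) :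
    W.nOp ((2 : ℂ) • t) (fn φ) z = fn (W.nPoly ((2 : ℂ) • t) φ) z := by
  rw [W.nOp_eq t _ hz, (W.hasDerivAt_amp_mul t φ hz).deriv, mul_comm, mul_assoc,
    mul_inv_cancel₀ (W.trho_ne_zero t hz), mul_one]

/-- `½ ∫ ε(z - y) ψ(y) ρ̃_t(y) dy`, a primitive of `ψ ρ̃_t`. -/
def skPrim (t : Times) (ψ : ℂ[X]) (z : ℝ) : ℂ :=
  (1 / 2 : ℂ) * ∫ y : ℝ, eps (z - y) * (fn ψ y * W.trho t y)

lemma continuousOn_trho (t : Times) : ContinuousOn (W.trho t) W.E := by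
  have : ContinuousOn (fun z : ℝ => Complex.exp (-(W.tV z : ℂ) + (xi t).eval (z : ℂ))) W.E :=
    Complex.continuous_exp.comp_continuousOn
      ((Complex.continuous_ofReal.comp_continuousOn W.continuousOn_tV).neg.add
        (continuous_fn (xi t)).continuousOn)
  exact this.congr fun z hz => Set.indicator_of_mem hz _

variable {W} {t : Times}

lemma TMomFinite.skPrim_eq (h : W.TMomFinite t) (ψ : ℂ[X]) (z : ℝ) :
    W.skPrim t ψ z = (∫ y in Set.Iic z, fn ψ y * W.trho t y) -
      (1 / 2 : ℂ) * ∫ y, fn ψ y * W.trho t y := by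
  have hi := h.integrable ψ
  have e1 : ∫ y : ℝ, eps (z - y) * (fn ψ y * W.trho t y) =
      (∫ y in Set.Iic z, fn ψ y * W.trho t y) - ∫ y in Set.Ioi z, fn ψ y * W.trho t y := by
    have hm : Measurable fun y : ℝ => eps (z - y) :=
      measurable_eps.comp (measurable_const.prodMk measurable_id)
    have hi2 : Integrable fun y : ℝ => eps (z - y) * (fn ψ y * W.trho t y) :=
      hi.bdd_mul (c := 1) hm.aestronglyMeasurable (Eventually.of_forall fun y => (norm_eps _).le)
    rw [← intervalIntegral.integral_Iic_add_Ioi (b := z) hi2.integrableOn hi2.integrableOn,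
      sub_eq_add_neg, ← integral_neg]
    congr 1
    · refine setIntegral_congr_fun measurableSet_Iic fun y hy => ?_
      simp only [eps, if_pos (sub_nonneg.2 (Set.mem_Iic.1 hy)), one_mul]
    · refine setIntegral_congr_fun measurableSet_Ioi fun y hy => ?_
      simp only [eps, if_neg (not_le.2 (sub_neg.2 (Set.mem_Ioi.1 hy))), neg_one_mul]
  have e2 := intervalIntegral.integral_Iic_add_Ioi (b := z) hi.integrableOn hi.integrableOn
  rw [skPrim, e1, ← e2]
  ring

lemma TMomFinite.hasDerivAt_skPrim (h : W.TMomFinite t) (ψ : ℂ[X]) {z : ℝ} (hz : z ∈ W.E) :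
    HasDerivAt (W.skPrim t ψ) (fn ψ z * W.trho t z) z := by
  have hi := h.integrable ψ
  have hfun : W.skPrim t ψ = fun x => ((∫ y in Set.Iic z, fn ψ y * W.trho t y) +
      ∫ y in z..x, fn ψ y * W.trho t y) - (1 / 2 : ℂ) * ∫ y, fn ψ y * W.trho t y := by
    funext x
    rw [h.skPrim_eq, ← intervalIntegral.integral_Iic_sub_Iic hi.integrableOn hi.integrableOn]
    ring
  have hcont : ContinuousAt (fun y => fn ψ y * W.trho t y) z :=
    (continuous_fn ψ).continuousAt.mul
      ((W.continuousOn_trho t).continuousAt (W.isOpen_E.mem_nhds hz))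
  rw [hfun]
  exact ((intervalIntegral.integral_hasDerivAt_right (a := z) hi.intervalIntegrable
    hi.1.stronglyMeasurableAtFilter hcont).const_add _).sub_const _

lemma TMomFinite.continuous_skPrim (h : W.TMomFinite t) (ψ : ℂ[X]) :
    Continuous (W.skPrim t ψ) := by
  have hi := h.integrable ψ
  have hfun : W.skPrim t ψ = fun x => ((∫ y in Set.Iic 0, fn ψ y * W.trho t y) +
      ∫ y in (0 : ℝ)..x, fn ψ y * W.trho t y) - (1 / 2 : ℂ) * ∫ y, fn ψ y * W.trho t y := by
    funext x
    rw [h.skPrim_eq, ← intervalIntegral.integral_Iic_sub_Iic hi.integrableOn hi.integrableOn]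
    ring
  rw [hfun]
  exact ((continuous_const.add (intervalIntegral.continuous_primitive
    (fun _ _ => hi.intervalIntegrable) 0)).sub continuous_const)

lemma norm_skPrim_le (ψ : ℂ[X]) (z : ℝ) :
    ‖W.skPrim t ψ z‖ ≤ ∫ y, ‖fn ψ y * W.trho t y‖ := by
  have h1 : ‖∫ y : ℝ, eps (z - y) * (fn ψ y * W.trho t y)‖ ≤ ∫ y, ‖fn ψ y * W.trho t y‖ := by
    refine (norm_integral_le_integral_norm _).trans (le_of_eq ?_)
    simp only [norm_mul, norm_eps, one_mul]
  rw [skPrim, norm_mul]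
  have h2 : ‖(1 / 2 : ℂ)‖ ≤ 1 := by norm_num
  exact (mul_le_of_le_one_left (norm_nonneg _) h2).trans h1

/-- The pairing of the primitive with a polynomial is the skew inner product. -/
lemma TMomFinite.integral_mul_skPrim (h : W.TMomFinite t) (φ ψ : ℂ[X]) :
    ∫ z, fn φ z * W.trho t z * W.skPrim t ψ z = W.innerSk t (fn φ) (fn ψ) := by
  rw [innerSk, Measure.volume_eq_prod, integral_prod _ (h.integrable_skIntegrand φ ψ),
    ← integral_const_mul]
  refine integral_congr_ae (Eventually.of_forall fun z => ?_)
  simp only [skPrim]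
  rw [mul_left_comm, ← integral_const_mul]
  congr 1
  refine integral_congr_ae (Eventually.of_forall fun y => ?_)
  simp only [skIntegrand]
  ring

/-- `√(f ρ_{2t}) φ` vanishes at the endpoints of `E`: at the finite ones because `f ρ` does. -/
lemma continuous_indicator_amp (W : Weight) (t : Times) (φ : ℂ[X]) :
    Continuous (W.E.indicator fun y => W.amp ((2 : ℂ) • t) y * fn φ y) := by
  refine continuous_iff_continuousAt.2 fun x => ?_
  by_cases hx : x ∈ W.E
  · refine (W.hasDerivAt_amp_mul t φ hx).continuousAt.congr ?_
    filter_upwards [W.isOpen_E.mem_nhds hx] with y hy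
    rw [Set.indicator_of_mem hy]
  · rw [ContinuousAt, Set.indicator_of_notMem hx, ← nhdsWithin_univ, ← Set.union_compl_self W.E,
      nhdsWithin_union, tendsto_sup]
    constructor
    · by_cases hc : x ∈ closure W.E
      · have hb := W.boundary x (by rw [W.isOpen_E.frontier_eq]; exact ⟨hc, hx⟩)
        rw [tendsto_zero_iff_norm_tendsto_zero]
        have hcont : Continuous fun y : ℝ =>
            Real.exp (((xi ((2 : ℂ) • t)).eval (y : ℂ)).re / 2) * ‖fn φ y‖ := by
          have h1 := continuous_fn (xi ((2 : ℂ) • t))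
          exact (Real.continuous_exp.comp ((Complex.continuous_re.comp h1).div_const 2)).mul
            (continuous_fn φ).norm
        have hlim := ((Real.continuous_sqrt.tendsto 0).comp hb).mul
          ((hcont.tendsto x).mono_left nhdsWithin_le_nhds)
        rw [Real.sqrt_zero, zero_mul] at hlim
        refine hlim.congr' ?_
        filter_upwards [self_mem_nhdsWithin] with y hy
        have e : W.f.eval y * Real.exp (-W.V y) =
            Real.exp (Real.log (W.f.eval y) - W.V y) := by
          rw [sub_eq_add_neg, Real.exp_add, Real.exp_log (W.f_pos y hy)]
        rw [Set.indicator_of_mem hy, norm_mul, amp, Complex.norm_exp, Function.comp_apply, e,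
          ← Real.exp_half, ← mul_assoc, ← Real.exp_add]
        congr 2
        rw [Complex.div_ofNat_re, Complex.add_re, Complex.ofReal_re]
        ring
      · rw [mem_closure_iff_nhdsWithin_neBot, not_neBot] at hc
        rw [hc]
        exact tendsto_bot
    · refine tendsto_const_nhds.congr' ?_
      filter_upwards [self_mem_nhdsWithin] with y hy
      rw [Set.indicator_of_notMem hy]

lemma TMomFinite.skPrim_nPoly (h : W.TMomFinite t) (φ : ℂ[X]) {z : ℝ} (hz : z ∈ W.E) :
    W.skPrim t (W.nPoly ((2 : ℂ) • t) φ) z = W.amp ((2 : ℂ) • t) z * fn φ z := by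
  set H : ℝ → ℂ := W.E.indicator fun y => W.amp ((2 : ℂ) • t) y * fn φ y with hH
  set F : ℝ → ℂ := fun y => fn (W.nPoly ((2 : ℂ) • t) φ) y * W.trho t y with hF
  have hFi : Integrable F := h.integrable _
  have hHi : Integrable H := by
    refine (h.integrable (W.f.map Complex.ofRealHom * φ)).congr (Eventually.of_forall fun y => ?_)
    simp only [hH]
    by_cases hy : y ∈ W.E
    · rw [Set.indicator_of_mem hy, fn_mul, fn_map, W.amp_eq t hy]
      ring
    · rw [Set.indicator_of_notMem hy, trho, Set.indicator_of_notMem hy, mul_zero]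
  have ftc : ∀ a b : ℝ, ∫ y in a..b, F y = H b - H a := fun a b => by
    refine integral_eq_of_hasDerivAt_off_countable H F
      (countable_frontier W.isOpen_E W.ordConnected_E)
      (continuous_indicator_amp W t φ).continuousOn (fun x hx => ?_) hFi.intervalIntegrable
    by_cases hxE : x ∈ W.E
    · refine (W.hasDerivAt_amp_mul t φ hxE).congr_of_eventuallyEq ?_
      filter_upwards [W.isOpen_E.mem_nhds hxE] with y hy
      rw [hH, Set.indicator_of_mem hy]
    · have hxc : x ∉ closure W.E := fun hc =>
        hx.2 (by rw [W.isOpen_E.frontier_eq]; exact ⟨hc, hxE⟩)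
      have h0 : F x = 0 := by
        simp only [hF, trho, Set.indicator_of_notMem hxE, mul_zero]
      rw [h0]
      refine (hasDerivAt_const x (0 : ℂ)).congr_of_eventuallyEq ?_
      filter_upwards [isClosed_closure.isOpen_compl.mem_nhds hxc] with y hy
      rw [hH, Set.indicator_of_notMem fun hyE => hy (subset_closure hyE)]
  -- `H` has limits at both infinite ends, and they vanish because `H` is integrable.
  have hbot : H z - ∫ y in Set.Iic z, F y = 0 := by
    refine (hHi.integrableAtFilter atBot).eq_zero_of_tendsto (fun s hs => ?_)
      ((tendsto_const_nhds.sub (intervalIntegral_tendsto_integral_Iic z hFi.integrableOn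
        tendsto_id)).congr fun a => ?_)
    · obtain ⟨a, ha⟩ := mem_atBot_sets.1 hs
      exact top_le_iff.1 ((Real.volume_Iic (a := a)).symm.le.trans (measure_mono ha))
    · simp only [id, ftc]
      ring
  have htop : H z + ∫ y in Set.Ioi z, F y = 0 := by
    refine (hHi.integrableAtFilter atTop).eq_zero_of_tendsto (fun s hs => ?_)
      ((tendsto_const_nhds.add (intervalIntegral_tendsto_integral_Ioi z hFi.integrableOn
        tendsto_id)).congr fun a => ?_)
    · obtain ⟨a, ha⟩ := mem_atTop_sets.1 hs
      exact top_le_iff.1 ((Real.volume_Ici (a := a)).symm.le.trans (measure_mono ha))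
    · simp only [id, ftc]
      ring
  have hz' : H z = W.amp ((2 : ℂ) • t) z * fn φ z := by rw [hH, Set.indicator_of_mem hz]
  rw [h.skPrim_eq, ← intervalIntegral.integral_Iic_add_Ioi (b := z) hFi.integrableOn
    hFi.integrableOn, ← hz']
  linear_combination -(1 / 2 : ℂ) * hbot - (1 / 2 : ℂ) * htop

/-- The operator `n_{2t}⁻¹`: the primitive `½ ∫ ε(z - y) ψ(y) ρ̃_t(y) dy` divided by
`√(f ρ_{2t})` (and extended by zero outside `E`). -/
def skInv (h : W.TMomFinite t) : ℂ[X] →ₗ[ℂ] (ℝ → ℂ) where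
  toFun ψ := W.E.indicator fun z => W.skPrim t ψ z / W.amp ((2 : ℂ) • t) z
  map_add' φ ψ := by
    funext z
    have : W.skPrim t (φ + ψ) z = W.skPrim t φ z + W.skPrim t ψ z := by
      simp only [h.skPrim_eq, fn_add, add_mul]
      rw [integral_add (h.integrable φ).integrableOn (h.integrable ψ).integrableOn,
        integral_add (h.integrable φ) (h.integrable ψ)]
      ring
    by_cases hz : z ∈ W.E
    · simp only [Pi.add_apply, Set.indicator_of_mem hz, this, add_div]
    · simp only [Pi.add_apply, Set.indicator_of_notMem hz, add_zero]
  map_smul' c ψ := by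
    funext z
    have : W.skPrim t (c • ψ) z = c * W.skPrim t ψ z := by
      simp only [h.skPrim_eq, fn_smul, mul_assoc]
      rw [integral_const_mul, integral_const_mul]
      ring
    by_cases hz : z ∈ W.E
    · simp only [Pi.smul_apply, RingHom.id_apply, smul_eq_mul, Set.indicator_of_mem hz, this,
        mul_div_assoc]
    · simp only [Pi.smul_apply, RingHom.id_apply, Set.indicator_of_notMem hz, smul_zero]

lemma skInv_apply (h : W.TMomFinite t) (ψ : ℂ[X]) {z : ℝ} (hz : z ∈ W.E) :
    skInv h ψ z = W.skPrim t ψ z / W.amp ((2 : ℂ) • t) z := by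
  change W.E.indicator (fun z => W.skPrim t ψ z / W.amp ((2 : ℂ) • t) z) z = _
  rw [Set.indicator_of_mem hz]

lemma mul_skInv_mul_rho (h : W.TMomFinite t) (φ ψ : ℂ[X]) (z : ℝ) :
    fn φ z * skInv h ψ z * W.rho ((2 : ℂ) • t) z = fn φ z * W.trho t z * W.skPrim t ψ z := by
  rw [W.rho_two]
  by_cases hz : z ∈ W.E
  · rw [skInv_apply h ψ hz]
    have := W.amp_ne_zero ((2 : ℂ) • t) z
    field_simp
  · rw [trho, Set.indicator_of_notMem hz]
    ring

lemma innerSy_skInv (h : W.TMomFinite t) (φ ψ : ℂ[X]) :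
    W.innerSy ((2 : ℂ) • t) (fn φ) (skInv h ψ) = W.innerSk t (fn φ) (fn ψ) := by
  rw [← h.integral_mul_skPrim]
  exact integral_congr_ae (Eventually.of_forall fun z => mul_skInv_mul_rho h φ ψ z)

lemma innerSy_comm (W : Weight) (t : Times) (φ ψ : ℝ → ℂ) :
    W.innerSy t φ ψ = W.innerSy t ψ φ := by
  simp only [innerSy, mul_comm (φ _)]

lemma isSkewInverse_skInv (h : W.TMomFinite t) : W.IsSkewInverse ((2 : ℂ) • t) (skInv h) := by
  refine ⟨fun φ => ?_, fun φ z hz => ?_, fun φ z hz => ?_, fun φ ψ => ?_, fun φ ψ => ?_⟩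
  · have : DifferentiableOn ℝ (fun z => W.skPrim t φ z / W.amp ((2 : ℂ) • t) z) W.E := fun z hz =>
      ((h.hasDerivAt_skPrim φ hz).fun_div (W.hasDerivAt_amp _ hz)
        (W.amp_ne_zero _ z)).differentiableAt.differentiableWithinAt
    exact this.congr fun z hz => skInv_apply h φ hz
  · have e : (fun y => W.amp ((2 : ℂ) • t) y * skInv h φ y) =ᶠ[𝓝 z] W.skPrim t φ := by
      filter_upwards [W.isOpen_E.mem_nhds hz] with y hy
      rw [skInv_apply h φ hy, mul_div_cancel₀ _ (W.amp_ne_zero _ y)]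
    rw [W.nOp_eq t _ hz, e.deriv_eq, (h.hasDerivAt_skPrim φ hz).deriv, mul_left_comm,
      inv_mul_cancel₀ (W.trho_ne_zero t hz), mul_one]
  · rw [skInv_apply h _ hz, h.skPrim_nPoly φ hz, mul_div_cancel_left₀ _ (W.amp_ne_zero _ z)]
  · simp only [mul_skInv_mul_rho]
    have := (h.integrable φ).bdd_mul (h.continuous_skPrim ψ).aestronglyMeasurable
      (Eventually.of_forall (norm_skPrim_le ψ))
    exact this.congr (Eventually.of_forall fun z => mul_comm _ _)
  · rw [W.innerSy_comm, innerSy_skInv, innerSy_skInv, W.innerSk_comm]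

/-- Two skew inverses differ by multiples of the solution `1 / √(f ρ_{2t})` of the homogeneous
equation. Skew-symmetry leaves no such freedom, unless all `∫ φ ρ̃_t` vanish, and then the inner
products with polynomials are not affected. -/
lemma IsSkewInverse.innerSy_eq (h : W.TMomFinite t) {u : ℂ[X] →ₗ[ℂ] (ℝ → ℂ)}
    (hu : W.IsSkewInverse ((2 : ℂ) • t) u) (φ ψ : ℂ[X]) :
    W.innerSy ((2 : ℂ) • t) (fn φ) (u ψ) = W.innerSk t (fn φ) (fn ψ) := by
  have hv := isSkewInverse_skInv h
  obtain ⟨z₀, hz₀⟩ := W.nonempty_E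
  have hdiff : ∀ w : ℂ[X] →ₗ[ℂ] (ℝ → ℂ), W.IsSkewInverse ((2 : ℂ) • t) w → ∀ ψ, ∀ z ∈ W.E,
      HasDerivAt (fun y => W.amp ((2 : ℂ) • t) y * w ψ y) (fn ψ z * W.trho t z) z :=
    fun w hw ψ z hz => by
      have h1 : DifferentiableAt ℝ (fun y => W.amp ((2 : ℂ) • t) y * w ψ y) z :=
        (W.hasDerivAt_amp _ hz).differentiableAt.fun_mul
          ((hw.1 ψ z hz).differentiableAt (W.isOpen_E.mem_nhds hz))
      have h2 := hw.2.1 ψ z hz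
      rw [W.nOp_eq t _ hz, inv_mul_eq_iff_eq_mul₀ (W.trho_ne_zero t hz)] at h2
      rw [mul_comm (fn ψ z), ← h2]
      exact h1.hasDerivAt
  have hex : ∀ ψ, ∃ c : ℂ, ∀ z ∈ W.E,
      u ψ z = skInv h ψ z + c / W.amp ((2 : ℂ) • t) z := fun ψ => by
    refine ⟨W.amp ((2 : ℂ) • t) z₀ * (u ψ z₀ - skInv h ψ z₀), fun z hz => ?_⟩
    have hd : ∀ z ∈ W.E, HasDerivAt (fun y => W.amp ((2 : ℂ) • t) y * u ψ y -
        W.amp ((2 : ℂ) • t) y * skInv h ψ y) 0 z := fun z hz => by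
      simpa using (hdiff u hu ψ z hz).fun_sub (hdiff _ hv ψ z hz)
    have := W.isOpen_E.is_const_of_deriv_eq_zero W.ordConnected_E.isPreconnected
      (fun z hz => (hd z hz).differentiableAt.differentiableWithinAt)
      (fun z hz => (hd z hz).deriv) hz hz₀
    have h0 := W.amp_ne_zero ((2 : ℂ) • t) z
    rw [mul_sub, ← this]
    field_simp
    ring
  choose c hc using hex
  have key : ∀ φ ψ, W.innerSy ((2 : ℂ) • t) (fn φ) (u ψ) =
      W.innerSk t (fn φ) (fn ψ) + c ψ * ∫ z, fn φ z * W.trho t z := fun φ ψ => by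
    rw [← innerSy_skInv h, innerSy, innerSy, ← integral_const_mul,
      ← integral_add (hv.2.2.2.1 φ ψ) ((h.integrable φ).const_mul _)]
    refine integral_congr_ae (Eventually.of_forall fun z => ?_)
    simp only
    by_cases hz : z ∈ W.E
    · have h0 := W.amp_ne_zero ((2 : ℂ) • t) z
      rw [hc ψ z hz, W.rho_two]
      field_simp
    · rw [rho, trho, Set.indicator_of_notMem hz, Set.indicator_of_notMem hz]
      ring
  have hskew : ∀ φ ψ, c ψ * (∫ z, fn φ z * W.trho t z) + c φ * ∫ z, fn ψ z * W.trho t z = 0 :=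
    fun φ ψ => by
      have := hu.2.2.2.2 φ ψ
      rw [W.innerSy_comm, key, key, W.innerSk_comm t (fn φ) (fn ψ)] at this
      linear_combination this
  rw [key]
  have hzero : c ψ * ∫ z, fn φ z * W.trho t z = 0 := by
    have h1 := hskew φ φ
    have h2 := hskew φ ψ
    rcases eq_or_ne (∫ z, fn φ z * W.trho t z) 0 with h0 | h0
    · rw [h0, mul_zero]
    · have hcφ : c φ = 0 := by
        rw [← add_mul] at h1
        rcases mul_eq_zero.1 h1 with h3 | h3
        · linear_combination h3 / 2
        · exact absurd h3 h0
      rwa [hcφ, zero_mul, add_zero] at h2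
  rw [hzero, add_zero]

end Weight

end TodaPfaff
end

/-! ### The matrices of `n_t` and of its inverse -/

noncomputable section

namespace TodaPfaff

namespace Weight

variable (W : Weight)

/-- The matrix of `n_t` in the basis `χ(z)`. -/
def monomialNmat (t : Times) : IMat :=
  ieval (W.f.map Complex.ofRealHom) shift ⬝∞
      (partialMat + (1 / 2 : ℂ) • ieval (derivative (xi t)) shift) -
    ieval (C (1 / 2) * (derivative W.f + W.g).map Complex.ofRealHom) shift

lemma rowFin_partialMat_add (t : Times) :
    RowFin (partialMat + (1 / 2 : ℂ) • ieval (derivative (xi t)) shift) :=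
  rowFin_partialMat.add ((rowFin_shift.ieval _).smul _)

lemma rowFin_monomialNmat (t : Times) : RowFin (W.monomialNmat t) :=
  ((rowFin_shift.ieval _).imul (rowFin_partialMat_add t)).sub (rowFin_shift.ieval _)

lemma rowp_imul_monomialNmat (t : Times) {S : IMat} (hS : RowFin S) (i : ℕ) :
    rowp (S ⬝∞ W.monomialNmat t) i = W.nPoly t (rowp S i) := by
  have h1 := rowFin_shift.ieval (W.f.map Complex.ofRealHom)
  have h2 := rowFin_shift.ieval (derivative (xi t))
  have h3 := rowFin_shift.ieval (C (1 / 2) * (derivative W.f + W.g).map Complex.ofRealHom)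
  rw [monomialNmat, imul_sub hS, ← imul_assoc hS h1, imul_add (hS.imul h1), imul_smul,
    rowp_sub (((hS.imul h1).imul rowFin_partialMat).add (((hS.imul h1).imul h2).smul _))
      (hS.imul h3),
    rowp_add ((hS.imul h1).imul rowFin_partialMat) (((hS.imul h1).imul h2).smul _),
    rowp_smul ((hS.imul h1).imul h2), rowp_imul_partialMat (hS.imul h1),
    rowp_imul_ieval_shift (hS.imul h1), rowp_imul_ieval_shift hS, rowp_imul_ieval_shift hS, nPoly,
    derivative_map, Polynomial.map_add]
  ring

lemma Nmat_eq (t : Times) {S : IMat} (hS : IsLower S) :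
    W.Nmat t S = S ⬝∞ W.monomialNmat t ⬝∞ linv S := by
  have h1 := rowFin_shift.ieval (W.f.map Complex.ofRealHom)
  have h3 := rowFin_shift.ieval (C (1 / 2) * (derivative W.f + W.g).map Complex.ofRealHom)
  have hD := rowFin_partialMat_add t
  have hl := hS.linv.rowFin
  rw [Nmat, Mmat, Lmat, ieval_conj hS rowFin_shift, ieval_conj hS rowFin_shift, monomialNmat,
    imul_sub hS.rowFin, sub_imul (hS.rowFin.imul (h1.imul hD)) (hS.rowFin.imul h3),
    imul_assoc (hS.rowFin.imul h1) hl, imul_assoc hS.rowFin hD, ← imul_assoc hl hS.rowFin,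
    hS.linv_imul, one_imul, ← imul_assoc (hS.rowFin.imul h1) hD, imul_assoc hS.rowFin h1]

lemma rowFin_Nmat (t : Times) {S : IMat} (hS : IsLower S) : RowFin (W.Nmat t S) := by
  rw [W.Nmat_eq t hS]
  exact (hS.rowFin.imul (W.rowFin_monomialNmat t)).imul hS.linv.rowFin

lemma Nmat_imul (t : Times) {S : IMat} (hS : IsLower S) :
    W.Nmat t S ⬝∞ S = S ⬝∞ W.monomialNmat t := by
  rw [W.Nmat_eq t hS, imul_assoc (hS.rowFin.imul (W.rowFin_monomialNmat t)) hS.linv.rowFin,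
    hS.linv_imul, imul_one]

lemma rowp_Nmat_imul (t : Times) {S : IMat} (hS : IsLower S) (i : ℕ) :
    rowp (W.Nmat t S ⬝∞ S) i = W.nPoly t (rowp S i) := by
  rw [W.Nmat_imul t hS, W.rowp_imul_monomialNmat t hS.rowFin]

lemma nPoly_rowPoly (t : Times) {S : IMat} (hS : IsLower S) (i : ℕ) (s : Finset ℕ)
    (h : ∀ k, k ∉ s → W.Nmat t S i k = 0) :
    W.nPoly t (rowPoly S i) = ∑ k ∈ s, W.Nmat t S i k • rowPoly S k := by
  rw [rowPoly_eq_rowp hS.isLT, ← W.rowp_Nmat_imul t hS,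
    rowp_imul (W.rowFin_Nmat t hS) hS.rowFin s h]
  simp only [rowPoly_eq_rowp hS.isLT, smul_eq_C_mul]

lemma nOp_rowPoly (t : Times) {S : IMat} (hS : IsLower S) (i : ℕ) {z : ℝ} (hz : z ∈ W.E) :
    W.nOp ((2 : ℂ) • t) (fn (rowPoly S i)) z =
      ∑ᶠ j, W.Nmat ((2 : ℂ) • t) S i j * fn (rowPoly S j) z := by
  obtain ⟨s, hs⟩ := (W.rowFin_Nmat ((2 : ℂ) • t) hS).exists_finset i
  rw [W.nOp_fn t _ hz, W.nPoly_rowPoly _ hS i s hs]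
  refine Eq.trans ?_ (finsum_eq_finsetSum_of_support_subset (s := s) _ fun k hk => ?_).symm
  · simp [fn, eval_finsetSum]
  · by_contra hc
    exact hk (by simp [hs k (by simpa using hc)])

variable {W} {t : Times}

section Inverse

variable (hm : W.MomFinite ((2 : ℂ) • t)) (h : W.TMomFinite t) {u : ℂ[X] →ₗ[ℂ] (ℝ → ℂ)}
  (hu : W.IsSkewInverse ((2 : ℂ) • t) u) {S : IMat} (hS : IsBorel S (W.mom ((2 : ℂ) • t)))

lemma innerSy_rowPoly {t : Times} (hm : W.MomFinite t) {S : IMat} (hS : IsBorel S (W.mom t))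
    (i j : ℕ) : W.innerSy t (fn (rowPoly S i)) (fn (rowPoly S j)) = (1 : IMat) i j := by
  obtain ⟨hl, h1⟩ := isBorel_iff.1 hS
  rw [W.innerSy_eq_form hm, rowPoly_eq_rowp hl.isLT, rowPoly_eq_rowp hl.isLT,
    ← congr_apply hl.rowFin hl.rowFin, h1]

include h hu in
lemma Umat_apply (S : IMat) (i j : ℕ) : W.Umat ((2 : ℂ) • t) S u i j =
    -W.innerSk t (fn (rowPoly S i)) (fn (rowPoly S j)) := by
  rw [Umat, hu.2.2.2.2, hu.innerSy_eq h]

include h hu in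
lemma neg_Umat {S : IMat} (hS : IsLower S) :
    -W.Umat ((2 : ℂ) • t) S u = S ⬝∞ W.tmom t ⬝∞ S.transpose := by
  ext i j
  rw [Matrix.neg_apply, Umat_apply h hu, neg_neg, W.innerSk_eq_form h, rowPoly_eq_rowp hS.isLT,
    rowPoly_eq_rowp hS.isLT, congr_apply hS.rowFin hS.rowFin]

include h hu in
lemma Umat_transpose (S : IMat) :
    (W.Umat ((2 : ℂ) • t) S u).transpose = -W.Umat ((2 : ℂ) • t) S u := by
  ext i j
  rw [Matrix.transpose_apply, Matrix.neg_apply, Umat_apply h hu, Umat_apply h hu, innerSk_comm]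

lemma IsSkewInverse.innerSy_nPoly {t : Times} (hu : W.IsSkewInverse t u) (φ ψ : ℂ[X]) :
    W.innerSy t (fn φ) (u (W.nPoly t ψ)) = W.innerSy t (fn φ) (fn ψ) := by
  refine integral_congr_ae (Eventually.of_forall fun z => ?_)
  by_cases hz : z ∈ W.E
  · simp only [hu.2.2.1 ψ z hz]
  · simp only [rho, Set.indicator_of_notMem hz, mul_zero]

include h hu in
/-- `⟨n φ, n ψ⟩^{sk} = ⟨n φ, ψ⟩^{sy}`, so that the matrix of `n` is skew-symmetric as well. -/
lemma innerSk_nPoly (φ ψ : ℂ[X]) : W.innerSk t (fn φ) (fn (W.nPoly ((2 : ℂ) • t) ψ)) =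
    W.innerSy ((2 : ℂ) • t) (fn φ) (fn ψ) := by
  rw [← hu.innerSy_eq h, hu.innerSy_nPoly]

include hm h hu hS

lemma Nmat_imul_Umat : W.Nmat ((2 : ℂ) • t) S ⬝∞ W.Umat ((2 : ℂ) • t) S u = 1 := by
  have hl := hS.1
  have hN := W.rowFin_Nmat ((2 : ℂ) • t) hl
  have e : W.Nmat ((2 : ℂ) • t) S ⬝∞ W.Umat ((2 : ℂ) • t) S u =
      -((W.Nmat ((2 : ℂ) • t) S ⬝∞ S) ⬝∞ W.tmom t ⬝∞ S.transpose) := by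
    rw [← neg_neg (W.Umat _ S u), neg_Umat h hu hl, imul_neg, imul_assoc hN hl.rowFin,
      imul_assoc' hN _ hl.rowFin.transpose_transpose]
  ext i j
  rw [e, Matrix.neg_apply, congr_apply (hN.imul hl.rowFin) hl.rowFin, W.rowp_Nmat_imul _ hl,
    ← W.innerSk_eq_form h, W.innerSk_comm, neg_neg, innerSk_nPoly h hu, ← rowPoly_eq_rowp hl.isLT,
    ← rowPoly_eq_rowp hl.isLT, innerSy_rowPoly hm hS]
  exact Matrix.one_apply.trans ((if_congr eq_comm rfl rfl).trans Matrix.one_apply.symm)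

lemma Nmat_transpose : (W.Nmat ((2 : ℂ) • t) S).transpose = -W.Nmat ((2 : ℂ) • t) S := by
  obtain ⟨hl, h1⟩ := isBorel_iff.1 hS
  have hN := W.rowFin_Nmat ((2 : ℂ) • t) hl
  have key : ∀ i j, W.Nmat ((2 : ℂ) • t) S i j =
      W.innerSk t (fn (W.nPoly ((2 : ℂ) • t) (rowp S i)))
        (fn (W.nPoly ((2 : ℂ) • t) (rowp S j))) := fun i j => by
    rw [innerSk_nPoly h hu, W.innerSy_eq_form hm, ← W.rowp_Nmat_imul _ hl,
      ← congr_apply (hN.imul hl.rowFin) hl.rowFin, imul_assoc hN hl.rowFin,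
      imul_assoc' hN _ hl.rowFin.transpose_transpose, h1, imul_one]
  ext i j
  rw [Matrix.transpose_apply, Matrix.neg_apply, key, key, W.innerSk_comm]

lemma Umat_imul_Nmat : W.Umat ((2 : ℂ) • t) S u ⬝∞ W.Nmat ((2 : ℂ) • t) S = 1 := by
  have e := congrArg Matrix.transpose (Nmat_imul_Umat hm h hu hS)
  rwa [imul_transpose, Umat_transpose h hu, Nmat_transpose hm h hu hS, neg_imul, imul_neg, neg_neg,
    Matrix.transpose_one] at e

end Inverse

end Weight

/-! ### The two lattices and the map between them -/

lemma natDegree_rowp {A : IMat} (hA : IsLower A) (i : ℕ) : (rowp A i).natDegree = i :=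
  natDegree_eq_of_le_of_coeff_ne_zero
    (natDegree_le_iff_coeff_eq_zero.2 fun j hj => by
      rw [hA.rowFin.coeff_rowp, hA.1 i j hj])
    (by rw [hA.rowFin.coeff_rowp]; exact hA.2 i)

lemma HasEntryDeriv.mono {F : ℂ → IMat} {D : IMat} {A B : Set ℂ} (hF : HasEntryDeriv F D B)
    (hAB : A ⊆ B) : HasEntryDeriv F D A := fun i j => (hF i j).mono hAB

/-- The map at a given time, in terms of the dressing matrix `Q = O S` of the skew moments. -/
lemma isMapO_iff {W : Weight} {t : Times} (h : W.TMomFinite t) {u : ℂ[X] →ₗ[ℂ] (ℝ → ℂ)}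
    (hu : W.IsSkewInverse ((2 : ℂ) • t) u) {S : IMat} (hS : IsLower S) (O : IMat) :
    IsMapO (W.Umat ((2 : ℂ) • t) S u) S O ↔ IsLower O ∧ InGk (O ⬝∞ S) ∧
      (O ⬝∞ S) ⬝∞ W.tmom t ⬝∞ (O ⬝∞ S).transpose = Jmat := by
  rw [IsMapO, Weight.neg_Umat h hu hS, and_comm (b := InGk _)]
  refine and_congr_right fun hO => and_congr_right fun _ => ?_
  rw [hO.congr_eq_iff, congr_imul hO.rowFin hS.rowFin]

variable {W : Weight}

lemma Weight.MomFinite.exists_toda_curve {t : Times} (h : W.MomFinite t) {S : IMat}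
    (hS : IsBorel S (W.mom t)) (k : ℕ+) : ∃ Sc : ℂ → IMat,
      IsTodaCurve W t k {s | W.MomFinite (move t k s)} S Sc ∧
      HasEntryDeriv (fun s => Lmat (Sc s))
        ((1 / 2 : ℂ) • icomm (skewPart (ipow (Lmat S) k)) (Lmat S))
        {s | W.MomFinite (move t k s)} := by
  have h0 : W.mom (move t k 0) = W.mom t := by rw [move_zero]
  obtain ⟨Sc, hSc0, hl, hc, hd⟩ := TodaPfaff.exists_toda_curve
    (m := fun s => W.mom (move t k s)) (A := {s | W.MomFinite (move t k s)}) (S := S)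
    (by rwa [h0]) (fun s => W.mom_transpose _) k
    (by rw [h0]; exact h.hasEntryDeriv k)
    (W.shift_mom_transpose _ _)
    (uniqueDiffWithinAt_of_imaginary fun y => h.imaginary k y)
  refine ⟨Sc, ⟨hSc0, hl, fun i j => ?_⟩, hd⟩
  filter_upwards [hc i j, self_mem_nhdsWithin] with s hs hsA
  rw [W.innerSy_eq_form hsA]
  exact hs

/-- The Pfaff lattice. The curve `S` at time `2(t + s eₖ)` is a Toda curve at time `2t` with
parameter `2s`. -/
lemma Weight.TMomFinite.exists_pfaff_curve {t : Times} (h : W.TMomFinite t)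
    (hm : W.MomFinite ((2 : ℂ) • t)) {S O : IMat} (hS : IsBorel S (W.mom ((2 : ℂ) • t)))
    (hO : IsLower O) (hQ : InGk (O ⬝∞ S))
    (hJ : (O ⬝∞ S) ⬝∞ W.tmom t ⬝∞ (O ⬝∞ S).transpose = Jmat) (k : ℕ+) :
    ∃ Sc Oc : ℂ → IMat,
      IsPfaffCurve W t k {s | W.MomFinite ((2 : ℂ) • move t k s) ∧ W.TMomFinite (move t k s)}
        S O Sc Oc ∧
      HasEntryDeriv (fun s => tLmat (Oc s) (Sc s))
        (icomm (-piK (ipow (tLmat O S) k)) (tLmat O S))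
        {s | W.MomFinite ((2 : ℂ) • move t k s) ∧ W.TMomFinite (move t k s)} := by
  obtain ⟨Sc, ⟨hSc0, hSl, hSc⟩, -⟩ := hm.exists_toda_curve hS k
  have h0 : W.tmom (move t k 0) = W.tmom t := by rw [move_zero]
  set A := {s | W.MomFinite ((2 : ℂ) • move t k s) ∧ W.TMomFinite (move t k s)} with hA
  have hAu : UniqueDiffWithinAt ℂ A 0 := uniqueDiffWithinAt_of_imaginary fun y => by
    refine ⟨?_, h.imaginary k y⟩
    rw [two_smul_move]
    have := hm.imaginary k (2 * y)
    rwa [Complex.ofReal_mul, Complex.ofReal_ofNat, mul_assoc] at this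
  obtain ⟨Qc, hQc0, hQG, hQc, hQd⟩ := TodaPfaff.exists_pfaff_curve
    (m := fun s => W.tmom (move t k s)) (A := A) (Q := O ⬝∞ S) hQ
    (by rw [h0]; exact hJ) (fun s => W.tmom_transpose _) k
    (by rw [h0]; exact (h.hasEntryDeriv k).mono fun s hs => hs.2) hAu
  have hOl : ∀ s, IsLower (Qc s ⬝∞ linv (Sc (2 * s))) := fun s =>
    (hQG s).1.imul (hSl _).linv
  have hOS : ∀ s, Qc s ⬝∞ linv (Sc (2 * s)) ⬝∞ Sc (2 * s) = Qc s := fun s => by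
    rw [imul_assoc (hQG s).1.rowFin (hSl _).linv.rowFin, (hSl _).linv_imul, imul_one]
  refine ⟨fun s => Sc (2 * s), fun s => Qc s ⬝∞ linv (Sc (2 * s)),
    ⟨by simp only [mul_zero, hSc0], ?_, fun s => ⟨hSl _, hOl s, by rw [hOS]; exact hQG s⟩,
      fun i j => ?_⟩, ?_⟩
  · simp only [mul_zero, hSc0, hQc0]
    rw [imul_assoc hO.rowFin hS.1.rowFin, hS.1.imul_linv, imul_one]
  · have ht : Tendsto (fun s : ℂ => 2 * s) (𝓝[A] 0)
        (𝓝[{s | W.MomFinite (move ((2 : ℂ) • t) k s)}] 0) := by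
      refine tendsto_nhdsWithin_iff.2 ⟨?_, ?_⟩
      · have : Continuous fun s : ℂ => 2 * s := by fun_prop
        simpa using (this.tendsto 0).mono_left nhdsWithin_le_nhds
      · filter_upwards [self_mem_nhdsWithin] with s hs
        have := hs.1
        rwa [two_smul_move] at this
    filter_upwards [ht.eventually (hSc i j), hQc i j, self_mem_nhdsWithin] with s h1 h2 h3
    refine ⟨by rw [two_smul_move]; exact h1, ?_⟩
    rw [W.innerSk_eq_form h3.2, mapPoly_eq_rowp (hOl s).isLT (hSl _).isLT,
      mapPoly_eq_rowp (hOl s).isLT (hSl _).isLT, hOS]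
    exact h2
  · simp only [tLmat_eq (hOl _) (hSl _), hOS, tLmat_eq hO hS.1]
    exact hQd

end TodaPfaff

end

theorem proposition6p1 (W : Weight) :
    -- the Toda lattice
    (∀ t : Times, W.MomFinite t →
      (∀ n : ℕ,
        IntegrableOn (fun c => expTr W.V t (hermMat c)) (hermSet W.E n) (hermHaar n) ∧
        W.tau n t = (1 / (n.factorial : ℂ)) *
          ∫ c in hermSet W.E n, expTr W.V t (hermMat c) ∂hermHaar n) ∧
      ((∀ k, (t k).im = 0) → ∀ n, W.tau n t ≠ 0) ∧
      (∀ k : ℕ+,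
        HasEntryDeriv (fun s => W.mom (move t k s)) (ipow shift k ⬝∞ W.mom t)
          {s | W.MomFinite (move t k s)} ∧
        ipow shift k ⬝∞ W.mom t = W.mom t ⬝∞ (ipow shift k).transpose) ∧
      ((∀ n, W.tau n t ≠ 0) →
        (∃ S, IsBorel S (W.mom t)) ∧
        ∀ S, IsBorel S (W.mom t) →
          (∀ i, (rowPoly S i).natDegree = i) ∧
          (∀ i j, W.innerSy t (fn (rowPoly S i)) (fn (rowPoly S j)) = (1 : IMat) i j) ∧
          (∀ n, S n n ^ 2 = W.tau n t / W.tau (n + 1) t) ∧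
          ∀ k : ℕ+, ∃ Sc : ℂ → IMat,
            IsTodaCurve W t k {s | W.MomFinite (move t k s)} S Sc ∧
            HasEntryDeriv (fun s => Lmat (Sc s))
              ((1 / 2 : ℂ) • icomm (skewPart (ipow (Lmat S) k)) (Lmat S))
              {s | W.MomFinite (move t k s)})) ∧
    -- the skew inner product and the symmetric matrix integrals
    (∀ t : Times, W.TMomFinite t →
      (∀ z ∈ W.E, W.trho t z ^ 2 = W.rho ((2 : ℂ) • t) z / ((W.f.eval z : ℝ) : ℂ)) ∧
      (∀ φ ψ : ℂ[X], Integrable (W.skIntegrand t (fn φ) (fn ψ))) ∧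
      (W.tmom t).transpose = -W.tmom t ∧
      (∀ k : ℕ+,
        HasEntryDeriv (fun s => W.tmom (move t k s))
          (ipow shift k ⬝∞ W.tmom t + W.tmom t ⬝∞ (ipow shift k).transpose)
          {s | W.TMomFinite (move t k s)}) ∧
      (∀ n : ℕ,
        IntegrableOn (fun c => expTr W.tV t (symMat c)) (symSet W.E (2 * n)) (symHaar (2 * n)) ∧
        W.ttau n t = (1 / ((-2) ^ n * ((2 * n).factorial : ℂ))) *
          ∫ c in symSet W.E (2 * n), expTr W.tV t (symMat c) ∂symHaar (2 * n)) ∧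
      ((∀ k, (t k).im = 0) → ∀ n, W.ttau n t ≠ 0)) ∧
    -- the map from the Toda lattice at time `2t` to the Pfaff lattice at time `t`
    (∀ t : Times, W.MomFinite ((2 : ℂ) • t) → W.TMomFinite t →
      (∃ u, W.IsSkewInverse ((2 : ℂ) • t) u) ∧
      ∀ u, W.IsSkewInverse ((2 : ℂ) • t) u →
        (∀ φ ψ : ℂ[X], W.innerSy ((2 : ℂ) • t) (fn φ) (u ψ) = W.innerSk t (fn φ) (fn ψ)) ∧
        ((∀ n, W.tau n ((2 : ℂ) • t) ≠ 0) →
          ∀ S, IsBorel S (W.mom ((2 : ℂ) • t)) →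
            (∀ i, ∀ z ∈ W.E, W.nOp ((2 : ℂ) • t) (fn (rowPoly S i)) z =
              ∑ᶠ j, W.Nmat ((2 : ℂ) • t) S i j * fn (rowPoly S j) z) ∧
            (W.Umat ((2 : ℂ) • t) S u).transpose = -W.Umat ((2 : ℂ) • t) S u ∧
            W.Nmat ((2 : ℂ) • t) S ⬝∞ W.Umat ((2 : ℂ) • t) S u = 1 ∧
            W.Umat ((2 : ℂ) • t) S u ⬝∞ W.Nmat ((2 : ℂ) • t) S = 1 ∧
            ((∀ n, W.ttau n t ≠ 0) →
              (∃ O, IsMapO (W.Umat ((2 : ℂ) • t) S u) S O) ∧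
              ∀ O, IsMapO (W.Umat ((2 : ℂ) • t) S u) S O →
                (∀ i, (mapPoly O S i).natDegree = i) ∧
                (∀ i j, W.innerSk t (fn (mapPoly O S i)) (fn (mapPoly O S j)) = Jmat i j) ∧
                (∀ n, (O ⬝∞ S) (2 * n) (2 * n) ^ 2 = W.ttau n t / W.ttau (n + 1) t) ∧
                ∀ k : ℕ+, ∃ Sc Oc : ℂ → IMat,
                  IsPfaffCurve W t k
                    {s | W.MomFinite ((2 : ℂ) • move t k s) ∧ W.TMomFinite (move t k s)}
                    S O Sc Oc ∧
                  HasEntryDeriv (fun s => tLmat (Oc s) (Sc s))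
                    (icomm (-piK (ipow (tLmat O S) k)) (tLmat O S))
                    {s | W.MomFinite ((2 : ℂ) • move t k s) ∧
                      W.TMomFinite (move t k s)}))) := by
  refine ⟨fun t h => ⟨h.tau_eq, h.tau_ne_zero, fun k => ⟨h.hasEntryDeriv k, W.shift_mom t k⟩,
      fun hτ => ⟨exists_isBorel (W.mom_transpose t) hτ, fun S hS =>
        ⟨fun i => ?_, Weight.innerSy_rowPoly h hS, hS.diag_sq, h.exists_toda_curve hS⟩⟩⟩,
    fun t h => ⟨fun z => W.trho_sq t, h.integrable_skIntegrand, W.tmom_transpose t,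
      h.hasEntryDeriv, h.ttau_eq, h.ttau_ne_zero⟩,
    fun t hm h => ⟨⟨_, Weight.isSkewInverse_skInv h⟩, fun u hu => ⟨hu.innerSy_eq h,
      fun _ S hS => ⟨fun i z => W.nOp_rowPoly t hS.1 i, Weight.Umat_transpose h hu S,
        Weight.Nmat_imul_Umat hm h hu hS, Weight.Umat_imul_Nmat hm h hu hS,
        fun hpf => ⟨?_, fun O hO => ?_⟩⟩⟩⟩⟩
  · rw [rowPoly_eq_rowp hS.1.isLT, natDegree_rowp hS.1]
  · obtain ⟨Q, hQ, hJ⟩ := exists_inGk_congr (W.tmom_transpose t) hpf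
    have e : Q ⬝∞ linv S ⬝∞ S = Q := by
      rw [imul_assoc hQ.1.rowFin hS.1.linv.rowFin, hS.1.linv_imul, imul_one]
    refine ⟨Q ⬝∞ linv S, (isMapO_iff h hu hS.1 _).2 ⟨hQ.1.imul hS.1.linv, ?_⟩⟩
    rw [e]
    exact ⟨hQ, hJ⟩
  · obtain ⟨hl, hQ, hJ⟩ := (isMapO_iff h hu hS.1 O).1 hO
    refine ⟨fun i => ?_, fun i j => ?_, hQ.diag_sq hJ, h.exists_pfaff_curve hm hS hl hQ hJ⟩
    · rw [mapPoly_eq_rowp hl.isLT hS.1.isLT, natDegree_rowp hQ.1]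
    · rw [W.innerSk_eq_form h, mapPoly_eq_rowp hl.isLT hS.1.isLT,
        mapPoly_eq_rowp hl.isLT hS.1.isLT, ← congr_apply hQ.1.rowFin hQ.1.rowFin, hJ]
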